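/- Let $n\in\{2,3\}$, $L>0$, $T>0$, $\sigma\neq 0$, $Q=(0,L]^n$, and $\|w\|=\big(\int_Q|w(x)|^2dx\big)^{1/2}$. All functions of $x\in\mathbf R^n$ are periodic with period $L$ in each coordinate. Let $(u,p)$ be a classical solution of the incompressible Navier--Stokes equations in negative direction of time $$\frac{\partial u}{\partial t}+\frac{\sigma^2}{2}\Delta u-(u,\nabla)u-\nabla p+f=0,\quad 0\le t<T,\qquad \operatorname{div}u=0,\qquad u(T,x)=\varphi(x),$$ with zero space average $\int_Q u(t,x)\,dx=0$ for $0\le t\le T$, where $u$ is of class $C^3$ on $[0,T]\times\mathbf R^n$ and $p(t,\cdot)$ is of class $C^2$. Put $\omega=\operatorname{curl}u$ and $g=\operatorname{curl}f$, where for $n=2$ the curl is the scalar $\operatorname{curl}v=\partial v^2/\partial x^1-\partial v^1/\partial x^2$. Let $U$ be the periodic Biot--Savart operator. With $w_m=L^{-n}\int_Q w(x)e^{-i(2\pi/L)(m,x)}dx$, $$Uw(x)=\frac{iL}{2\pi}\sum_{m\in\mathbf Z^3,\,m\ne0}\frac{m\times w_m}{|m|^2}\,e^{i(2\pi/L)(m,x)}\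 \ (n=3),\qquad Uw(x)=\frac{iL}{2\pi}\sum_{m\in\mathbf Z^2,\,m\ne0}\frac{w_m}{|m|^2}\begin{pmatrix}m^2\\-m^1\end{pmatrix}e^{i(2\pi/L)(m,x)}\ \ (n=2).$$ For $N\ge1$ put $h=T/N$ and $t_k=kh$. A frozen-velocity approximation of the vorticity with $N$ steps consists of functions $\tilde\omega_k$, $k=N-1,\dots,0$, each continuous on $[t_k,t_{k+1}]\times\mathbf R^n$ and with $\partial_t\tilde\omega_k$ and the space derivatives up to order two continuous on $[t_k,t_{k+1})\times\mathbf R^n$, such that, with the frozen velocity $\hat u_k(x)=U\tilde\omega_k(t_{k+1},\cdot)(x)$, $$\frac{\partial\tilde\omega_k}{\partial t}+\frac{\sigma^2}{2}\Delta\tilde\omega_k-(\hat u_k,\nabla)\tilde\omega_k+(\tilde\omega_k,\nabla)\hat u_k+g=0,\qquad t_k\le t<t_{k+1},$$ (for $n=2$, where $\tilde\omega_k$ is scalar, the term $(\tilde\omega_k,\nabla)\hat u_k$ is absent), and $$\tilde\omega_{N-1}(t_N,\cdot)=\operatorname{curl}\varphi,\qquad \tilde\omega_k(t_{k+1},\cdot)=\tilde\omega_{k+1}(t_{k+1},\cdot),\quad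 k=N-2,\dots,0.$$ Theorem. The approximation $\tilde\omega_k$ converges to $\omega$ with order $1$ in the $L^2$-norm: there is a constant $K$, which may depend on $n,L,T,\sigma$ and on the data and solution $f,\varphi,u,p$ but not on $N$, $k$, $t$ or the approximation, such that for every $N\ge1$ and every frozen-velocity approximation $(\tilde\omega_k)$ with $N$ steps $$\|\omega(t,\cdot)-\tilde\omega_k(t,\cdot)\|\le K\,h,\qquad t_k\le t\le t_{k+1},\quad k=0,\dots,N-1.$$ -/

import Mathlib

open Set MeasureTheory
open scoped Laplacian

noncomputable section

namespace PeriodicNSE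

/-- Euclidean space `ℝⁿ`. -/
abbrev E (n : ℕ) : Type := EuclideanSpace ℝ (Fin n)

/-- The period cell `Q = (0, L]ⁿ`. -/
def cell (n : ℕ) (L : ℝ) : Set (E n) := {x | ∀ i, x i ∈ Ioc 0 L}

/-- `w` is periodic with period `L` in each coordinate direction. -/
def IsPeriodic {n : ℕ} {F : Type*} (L : ℝ) (w : E n → F) : Prop :=
  ∀ (x : E n) (i : Fin n), w (x + L • EuclideanSpace.single i (1 : ℝ)) = w x

/-- The `L²(Q)` norm. -/
def l2Norm {n : ℕ} {F : Type*} [NormedAddCommGroup F] (L : ℝ) (w : E n → F) : ℝ :=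
  Real.sqrt (∫ x in cell n L, ‖w x‖ ^ 2)

/-- The partial derivative `∂w/∂xⁱ`. -/
def partialDeriv {n : ℕ} {F : Type*} [NormedAddCommGroup F] [NormedSpace ℝ F]
    (i : Fin n) (w : E n → F) (x : E n) : F :=
  fderiv ℝ w x (EuclideanSpace.single i (1 : ℝ))

/-- The divergence of a vector field on `ℝⁿ`. -/
def div {n : ℕ} (v : E n → E n) (x : E n) : ℝ := ∑ i, partialDeriv i v x i

/-- The advection operator `(v, ∇)w = ∑ⱼ vʲ ∂w/∂xʲ`. -/
def advect {n : ℕ} {F : Type*} [NormedAddCommGroup F] [NormedSpace ℝ F]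
    (v : E n → E n) (w : E n → F) (x : E n) : F :=
  ∑ j, v x j • partialDeriv j w x

/-- The scalar curl of a planar vector field. -/
def curl2 (v : E 2 → E 2) (x : E 2) : ℝ :=
  partialDeriv 0 v x 1 - partialDeriv 1 v x 0

/-- The curl of a vector field on `ℝ³`. -/
def curl3 (v : E 3 → E 3) (x : E 3) : E 3 :=
  !₂[partialDeriv 1 v x 2 - partialDeriv 2 v x 1,
     partialDeriv 2 v x 0 - partialDeriv 0 v x 2,
     partialDeriv 0 v x 1 - partialDeriv 1 v x 0]

/-- The exponential `exp (i (2π/L) (m, x))`, `m ∈ ℤⁿ`. -/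
def character {n : ℕ} (L : ℝ) (m : Fin n → ℤ) (x : E n) : ℂ :=
  Complex.exp (Complex.I * ((2 * Real.pi / L * ∑ j, (m j : ℝ) * x j : ℝ) : ℂ))

/-- The Fourier coefficient `w_m = L⁻ⁿ ∫_Q w(x) exp (-i (2π/L) (m, x)) dx`. -/
def coeff {n : ℕ} (L : ℝ) (w : E n → ℝ) (m : Fin n → ℤ) : ℂ :=
  ((L ^ n : ℝ) : ℂ)⁻¹ * ∫ x in cell n L, (w x : ℂ) * character L (-m) x

/-- `|m|²` for a lattice vector `m ∈ ℤⁿ`. -/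
def normSq {n : ℕ} (m : Fin n → ℤ) : ℂ := ∑ j, (m j : ℂ) ^ 2

/-- The periodic Biot-Savart operator `U` in dimension two:
`Uω = (iL/2π) ∑_{m ≠ 0} |m|⁻² exp (i (2π/L) (m, x)) (ω_m m², -ω_m m¹)`.
The term `m = 0` vanishes. The sum is real for real `ω`; `re` only changes its type. -/
def biotSavart2 (L : ℝ) (w : E 2 → ℝ) (x : E 2) : E 2 :=
  WithLp.toLp 2 fun i =>
    (Complex.I * L / (2 * Real.pi) * ∑' m : Fin 2 → ℤ, (normSq m)⁻¹ * character L m x *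
      (![coeff L w m * m 1, -(coeff L w m * m 0)] : Fin 2 → ℂ) i).re

/-- The periodic Biot-Savart operator `U` in dimension three:
`Uω = (iL/2π) ∑_{m ≠ 0} |m|⁻² exp (i (2π/L) (m, x)) m × ω_m`.
The term `m = 0` vanishes. The sum is real for real `ω`; `re` only changes its type. -/
def biotSavart3 (L : ℝ) (w : E 3 → E 3) (x : E 3) : E 3 :=
  WithLp.toLp 2 fun i =>
    (Complex.I * L / (2 * Real.pi) * ∑' m : Fin 3 → ℤ, (normSq m)⁻¹ * character L m x *
      crossProduct (fun j => (m j : ℂ)) (fun j => coeff L (fun y => w y j) m) i).re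

/-- `(u, p)` is a classical solution, with `u` of class `C³` on `[0, T] × ℝⁿ`, of the
`L`-periodic incompressible Navier-Stokes equations in negative direction of time,
`∂u/∂t + (σ²/2) Δu - (u, ∇)u - ∇p + f = 0`, `div u = 0`, `u(T, ·) = φ`,
with zero space average. At `t = 0` the time derivative is the one-sided one. -/
structure IsNSESolution {n : ℕ} (L T σ : ℝ) (f : ℝ → E n → E n) (φ : E n → E n)
    (u : ℝ → E n → E n) (p : ℝ → E n → ℝ) : Prop where
  smooth_velocity : ContDiffOn ℝ 3 (fun q : ℝ × E n => u q.1 q.2) (Icc 0 T ×ˢ univ)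
  smooth_pressure : ∀ t ∈ Ico 0 T, ContDiff ℝ 2 (p t)
  periodic_velocity : ∀ t ∈ Icc 0 T, IsPeriodic L (u t)
  periodic_pressure : ∀ t ∈ Ico 0 T, IsPeriodic L (p t)
  periodic_force : ∀ t ∈ Ico 0 T, IsPeriodic L (f t)
  momentum : ∀ t ∈ Ico 0 T, ∀ x,
    derivWithin (fun s => u s x) (Icc 0 T) t + (σ ^ 2 / 2) • (Δ (u t)) x
      - advect (u t) (u t) x - gradient (p t) x + f t x = 0
  div_free : ∀ t ∈ Icc 0 T, ∀ x, div (u t) x = 0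
  terminal : u T = φ
  mean_zero : ∀ t ∈ Icc 0 T, ∫ x in cell n L, u t x = 0

/-- The regularity of a classical solution of a backward parabolic equation on `[a, b)`:
`w` is continuous on `[a, b] × ℝⁿ`, and `∂w/∂t` and the space derivatives of `w` up to order
two exist and are continuous on `[a, b) × ℝⁿ`. -/
structure IsClassicalOn {n : ℕ} {F : Type*} [NormedAddCommGroup F] [NormedSpace ℝ F]
    (a b : ℝ) (w : ℝ → E n → F) : Prop where
  continuous : ContinuousOn (fun q : ℝ × E n => w q.1 q.2) (Icc a b ×ˢ univ)
  time_diff : ∀ t ∈ Ico a b, ∀ x, DifferentiableWithinAt ℝ (fun s => w s x) (Icc a b) t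
  time_cont : ContinuousOn
    (fun q : ℝ × E n => derivWithin (fun s => w s q.2) (Icc a b) q.1) (Ico a b ×ˢ univ)
  space_diff : ∀ t ∈ Ico a b, ContDiff ℝ 2 (w t)
  space_cont_one : ContinuousOn
    (fun q : ℝ × E n => fderiv ℝ (w q.1) q.2) (Ico a b ×ˢ univ)
  space_cont_two : ContinuousOn
    (fun q : ℝ × E n => fderiv ℝ (fderiv ℝ (w q.1)) q.2) (Ico a b ×ˢ univ)

/-- The grid points `t_k = k h` with `h = T / N`. -/
def gridTime (T : ℝ) (N k : ℕ) : ℝ := k * (T / N)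

/-- `w k`, `k = 0, …, N - 1`, is the frozen-velocity approximation of the vorticity on
`[t_k, t_{k+1}]` in dimension two: with the frozen velocity `û_k = U w_k(t_{k+1}, ·)`,
`∂w_k/∂t + (σ²/2) Δw_k - (û_k, ∇)w_k + curl f = 0` on `[t_k, t_{k+1})`, and
`w_k(t_{k+1}, ·)` is `curl φ` for `k = N - 1` and `w_{k+1}(t_{k+1}, ·)` for `k < N - 1`. -/
structure IsFrozenApprox2 (L T σ : ℝ) (f : ℝ → E 2 → E 2) (φ : E 2 → E 2) (N : ℕ)
    (w : ℕ → ℝ → E 2 → ℝ) : Prop where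
  classical : ∀ k < N, IsClassicalOn (gridTime T N k) (gridTime T N (k + 1)) (w k)
  periodic : ∀ k < N, ∀ t ∈ Icc (gridTime T N k) (gridTime T N (k + 1)), IsPeriodic L (w k t)
  equation : ∀ k < N, ∀ t ∈ Ico (gridTime T N k) (gridTime T N (k + 1)), ∀ x,
    derivWithin (fun s => w k s x) (Icc (gridTime T N k) (gridTime T N (k + 1))) t
      + (σ ^ 2 / 2) * (Δ (w k t)) x
      - advect (biotSavart2 L (w k (gridTime T N (k + 1)))) (w k t) x
      + curl2 (f t) x = 0
  terminal : ∀ k < N, w k (gridTime T N (k + 1)) =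
    if k + 1 = N then curl2 φ else w (k + 1) (gridTime T N (k + 1))

/-- `w k`, `k = 0, …, N - 1`, is the frozen-velocity approximation of the vorticity on
`[t_k, t_{k+1}]` in dimension three: with the frozen velocity `û_k = U w_k(t_{k+1}, ·)`,
`∂w_k/∂t + (σ²/2) Δw_k - (û_k, ∇)w_k + (w_k, ∇)û_k + curl f = 0` on `[t_k, t_{k+1})`, and
`w_k(t_{k+1}, ·)` is `curl φ` for `k = N - 1` and `w_{k+1}(t_{k+1}, ·)` for `k < N - 1`. -/
structure IsFrozenApprox3 (L T σ : ℝ) (f : ℝ → E 3 → E 3) (φ : E 3 → E 3) (N : ℕ)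
    (w : ℕ → ℝ → E 3 → E 3) : Prop where
  classical : ∀ k < N, IsClassicalOn (gridTime T N k) (gridTime T N (k + 1)) (w k)
  periodic : ∀ k < N, ∀ t ∈ Icc (gridTime T N k) (gridTime T N (k + 1)), IsPeriodic L (w k t)
  equation : ∀ k < N, ∀ t ∈ Ico (gridTime T N k) (gridTime T N (k + 1)), ∀ x,
    derivWithin (fun s => w k s x) (Icc (gridTime T N k) (gridTime T N (k + 1))) t
      + (σ ^ 2 / 2) • (Δ (w k t)) x
      - advect (biotSavart3 L (w k (gridTime T N (k + 1)))) (w k t) x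
      + advect (w k t) (biotSavart3 L (w k (gridTime T N (k + 1)))) x
      + curl3 (f t) x = 0
  terminal : ∀ k < N, w k (gridTime T N (k + 1)) =
    if k + 1 = N then curl3 φ else w (k + 1) (gridTime T N (k + 1))

end PeriodicNSE

end

/-!
In both dimensions the curl is encoded by the skew tensor `∂_i v_j - ∂_j v_i`, and the Biot–Savart
operator by `∑ⱼ ∂_j (-Δ)⁻¹ W_ij`. Parseval's identity then bounds the `H¹` norm of the velocity
`u(t) - û_k` by the vorticity error at `t_{k+1}`, up to an error of order `h` from the
variation of `u` in time.

The vorticity error `z = ω - w_k` satisfies a backward parabolic equation, whose energy identity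
bounds the rate of change of `y = ‖z‖²`. The transport by `û_k` does not contribute, because `û_k`
is divergence-free. The terms that are linear in `z` are estimated by the smoothness of `u`. In
dimension three there remains the stretching of `z` by the velocity error, which is cubic in the
errors: the Sobolev embedding `H¹ ⊂ L⁶` and Young's inequality absorb it into the dissipation, at
the price of a growth rate that depends on `y(t_{k+1})`.

Gronwall's inequality on a single step thus gives `y(t) ≤ e^{3Ch} (y(t_{k+1}) + C h³)` as long as
`y(t_{k+1}) ≤ 1`. Accumulated over the steps this keeps `y` of order `h²`, which is less than one
for small `h`, so the bound propagates from `t = T` down to `t = 0`.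
-/

namespace PeriodicNSE

variable {n : ℕ} {L T σ : ℝ}

/-! ### Periodic functions and the period cell -/

/-- The covering map `ℝⁿ → (ℝ/ℤ)ⁿ`, `x ↦ x / L`, through which the `L`-periodic functions are
identified with the functions on the unit torus. -/
noncomputable def toTorus (n : ℕ) (L : ℝ) (x : E n) : UnitAddTorus (Fin n) :=
  fun i => ((x i / L : ℝ) : UnitAddCircle)

/-- The normalized Haar measure of the unit torus. -/
noncomputable def torusMeasure (n : ℕ) : Measure (UnitAddTorus (Fin n)) :=
  Measure.pi fun _ => AddCircle.haarAddCircle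

instance : IsProbabilityMeasure (torusMeasure n) := by
  unfold torusMeasure; infer_instance

instance : (torusMeasure n).IsAddLeftInvariant := by
  unfold torusMeasure; infer_instance

lemma toTorus_add (x y : E n) : toTorus n L (x + y) = toTorus n L x + toTorus n L y := by
  funext i
  simp [toTorus, add_div]

lemma isOpenQuotientMap_toTorus (hL : 0 < L) : IsOpenQuotientMap (toTorus n L) := by
  have isOpenQuotientMap_coe :
      IsOpenQuotientMap (Pi.map fun (_ : Fin n) (s : ℝ) => (s : UnitAddCircle)) :=
    IsOpenQuotientMap.piMap fun _ => QuotientAddGroup.isOpenQuotientMap_mk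
  let rescale : E n ≃ₜ (Fin n → ℝ) :=
    (PiLp.homeomorph 2 fun _ : Fin n => ℝ).trans (Homeomorph.smulOfNeZero L⁻¹ (inv_ne_zero hL.ne'))
  convert! isOpenQuotientMap_coe.comp rescale.isOpenQuotientMap using 1
  funext x i
  simp [toTorus, rescale, PiLp.homeomorph, div_eq_inv_mul]

lemma IsPeriodic.eq_of_int {F : Type*} {w : E n → F} (hw : IsPeriodic L w) {x y : E n}
    (h : ∀ i, ∃ k : ℤ, y i = x i + k * L) : w y = w x := by
  choose k hk using h
  have translate_eq (s : Finset (Fin n)) :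
      ∀ x, w (x + ∑ i ∈ s, k i • (L • EuclideanSpace.single i (1 : ℝ))) = w x := by
    induction s using Finset.induction_on with
    | empty => simp
    | insert a s ha ih =>
      intro x
      have hwa : Function.Periodic w (L • EuclideanSpace.single a (1 : ℝ)) := fun x => hw x a
      rw [Finset.sum_insert ha, add_comm (k a • _), ← add_assoc, hwa.zsmul (k a), ih]
  have y_eq : y = x + ∑ i, k i • (L • EuclideanSpace.single i (1 : ℝ)) := by
    ext j
    simp [hk, Finset.sum_apply, Pi.single_apply, mul_comm]
  rw [y_eq, translate_eq]

lemma IsPeriodic.eq_of_toTorus {F : Type*} (hL : 0 < L) {w : E n → F} (hw : IsPeriodic L w)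
    {x y : E n} (h : toTorus n L x = toTorus n L y) : w x = w y := by
  refine hw.eq_of_int fun i => ?_
  have hi := congrFun h i
  simp only [toTorus] at hi
  rw [← sub_eq_zero, ← AddCircle.coe_sub, AddCircle.coe_eq_zero_iff] at hi
  obtain ⟨k, hk⟩ := hi
  refine ⟨k, ?_⟩
  simp only [zsmul_eq_mul, mul_one] at hk
  field_simp at hk
  linarith

lemma IsPeriodic.exists_lift {F : Type*} [TopologicalSpace F] (hL : 0 < L) {w : E n → F}
    (hw : IsPeriodic L w) (hc : Continuous w) :
    ∃ W : C(UnitAddTorus (Fin n), F), ∀ x, W (toTorus n L x) = w x := by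
  have quotient := (isOpenQuotientMap_toTorus (n := n) hL).isQuotientMap
  let π : C(E n, UnitAddTorus (Fin n)) := ⟨toTorus n L, quotient.continuous⟩
  have hπ : Topology.IsQuotientMap π := quotient
  have factors : Function.FactorsThrough w π := fun _ _ hxy => hw.eq_of_toTorus hL hxy
  exact ⟨hπ.lift ⟨w, hc⟩ factors, DFunLike.congr_fun (hπ.lift_comp ⟨w, hc⟩ factors)⟩

lemma measurableSet_cell : MeasurableSet (cell n L) := by
  have cell_eq : cell n L = ⋂ i, (fun x : E n => x i) ⁻¹' Ioc 0 L := by ext; simp [cell]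
  rw [cell_eq]
  exact .iInter fun i => (by fun_prop : Measurable fun x : E n => x i) measurableSet_Ioc

open scoped Pointwise in
lemma smul_unitCell (hL : 0 < L) :
    L • {y : Fin n → ℝ | ∀ i, y i ∈ Ioc (0 : ℝ) (0 + 1)} = WithLp.toLp 2 ⁻¹' cell n L := by
  ext y
  rw [Set.mem_smul_set_iff_inv_smul_mem₀ hL.ne']
  simp only [zero_add, mem_Ioc, mem_ofPred_eq, Pi.smul_apply, smul_eq_mul, mem_preimage, cell]
  refine forall_congr' fun i => ?_
  rw [inv_mul_le_iff₀ hL, mul_one, mul_pos_iff_of_pos_left (by positivity)]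

lemma setIntegral_cell_toTorus {F : Type*} [NormedAddCommGroup F] [NormedSpace ℝ F] (hL : 0 < L)
    (W : UnitAddTorus (Fin n) → F) :
    ∫ x in cell n L, W (toTorus n L x) = L ^ n • ∫ t, W t ∂torusMeasure n := by
  have integral_coordinates := (PiLp.volume_preserving_toLp (Fin n)).setIntegral_preimage_emb
    (MeasurableEquiv.toLp 2 (Fin n → ℝ)).measurableEmbedding
    (fun x => W (toTorus n L x)) (cell n L)
  have integral_torus : ∫ t, W t ∂torusMeasure n = _ := UnitAddTorus.integral_preimage W 0
  have integral_rescale := Measure.setIntegral_comp_smul_of_pos volume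
    (fun y : Fin n → ℝ => W (toTorus n L (WithLp.toLp 2 y)))
    {y | ∀ i, y i ∈ Ioc (0 : ℝ) (0 + 1)} hL
  have toTorus_smul (y : Fin n → ℝ) :
      toTorus n L (WithLp.toLp 2 (L • y)) = fun i => (y i : UnitAddCircle) := by
    funext i
    simp [toTorus, hL.ne']
  simp only [toTorus_smul] at integral_rescale
  simp only [Pi.zero_apply] at integral_torus
  rw [integral_torus, integral_rescale, smul_unitCell hL, ← integral_coordinates, smul_smul]
  simp [hL.ne']

lemma measureReal_cell (hL : 0 < L) : volume.real (cell n L) = L ^ n := by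
  simpa using setIntegral_cell_toTorus (n := n) hL fun _ => (1 : ℝ)

lemma cell_subset_closedBall : cell n L ⊆ Metric.closedBall 0 (Real.sqrt (n * L ^ 2)) := by
  intro x hx
  rw [mem_closedBall_zero_iff, EuclideanSpace.norm_eq]
  refine Real.sqrt_le_sqrt ?_
  calc ∑ i, ‖x i‖ ^ 2 ≤ ∑ _i : Fin n, L ^ 2 := by
        refine Finset.sum_le_sum fun i _ => ?_
        rw [Real.norm_eq_abs, sq_abs]
        exact pow_le_pow_left₀ (hx i).1.le (hx i).2 2
    _ = n * L ^ 2 := by simp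

instance : IsFiniteMeasure (volume.restrict (cell n L)) :=
  isFiniteMeasure_restrict.2
    (Metric.isBounded_closedBall.subset cell_subset_closedBall).measure_lt_top.ne

lemma integrableOn_cell {F : Type*} [NormedAddCommGroup F] {w : E n → F} (hw : Continuous w) :
    IntegrableOn w (cell n L) :=
  (hw.continuousOn.integrableOn_compact
    (isCompact_closedBall (0 : E n) (Real.sqrt (n * L ^ 2)))).mono_set cell_subset_closedBall

lemma IsPeriodic.exists_bound {F : Type*} [NormedAddCommGroup F] (hL : 0 < L) {w : E n → F}
    (hw : IsPeriodic L w) (hc : Continuous w) : ∃ M, ∀ x, ‖w x‖ ≤ M := by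
  obtain ⟨W, hW⟩ := hw.exists_lift hL hc
  exact ⟨‖W‖, fun x => hW x ▸ W.norm_coe_le_norm _⟩

lemma IsPeriodic.integral_translate {F : Type*} [NormedAddCommGroup F] [NormedSpace ℝ F]
    (hL : 0 < L) {w : E n → F} (hw : IsPeriodic L w) (hc : Continuous w) (a : E n) :
    ∫ x in cell n L, w (a + x) = ∫ x in cell n L, w x := by
  obtain ⟨W, hW⟩ := hw.exists_lift hL hc
  simp_rw [← hW, toTorus_add]
  rw [setIntegral_cell_toTorus hL fun t => W (toTorus n L a + t), setIntegral_cell_toTorus hL,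
    integral_add_left_eq_self]

protected lemma IsPeriodic.fderiv {F : Type*} [NormedAddCommGroup F] [NormedSpace ℝ F]
    {w : E n → F} (hw : IsPeriodic L w) : IsPeriodic L (fderiv ℝ w) := by
  intro x i
  have w_eq : w = fun y => w (y + L • EuclideanSpace.single i 1) := funext fun y => (hw y i).symm
  conv_rhs => rw [w_eq]
  rw [fderiv_comp_add_right]

protected lemma IsPeriodic.partialDeriv {F : Type*} [NormedAddCommGroup F] [NormedSpace ℝ F]
    {w : E n → F} (hw : IsPeriodic L w) (i : Fin n) : IsPeriodic L (partialDeriv i w) := by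
  intro x j
  simp only [PeriodicNSE.partialDeriv, hw.fderiv x j]

protected lemma IsPeriodic.comp {F G : Type*} {w : E n → F} (hw : IsPeriodic L w) (g : F → G) :
    IsPeriodic L fun x => g (w x) := fun x i => congrArg g (hw x i)

lemma IsPeriodic.comp₂ {F G H : Type*} {w : E n → F} {v : E n → G} (hw : IsPeriodic L w)
    (hv : IsPeriodic L v) (g : F → G → H) :
    IsPeriodic L fun x => g (w x) (v x) := fun x i => by simp only [hw x i, hv x i]

lemma continuous_partialDeriv {F : Type*} [NormedAddCommGroup F] [NormedSpace ℝ F]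
    {w : E n → F} (hc : ContDiff ℝ 1 w) (i : Fin n) : Continuous (partialDeriv i w) :=
  (hc.continuous_fderiv one_ne_zero).clm_apply continuous_const

-- The integral of `w` over a translated cell does not depend on the translation.
lemma IsPeriodic.integral_partialDeriv {F : Type*} [NormedAddCommGroup F] [NormedSpace ℝ F]
    [CompleteSpace F] (hL : 0 < L) {w : E n → F} (hw : IsPeriodic L w) (hc : ContDiff ℝ 1 w)
    (i : Fin n) : ∫ x in cell n L, partialDeriv i w x = 0 := by
  obtain ⟨M, hM⟩ := (hw.partialDeriv i).exists_bound hL (continuous_partialDeriv hc i)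
  have continuous_w := hc.continuous
  have continuous_deriv := continuous_partialDeriv hc i
  have hasDerivAt_translate (x : E n) (s : ℝ) :
      HasDerivAt (fun s : ℝ => w (s • EuclideanSpace.single i 1 + x))
        (partialDeriv i w (s • EuclideanSpace.single i 1 + x)) s := by
    have line : HasDerivAt (fun s : ℝ => s • EuclideanSpace.single i (1 : ℝ) + x)
        (EuclideanSpace.single i (1 : ℝ)) s := by
      simpa using ((hasDerivAt_id s).smul_const (EuclideanSpace.single i (1 : ℝ))).add_const x
    exact (hc.differentiable one_ne_zero _).hasFDerivAt.comp_hasDerivAt s line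
  have hasDerivAt_integral := (hasDerivAt_integral_of_dominated_loc_of_deriv_le
    (μ := volume.restrict (cell n L)) (bound := fun _ => M)
    (F := fun (s : ℝ) x => w (s • EuclideanSpace.single i 1 + x))
    (F' := fun (s : ℝ) x => partialDeriv i w (s • EuclideanSpace.single i 1 + x))
    (x₀ := (0 : ℝ)) (s := univ) Filter.univ_mem
    (.of_forall fun s => Continuous.aestronglyMeasurable (by fun_prop))
    (integrableOn_cell (by fun_prop)) (Continuous.aestronglyMeasurable (by fun_prop))
    (.of_forall fun x s _ => hM _) (integrable_const _)
    (.of_forall fun x s _ => hasDerivAt_translate x s)).2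
  simp_rw [hw.integral_translate hL continuous_w] at hasDerivAt_integral
  simpa using hasDerivAt_integral.unique (hasDerivAt_const _ _)

lemma partialDeriv_mul {𝔸 : Type*} [NormedCommRing 𝔸] [NormedAlgebra ℝ 𝔸] {v w : E n → 𝔸}
    {x : E n} (hv : DifferentiableAt ℝ v x) (hw : DifferentiableAt ℝ w x) (i : Fin n) :
    partialDeriv i (fun x => v x * w x) x
      = v x * partialDeriv i w x + partialDeriv i v x * w x := by
  simp only [partialDeriv]
  rw [fderiv_fun_mul hv hw]
  simp [mul_comm]

lemma IsPeriodic.integral_mul_partialDeriv {𝔸 : Type*} [NormedCommRing 𝔸] [NormedAlgebra ℝ 𝔸]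
    [CompleteSpace 𝔸] (hL : 0 < L) {v w : E n → 𝔸} (hv : IsPeriodic L v)
    (hw : IsPeriodic L w) (hvc : ContDiff ℝ 1 v) (hwc : ContDiff ℝ 1 w) (i : Fin n) :
    ∫ x in cell n L, v x * partialDeriv i w x = -∫ x in cell n L, partialDeriv i v x * w x := by
  have integral_deriv_mul := (hv.comp₂ hw (· * ·)).integral_partialDeriv hL (hvc.mul hwc) i
  simp_rw [fun x => partialDeriv_mul (hvc.differentiable one_ne_zero x)
    (hwc.differentiable one_ne_zero x) i] at integral_deriv_mul
  rw [integral_add] at integral_deriv_mul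
  · exact eq_neg_of_add_eq_zero_left integral_deriv_mul
  · exact integrableOn_cell (hvc.continuous.mul (continuous_partialDeriv hwc i))
  · exact integrableOn_cell ((continuous_partialDeriv hvc i).mul hwc.continuous)

/-! ### Fourier series -/

lemma character_eq_mFourier (m : Fin n → ℤ) (x : E n) :
    character L m x = UnitAddTorus.mFourier m (toTorus n L x) := by
  simp only [character, UnitAddTorus.mFourier, toTorus, ContinuousMap.coe_mk, fourier_coe_apply,
    ← Complex.exp_sum]
  congr 1
  push_cast
  rw [Finset.mul_sum, Finset.mul_sum]
  refine Finset.sum_congr rfl fun i _ => ?_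
  ring

lemma norm_character (m : Fin n → ℤ) (x : E n) : ‖character L m x‖ = 1 := by
  rw [character, mul_comm, Complex.norm_exp_ofReal_mul_I]

lemma character_neg_mul_character (k m : Fin n → ℤ) (x : E n) :
    character L (-k) x * character L m x = character L (m - k) x := by
  rw [character_eq_mFourier, character_eq_mFourier, character_eq_mFourier,
    ← UnitAddTorus.mFourier_add, neg_add_eq_sub]

lemma isPeriodic_character (hL : 0 < L) (m : Fin n → ℤ) : IsPeriodic L (character L m) := by
  intro x i
  rw [character_eq_mFourier, character_eq_mFourier]
  congr 1
  funext j
  simp only [toTorus]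
  rw [← sub_eq_zero, ← AddCircle.coe_sub, AddCircle.coe_eq_zero_iff]
  obtain rfl | hji := eq_or_ne j i
  · exact ⟨1, by simp [hL.ne', add_div]⟩
  · exact ⟨0, by simp [hji]⟩

/-- The real-linear form with the components `2πi m_j / L`, which is the logarithm of
`character L m`. -/
noncomputable def waveForm (L : ℝ) (m : Fin n → ℤ) : E n →L[ℝ] ℂ :=
  ∑ j, (2 * Real.pi * Complex.I / L * m j : ℂ) • (Complex.ofRealCLM.comp (EuclideanSpace.proj j))

lemma waveForm_single (m : Fin n → ℤ) (j : Fin n) :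
    waveForm L m (EuclideanSpace.single j 1) = 2 * Real.pi * Complex.I / L * m j := by
  simp [waveForm, apply_ite Complex.ofReal]

lemma character_eq_exp (m : Fin n → ℤ) (x : E n) :
    character L m x = Complex.exp (waveForm L m x) := by
  simp only [character, waveForm]
  congr 1
  simp only [Complex.ofReal_mul, Complex.ofReal_div, Complex.ofReal_ofNat, Complex.ofReal_sum,
    Complex.ofReal_intCast, Finset.mul_sum, sum_apply, smul_apply, ContinuousLinearMap.comp_apply,
    Complex.ofRealCLM_apply, PiLp.proj_apply, smul_eq_mul]
  refine Finset.sum_congr rfl fun i _ => ?_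
  ring

lemma hasFDerivAt_character (m : Fin n → ℤ) (x : E n) :
    HasFDerivAt (character L m) (character L m x • waveForm L m) x := by
  rw [funext (character_eq_exp (L := L) m)]
  exact (waveForm L m).hasFDerivAt.cexp

lemma contDiff_character (m : Fin n → ℤ) {k : WithTop ℕ∞} : ContDiff ℝ k (character L m) := by
  rw [funext (character_eq_exp (L := L) m)]
  exact (waveForm L m).contDiff.cexp

lemma continuous_character (m : Fin n → ℤ) : Continuous (character L m) :=
  (contDiff_character m (k := 0)).continuous

lemma partialDeriv_character (m : Fin n → ℤ) (j : Fin n) (x : E n) :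
    partialDeriv j (character L m) x = 2 * Real.pi * Complex.I / L * m j * character L m x := by
  rw [partialDeriv, (hasFDerivAt_character m x).fderiv]
  simp [waveForm_single, mul_comm]

lemma partialDeriv_ofReal {w : E n → ℝ} {x : E n} (hw : DifferentiableAt ℝ w x) (j : Fin n) :
    partialDeriv j (fun x => (w x : ℂ)) x = ((partialDeriv j w x : ℝ) : ℂ) :=
  congrArg (fun f => f (EuclideanSpace.single j 1))
    (Complex.ofRealCLM.hasFDerivAt.comp x hw.hasFDerivAt).fderiv

lemma partialDeriv_re {w : E n → ℂ} {x : E n} (hw : DifferentiableAt ℝ w x) (j : Fin n) :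
    partialDeriv j (fun x => (w x).re) x = (partialDeriv j w x).re :=
  congrArg (fun f => f (EuclideanSpace.single j 1))
    (Complex.reCLM.hasFDerivAt.comp x hw.hasFDerivAt).fderiv

lemma integral_character (hL : 0 < L) {m : Fin n → ℤ} (hm : m ≠ 0) :
    ∫ x in cell n L, character L m x = 0 := by
  obtain ⟨j, hj⟩ := Function.ne_iff.1 hm
  have integral_deriv :=
    (isPeriodic_character hL m).integral_partialDeriv hL (contDiff_character m) j
  simp_rw [partialDeriv_character, integral_const_mul] at integral_deriv
  have mj_ne_zero : (m j : ℂ) ≠ 0 := by exact_mod_cast hj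
  exact (mul_eq_zero.1 integral_deriv).resolve_left (by simp [hL.ne', Real.pi_ne_zero, mj_ne_zero])

lemma integral_character_neg_mul_character (hL : 0 < L) (k m : Fin n → ℤ) :
    ∫ x in cell n L, character L (-k) x * character L m x
      = if m = k then (L ^ n : ℂ) else 0 := by
  simp_rw [character_neg_mul_character]
  split_ifs with hmk
  · have character_zero (x : E n) : character L (m - k) x = 1 := by simp [character, hmk]
    simp [character_zero, measureReal_cell hL]
  · exact integral_character hL (sub_ne_zero.2 hmk)

lemma coeff_partialDeriv (hL : 0 < L) {w : E n → ℝ} (hw : IsPeriodic L w) (hc : ContDiff ℝ 1 w)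
    (j : Fin n) (m : Fin n → ℤ) :
    coeff L (partialDeriv j w) m = 2 * Real.pi * Complex.I / L * m j * coeff L w m := by
  have by_parts := (isPeriodic_character hL (-m)).integral_mul_partialDeriv hL
    (hw.comp (fun s : ℝ => (s : ℂ))) (contDiff_character _) (Complex.ofRealCLM.contDiff.comp hc) j
  simp_rw [partialDeriv_ofReal (hc.differentiable one_ne_zero _), partialDeriv_character]
    at by_parts
  simp only [coeff]
  simp_rw [fun x => mul_comm ((partialDeriv j w x : ℝ) : ℂ) (character L (-m) x)]
  rw [by_parts, mul_left_comm]
  congr 1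
  rw [neg_eq_neg_one_mul]
  simp only [← integral_const_mul]
  refine integral_congr_ae (.of_forall fun x => ?_)
  simp only [Pi.neg_apply, Int.cast_neg]
  ring

lemma mFourierCoeff_eq_setIntegral (hL : 0 < L) (W : C(UnitAddTorus (Fin n), ℂ))
    (m : Fin n → ℤ) :
    UnitAddTorus.mFourierCoeff W m
      = ((L ^ n : ℝ) : ℂ)⁻¹ * ∫ x in cell n L, character L (-m) x * W (toTorus n L x) := by
  have integral_torus := setIntegral_cell_toTorus hL fun t => UnitAddTorus.mFourier (-m) t • W t
  simp only [← character_eq_mFourier, smul_eq_mul, Complex.real_smul] at integral_torus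
  rw [integral_torus, inv_mul_cancel_left₀ (by simp [hL.ne'])]
  rfl

lemma exists_torus_lift (hL : 0 < L) {w : E n → ℝ} (hw : IsPeriodic L w) (hc : Continuous w) :
    ∃ W : C(UnitAddTorus (Fin n), ℂ), (∀ x, W (toTorus n L x) = w x) ∧
      ∀ m, UnitAddTorus.mFourierCoeff W m = coeff L w m := by
  obtain ⟨W, hW⟩ := (hw.comp (fun s : ℝ => (s : ℂ))).exists_lift hL (by fun_prop)
  refine ⟨W, hW, fun m => ?_⟩
  simp only [mFourierCoeff_eq_setIntegral hL, hW, coeff, mul_comm (character L _ _)]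

lemma hasSum_sq_mFourierCoeff (hL : 0 < L) (W : C(UnitAddTorus (Fin n), ℂ)) :
    HasSum (fun m => L ^ n * ‖UnitAddTorus.mFourierCoeff W m‖ ^ 2)
      (∫ x in cell n L, ‖W (toTorus n L x)‖ ^ 2) := by
  rw [setIntegral_cell_toTorus hL fun t => ‖W t‖ ^ 2, smul_eq_mul]
  refine HasSum.mul_left _ ?_
  have parseval : HasSum
      (fun m => ‖UnitAddTorus.mFourierCoeff (ContinuousMap.toLp 2 (torusMeasure n) ℂ W) m‖ ^ 2)
      (∫ t, ‖ContinuousMap.toLp 2 (torusMeasure n) ℂ W t‖ ^ 2 ∂torusMeasure n) :=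
    UnitAddTorus.hasSum_sq_mFourierCoeff _
  have mFourierCoeff_toLp (m : Fin n → ℤ) :
      UnitAddTorus.mFourierCoeff (ContinuousMap.toLp 2 (torusMeasure n) ℂ W) m
        = UnitAddTorus.mFourierCoeff W m := UnitAddTorus.mFourierCoeff_toLp W m
  simp only [mFourierCoeff_toLp] at parseval
  convert! parseval using 1
  refine integral_congr_ae ?_
  filter_upwards [ContinuousMap.coeFn_toLp (p := 2) (𝕜 := ℂ) (torusMeasure n) W] with t ht
  rw [← ht]

lemma hasSum_sq_coeff (hL : 0 < L) {w : E n → ℝ} (hw : IsPeriodic L w) (hc : Continuous w) :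
    HasSum (fun m => L ^ n * ‖coeff L w m‖ ^ 2) (∫ x in cell n L, w x ^ 2) := by
  obtain ⟨W, hW, hm⟩ := exists_torus_lift hL hw hc
  simpa [hW, hm] using hasSum_sq_mFourierCoeff hL W

lemma hasSum_coeff_mul_character (hL : 0 < L) {w : E n → ℝ} (hw : IsPeriodic L w)
    (hc : Continuous w) (hs : Summable (coeff L w)) (x : E n) :
    HasSum (fun m => coeff L w m * character L m x) (w x : ℂ) := by
  obtain ⟨W, hW, hm⟩ := exists_torus_lift hL hw hc
  have fourier_inversion := UnitAddTorus.hasSum_mFourier_series_apply_of_summable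
    (f := W) (by rwa [funext hm]) (toTorus n L x)
  simpa [hW, hm, character_eq_mFourier] using fourier_inversion

/-- The trigonometric series `∑ₘ c_m exp (i (2π/L) (m, x))`. -/
noncomputable def fourierSeries (L : ℝ) (c : (Fin n → ℤ) → ℂ) (x : E n) : ℂ :=
  ∑' m, c m * character L m x

lemma summable_mul_character {c : (Fin n → ℤ) → ℂ} (hc : Summable c) (x : E n) :
    Summable fun m => c m * character L m x := by
  refine Summable.of_norm ?_
  simpa only [norm_mul, norm_character, mul_one] using hc.norm

lemma isPeriodic_fourierSeries (hL : 0 < L) (c : (Fin n → ℤ) → ℂ) :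
    IsPeriodic L (fourierSeries L c) := by
  intro x i
  simp only [fourierSeries, isPeriodic_character hL _ x i]

lemma continuous_fourierSeries {c : (Fin n → ℤ) → ℂ} (hc : Summable c) :
    Continuous (fourierSeries L c) :=
  continuous_tsum (fun m => continuous_const.mul (continuous_character m)) hc.norm
    fun m x => by simp [norm_character]

lemma fourierSeries_sub {c d : (Fin n → ℤ) → ℂ} (hc : Summable c) (hd : Summable d) (x : E n) :
    fourierSeries L (fun m => c m - d m) x = fourierSeries L c x - fourierSeries L d x := by
  simp only [fourierSeries, sub_mul]
  exact (summable_mul_character hc x).tsum_sub (summable_mul_character hd x)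

lemma summable_norm_mul_norm_waveForm {c : (Fin n → ℤ) → ℂ}
    (hd : ∀ j, Summable fun m => (m j : ℂ) * c m) :
    Summable fun m => ‖c m‖ * ‖waveForm L m‖ := by
  have summable_components : Summable fun m : Fin n → ℤ => ∑ j,
      ‖(2 * Real.pi * Complex.I / L : ℂ)‖ * ‖(m j : ℂ) * c m‖ *
        ‖Complex.ofRealCLM.comp (EuclideanSpace.proj j : E n →L[ℝ] ℝ)‖ :=
    summable_sum fun j _ => ((hd j).norm.mul_left _).mul_right _
  refine summable_components.of_nonneg_of_le (fun m => by positivity) fun m => ?_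
  calc ‖c m‖ * ‖waveForm L m‖ ≤ ‖c m‖ * ∑ j, ‖(2 * Real.pi * Complex.I / L * m j : ℂ) •
        (Complex.ofRealCLM.comp (EuclideanSpace.proj j : E n →L[ℝ] ℝ))‖ := by
        gcongr; exact norm_sum_le _ _
    _ = _ := by
        rw [Finset.mul_sum]
        refine Finset.sum_congr rfl fun j _ => ?_
        rw [norm_smul, norm_mul, norm_mul]
        ring

lemma norm_mul_character_smul_waveForm (c : ℂ) (m : Fin n → ℤ) (x : E n) :
    ‖(c * character L m x) • waveForm L m‖ = ‖c‖ * ‖waveForm L m‖ := by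
  rw [norm_smul, norm_mul, norm_character, mul_one]

lemma hasFDerivAt_fourierSeries {c : (Fin n → ℤ) → ℂ}
    (hd : ∀ j, Summable fun m => (m j : ℂ) * c m) (hc : Summable c) (x : E n) :
    HasFDerivAt (fourierSeries L c) (∑' m, (c m * character L m x) • waveForm L m) x := by
  refine hasFDerivAt_tsum (x₀ := x) (summable_norm_mul_norm_waveForm (L := L) hd) (fun m y => ?_)
    (fun m y => (norm_mul_character_smul_waveForm (c m) m y).le) (summable_mul_character hc x) x
  rw [← smul_smul]
  exact (hasFDerivAt_character m y).const_mul (c m)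

lemma contDiff_fourierSeries {c : (Fin n → ℤ) → ℂ}
    (hd : ∀ j, Summable fun m => (m j : ℂ) * c m) (hc : Summable c) :
    ContDiff ℝ 1 (fourierSeries L c) := by
  rw [contDiff_one_iff_hasFDerivAt]
  refine ⟨_, continuous_tsum (fun m => ?_) (summable_norm_mul_norm_waveForm (L := L) hd)
    fun m x => (norm_mul_character_smul_waveForm (c m) m x).le,
    fun x => hasFDerivAt_fourierSeries hd hc x⟩
  have := continuous_character (L := L) m
  fun_prop

lemma partialDeriv_fourierSeries {c : (Fin n → ℤ) → ℂ}
    (hd : ∀ j, Summable fun m => (m j : ℂ) * c m) (hc : Summable c) (j : Fin n) (x : E n) :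
    partialDeriv j (fourierSeries L c) x
      = fourierSeries L (fun m => 2 * Real.pi * Complex.I / L * m j * c m) x := by
  have summable_deriv : Summable fun m => (c m * character L m x) • waveForm L m :=
    .of_norm_bounded (summable_norm_mul_norm_waveForm (L := L) hd)
      fun m => (norm_mul_character_smul_waveForm (c m) m x).le
  have apply_tsum := (ContinuousLinearMap.apply ℝ ℂ
    (EuclideanSpace.single j (1 : ℝ) : E n)).map_tsum summable_deriv
  simp only [ContinuousLinearMap.apply_apply] at apply_tsum
  rw [partialDeriv, (hasFDerivAt_fourierSeries hd hc x).fderiv, apply_tsum, fourierSeries]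
  refine tsum_congr fun m => ?_
  rw [smul_apply, waveForm_single, smul_eq_mul]
  ring

lemma setIntegral_character_neg_mul_fourierSeries (hL : 0 < L) {c : (Fin n → ℤ) → ℂ}
    (hc : Summable c) (k : Fin n → ℤ) :
    ∫ x in cell n L, character L (-k) x * fourierSeries L c x = L ^ n * c k := by
  have hasSum_integral := hasSum_integral_of_summable_integral_norm
    (μ := volume.restrict (cell n L))
    (F := fun m x => character L (-k) x * (c m * character L m x))
    (fun m => integrableOn_cell ((continuous_character _).mul
      (continuous_const.mul (continuous_character m))))
    (by
      simp only [norm_mul, norm_character, one_mul, mul_one, integral_const]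
      exact hc.norm.mul_left _)
  simp_rw [mul_left_comm, integral_const_mul, integral_character_neg_mul_character hL,
    mul_ite, mul_zero] at hasSum_integral
  simp_rw [fourierSeries, ← tsum_mul_left, mul_left_comm]
  rw [hasSum_integral.unique (hasSum_single k fun m hm => if_neg hm), if_pos rfl, mul_comm]

lemma hasSum_sq_fourierSeries (hL : 0 < L) {c : (Fin n → ℤ) → ℂ} (hc : Summable c) :
    HasSum (fun m => L ^ n * ‖c m‖ ^ 2) (∫ x in cell n L, ‖fourierSeries L c x‖ ^ 2) := by
  obtain ⟨W, hW⟩ := (isPeriodic_fourierSeries hL c).exists_lift hL (continuous_fourierSeries hc)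
  have mFourierCoeff_eq (k : Fin n → ℤ) : UnitAddTorus.mFourierCoeff W k = c k := by
    simp only [mFourierCoeff_eq_setIntegral hL, hW,
      setIntegral_character_neg_mul_fourierSeries hL hc]
    push_cast
    rw [inv_mul_cancel_left₀ (by simp [hL.ne'])]
  simpa only [hW, mFourierCoeff_eq] using hasSum_sq_mFourierCoeff hL W

lemma integral_re_sq_fourierSeries_le (hL : 0 < L) {c : (Fin n → ℤ) → ℂ} (hc : Summable c)
    {w : E n → ℝ} (hw : IsPeriodic L w) (hwc : Continuous w) {A : ℝ}
    (hA : ∀ m, ‖c m‖ ≤ A * ‖coeff L w m‖) :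
    ∫ x in cell n L, (fourierSeries L c x).re ^ 2 ≤ A ^ 2 * ∫ x in cell n L, w x ^ 2 := by
  have continuous_series := continuous_fourierSeries (L := L) hc
  calc ∫ x in cell n L, (fourierSeries L c x).re ^ 2
      ≤ ∫ x in cell n L, ‖fourierSeries L c x‖ ^ 2 := by
        refine setIntegral_mono (integrableOn_cell (by fun_prop)) (integrableOn_cell (by fun_prop))
          fun x => ?_
        exact sq_le_sq' (neg_le_of_abs_le (Complex.abs_re_le_norm _)) (Complex.re_le_norm _)
    _ ≤ A ^ 2 * ∫ x in cell n L, w x ^ 2 := by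
        refine hasSum_le (fun m => ?_) (hasSum_sq_fourierSeries hL hc)
          ((hasSum_sq_coeff hL hw hwc).mul_left (A ^ 2))
        have sq_le := pow_le_pow_left₀ (norm_nonneg _) (hA m) 2
        rw [mul_pow] at sq_le
        rw [mul_left_comm]
        gcongr

lemma sum_sq_pos {m : Fin n → ℤ} (hm : m ≠ 0) : 0 < ∑ j, (m j : ℝ) ^ 2 := by
  obtain ⟨j, hj⟩ := Function.ne_iff.1 hm
  have mj_ne_zero : (m j : ℝ) ≠ 0 := by exact_mod_cast hj
  exact Finset.sum_pos' (fun _ _ => sq_nonneg _) ⟨j, Finset.mem_univ j, by positivity⟩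

lemma sq_le_sum_sq (m : Fin n → ℤ) (j : Fin n) : (m j : ℝ) ^ 2 ≤ ∑ j, (m j : ℝ) ^ 2 :=
  Finset.single_le_sum (f := fun j => (m j : ℝ) ^ 2) (fun _ _ => sq_nonneg _) (Finset.mem_univ j)

lemma normSq_eq_ofReal (m : Fin n → ℤ) : normSq m = ((∑ j, (m j : ℝ) ^ 2 : ℝ) : ℂ) := by
  simp [normSq]

lemma normSq_ne_zero {m : Fin n → ℤ} (hm : m ≠ 0) : normSq m ≠ 0 := by
  rw [normSq_eq_ofReal]
  exact_mod_cast (sum_sq_pos hm).ne'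

lemma summable_inv_sum_sq_pow {k : ℕ} (hk : n < 2 * k) :
    Summable fun m : Fin n → ℤ => ((∑ j, (m j : ℝ) ^ 2) ^ k)⁻¹ := by
  let b := Pi.basisFun ℝ (Fin n)
  let Λ : Submodule ℤ (Fin n → ℝ) := Submodule.span ℤ (Set.range b)
  have finrank_lattice : Module.finrank ℤ Λ = n := by simpa using ZLattice.rank ℝ Λ
  have mem_lattice (m : Fin n → ℤ) : (fun j => (m j : ℝ)) ∈ Λ := by
    have coords : (fun j => (m j : ℝ)) = ∑ j, m j • b j := by
      funext i
      simp [b, Pi.single_apply]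
    rw [coords]
    exact Submodule.sum_mem _ fun j _ => Submodule.smul_mem _ _ (Submodule.subset_span ⟨j, rfl⟩)
  let toLattice (m : Fin n → ℤ) : Λ := ⟨fun j => (m j : ℝ), mem_lattice m⟩
  have toLattice_injective : Function.Injective toLattice := by
    intro m m' h
    funext j
    have coords_eq : (m j : ℝ) = m' j := congrFun (congrArg Subtype.val h) j
    exact_mod_cast coords_eq
  refine Summable.of_nonneg_of_le (fun m => by positivity) (fun m => ?_)
    ((ZLattice.summable_norm_pow_inv Λ (2 * k) (by omega)).comp_injective toLattice_injective)
  obtain rfl | hm := eq_or_ne m 0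
  · simp [show k ≠ 0 by omega]
  have norm_pos : 0 < ‖toLattice m‖ := by
    refine norm_pos_iff.2 fun h => hm (toLattice_injective (h.trans ?_))
    ext; simp [toLattice]
  have norm_sq_le : ‖toLattice m‖ ^ 2 ≤ ∑ j, (m j : ℝ) ^ 2 := by
    refine (Real.le_sqrt (norm_nonneg _) (by positivity)).1
      ((pi_norm_le_iff_of_nonneg (by positivity)).2 fun j => ?_)
    exact Real.abs_le_sqrt (sq_le_sum_sq m j)
  rw [Function.comp_apply, inv_pow, pow_mul]
  gcongr

/-! ### The operators `∂_j (-Δ)⁻¹` -/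

lemma norm_normSq_inv_mul_mul_le_one (m : Fin n → ℤ) (j k : Fin n) :
    ‖(normSq m)⁻¹ * m j * m k‖ ≤ 1 := by
  have sum_nonneg : 0 ≤ ∑ j, (m j : ℝ) ^ 2 := by positivity
  rw [normSq_eq_ofReal, norm_mul, norm_mul, norm_inv, Complex.norm_real, Complex.norm_intCast,
    Complex.norm_intCast, Real.norm_of_nonneg sum_nonneg, mul_assoc]
  refine inv_mul_le_one_of_le₀ ?_ sum_nonneg
  nlinarith [sq_nonneg (|(m j : ℝ)| - |(m k : ℝ)|), sq_abs (m j : ℝ), sq_abs (m k : ℝ),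
    sq_le_sum_sq m j, sq_le_sum_sq m k]

lemma norm_normSq_inv_mul_le_one (m : Fin n → ℤ) (j : Fin n) : ‖(normSq m)⁻¹ * m j‖ ≤ 1 := by
  by_cases hmj : m j = 0
  · simp [hmj]
  refine le_trans ?_ (norm_normSq_inv_mul_mul_le_one m j j)
  rw [norm_mul (_ * _) (m j : ℂ), Complex.norm_intCast]
  exact le_mul_of_one_le_right (norm_nonneg _) (by exact_mod_cast Int.one_le_abs hmj)

/-- The Fourier multiplier `(iL/2π) m_j/|m|²` of the operator `∂_j (-Δ)⁻¹`. It vanishes at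
`m = 0` because the inverse of zero is zero. -/
noncomputable def gradInvLapSymbol (L : ℝ) (j : Fin n) (m : Fin n → ℤ) : ℂ :=
  Complex.I * L / (2 * Real.pi) * ((normSq m)⁻¹ * m j)

/-- The operator `∂_j (-Δ)⁻¹` on real `L`-periodic functions, the building block of the
Biot-Savart operators. The series is real for real `w`; `re` only changes its type. -/
noncomputable def gradInvLap (L : ℝ) (j : Fin n) (w : E n → ℝ) (x : E n) : ℝ :=
  (fourierSeries L (fun m => gradInvLapSymbol L j m * coeff L w m) x).re

lemma norm_I_mul_div_two_pi_le (hL : 0 ≤ L) : ‖(Complex.I * L / (2 * Real.pi) : ℂ)‖ ≤ L := by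
  have norm_eq : ‖(Complex.I * L / (2 * Real.pi) : ℂ)‖ = L / (2 * Real.pi) := by
    simp [abs_of_nonneg hL, abs_of_pos Real.pi_pos]
  rw [norm_eq]
  exact div_le_self hL (by linarith [Real.pi_gt_three])

lemma norm_gradInvLapSymbol_le (hL : 0 ≤ L) (j : Fin n) (m : Fin n → ℤ) :
    ‖gradInvLapSymbol L j m‖ ≤ L := by
  rw [gradInvLapSymbol, norm_mul]
  exact (mul_le_of_le_one_right (norm_nonneg _) (norm_normSq_inv_mul_le_one m j)).trans
    (norm_I_mul_div_two_pi_le hL)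

lemma norm_mul_gradInvLapSymbol_le (hL : 0 ≤ L) (j k : Fin n) (m : Fin n → ℤ) :
    ‖(m k : ℂ) * gradInvLapSymbol L j m‖ ≤ L := by
  rw [gradInvLapSymbol, mul_left_comm, norm_mul, mul_comm (m k : ℂ)]
  exact (mul_le_of_le_one_right (norm_nonneg _) (norm_normSq_inv_mul_mul_le_one m j k)).trans
    (norm_I_mul_div_two_pi_le hL)

lemma mul_gradInvLapSymbol (hL : L ≠ 0) (j k : Fin n) (m : Fin n → ℤ) :
    2 * Real.pi * Complex.I / L * m k * gradInvLapSymbol L j m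
      = -((normSq m)⁻¹ * m j * m k) := by
  have L_ne_zero : (L : ℂ) ≠ 0 := by exact_mod_cast hL
  have pi_ne_zero : (Real.pi : ℂ) ≠ 0 := by exact_mod_cast Real.pi_ne_zero
  rw [gradInvLapSymbol]
  field_simp
  rw [Complex.I_sq]
  ring

section GradInvLap

variable {w : E n → ℝ}

lemma summable_gradInvLapSymbol_mul (hL : 0 ≤ L) (j : Fin n) (hs : Summable (coeff L w)) :
    Summable fun m => gradInvLapSymbol L j m * coeff L w m := by
  refine Summable.of_norm_bounded (hs.norm.mul_left L) fun m => ?_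
  rw [norm_mul]
  gcongr
  exact norm_gradInvLapSymbol_le hL j m

lemma summable_mul_gradInvLapSymbol_mul (hL : 0 ≤ L) (j k : Fin n) (hs : Summable (coeff L w)) :
    Summable fun m => (m k : ℂ) * (gradInvLapSymbol L j m * coeff L w m) := by
  refine Summable.of_norm_bounded (hs.norm.mul_left L) fun m => ?_
  rw [← mul_assoc, norm_mul _ (coeff L w m)]
  gcongr
  exact norm_mul_gradInvLapSymbol_le hL j k m

lemma isPeriodic_gradInvLap (hL : 0 < L) (j : Fin n) : IsPeriodic L (gradInvLap L j w) :=
  (isPeriodic_fourierSeries hL _).comp Complex.re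

lemma contDiff_gradInvLap (hL : 0 ≤ L) (j : Fin n) (hs : Summable (coeff L w)) :
    ContDiff ℝ 1 (gradInvLap L j w) :=
  Complex.reCLM.contDiff.comp (contDiff_fourierSeries
    (fun k => summable_mul_gradInvLapSymbol_mul hL j k hs) (summable_gradInvLapSymbol_mul hL j hs))

lemma partialDeriv_gradInvLap (hL : 0 < L) (j k : Fin n) (hs : Summable (coeff L w)) (x : E n) :
    partialDeriv k (gradInvLap L j w) x
      = (fourierSeries L (fun m => -((normSq m)⁻¹ * m j * m k) * coeff L w m) x).re := by
  have summable_deriv := fun k => summable_mul_gradInvLapSymbol_mul hL.le j k hs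
  have summable_series := summable_gradInvLapSymbol_mul hL.le j hs
  have deriv_re := partialDeriv_re
    ((contDiff_fourierSeries (L := L) summable_deriv summable_series).differentiable
      one_ne_zero x) k
  rw [partialDeriv_fourierSeries summable_deriv summable_series] at deriv_re
  simp_rw [← mul_assoc (_ * _) (gradInvLapSymbol L j _), mul_gradInvLapSymbol hL.ne'] at deriv_re
  exact deriv_re

lemma partialDeriv_gradInvLap_comm (hL : 0 < L) (j k : Fin n) (hs : Summable (coeff L w))
    (x : E n) :
    partialDeriv k (gradInvLap L j w) x = partialDeriv j (gradInvLap L k w) x := by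
  rw [partialDeriv_gradInvLap hL j k hs, partialDeriv_gradInvLap hL k j hs]
  simp_rw [mul_right_comm _ ((_ : ℤ) : ℂ) ((_ : ℤ) : ℂ)]

lemma integral_gradInvLap_sq_le (hL : 0 < L) (j : Fin n) (hw : IsPeriodic L w)
    (hc : Continuous w) (hs : Summable (coeff L w)) :
    ∫ x in cell n L, gradInvLap L j w x ^ 2 ≤ L ^ 2 * ∫ x in cell n L, w x ^ 2 := by
  refine integral_re_sq_fourierSeries_le hL (summable_gradInvLapSymbol_mul hL.le j hs) hw hc
    fun m => ?_
  rw [norm_mul]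
  gcongr
  exact norm_gradInvLapSymbol_le hL.le j m

lemma integral_partialDeriv_gradInvLap_sq_le (hL : 0 < L) (j k : Fin n) (hw : IsPeriodic L w)
    (hc : Continuous w) (hs : Summable (coeff L w)) :
    ∫ x in cell n L, partialDeriv k (gradInvLap L j w) x ^ 2 ≤ ∫ x in cell n L, w x ^ 2 := by
  have norm_le (m : Fin n → ℤ) :
      ‖-((normSq m)⁻¹ * m j * m k) * coeff L w m‖ ≤ 1 * ‖coeff L w m‖ := by
    rw [norm_mul, norm_neg]
    gcongr
    exact norm_normSq_inv_mul_mul_le_one m j k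
  simp_rw [partialDeriv_gradInvLap hL j k hs]
  simpa using integral_re_sq_fourierSeries_le hL
    (Summable.of_norm_bounded (hs.norm.mul_left 1) norm_le) hw hc norm_le

lemma coeff_sub {v : E n → ℝ} (hv : Continuous v) (hw : Continuous w) (m : Fin n → ℤ) :
    coeff L (fun x => v x - w x) m = coeff L v m - coeff L w m := by
  have hch := continuous_character (L := L) (-m)
  simp only [coeff, Complex.ofReal_sub, sub_mul]
  rw [integral_sub, mul_sub]
  · exact integrableOn_cell (by fun_prop)
  · exact integrableOn_cell (by fun_prop)

lemma gradInvLap_sub (hL : 0 ≤ L) {v : E n → ℝ} (hv : Continuous v) (hw : Continuous w)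
    (hsv : Summable (coeff L v)) (hsw : Summable (coeff L w)) (j : Fin n) (x : E n) :
    gradInvLap L j (fun x => v x - w x) x = gradInvLap L j v x - gradInvLap L j w x := by
  simp only [gradInvLap, coeff_sub hv hw, mul_sub]
  rw [fourierSeries_sub (summable_gradInvLapSymbol_mul hL j hsv)
    (summable_gradInvLapSymbol_mul hL j hsw), Complex.sub_re]

lemma gradInvLap_partialDeriv_comm (hL : 0 < L) (hw : IsPeriodic L w) (hc : ContDiff ℝ 1 w)
    (j k : Fin n) : gradInvLap L j (partialDeriv k w) = gradInvLap L k (partialDeriv j w) := by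
  funext x
  simp only [gradInvLap, coeff_partialDeriv hL hw hc, gradInvLapSymbol]
  congr 3
  funext m
  ring

lemma coeff_zero_eq_average : coeff L w 0 = ((L ^ n)⁻¹ * ∫ x in cell n L, w x : ℝ) := by
  have character_zero (x : E n) : character L (-0) x = 1 := by simp [character]
  simp only [coeff, character_zero, mul_one]
  push_cast
  congr 1
  exact integral_ofReal

lemma sum_gradInvLapSymbol_mul_coeff_partialDeriv (hL : 0 < L) (hw : IsPeriodic L w)
    (hc : ContDiff ℝ 1 w) (mean_zero : ∫ x in cell n L, w x = 0) (m : Fin n → ℤ) :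
    ∑ j, gradInvLapSymbol L j m * coeff L (partialDeriv j w) m = -coeff L w m := by
  simp_rw [coeff_partialDeriv hL hw hc]
  obtain rfl | hm := eq_or_ne m 0
  · simp [coeff_zero_eq_average, mean_zero]
  calc ∑ j, gradInvLapSymbol L j m * (2 * Real.pi * Complex.I / L * m j * coeff L w m)
      = ∑ j, -((normSq m)⁻¹ * m j * m j) * coeff L w m := by
        refine Finset.sum_congr rfl fun j _ => ?_
        rw [← mul_gradInvLapSymbol hL.ne']; ring
    _ = -((normSq m)⁻¹ * normSq m) * coeff L w m := by
        rw [← Finset.sum_mul, Finset.sum_neg_distrib, normSq, Finset.mul_sum]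
        simp_rw [mul_assoc, ← sq]
    _ = -coeff L w m := by rw [inv_mul_cancel₀ (normSq_ne_zero hm), neg_one_mul]

lemma sum_gradInvLap_partialDeriv (hL : 0 < L) (hw : IsPeriodic L w) (hc : ContDiff ℝ 1 w)
    (hs : Summable (coeff L w)) (hs' : ∀ j, Summable (coeff L (partialDeriv j w)))
    (mean_zero : ∫ x in cell n L, w x = 0) (x : E n) :
    ∑ j, gradInvLap L j (partialDeriv j w) x = -w x := by
  have fourier_inversion := (hasSum_coeff_mul_character hL hw hc.continuous hs x).tsum_eq
  simp only [gradInvLap, ← Complex.re_sum, fourierSeries]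
  rw [← Summable.tsum_finsetSum fun j _ =>
    summable_mul_character (summable_gradInvLapSymbol_mul hL.le j (hs' j)) x]
  simp_rw [← Finset.sum_mul,
    sum_gradInvLapSymbol_mul_coeff_partialDeriv hL hw hc mean_zero, neg_mul]
  rw [tsum_neg, fourier_inversion, Complex.neg_re, Complex.ofReal_re]

end GradInvLap

/-! ### Absolute convergence of Fourier series of `C²` functions -/

lemma contDiff_partialDeriv {F : Type*} [NormedAddCommGroup F] [NormedSpace ℝ F] {w : E n → F}
    {k l : WithTop ℕ∞} (hw : ContDiff ℝ l w) (hk : k + 1 ≤ l) (i : Fin n) :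
    ContDiff ℝ k (partialDeriv i w) :=
  (hw.fderiv_right hk).clm_apply contDiff_const

lemma summable_sq_mul_norm_coeff_sq (hL : 0 < L) {w : E n → ℝ} (hw : IsPeriodic L w)
    (hc : ContDiff ℝ 2 w) (j : Fin n) :
    Summable fun m : Fin n → ℤ => ((m j : ℝ) ^ 2 * ‖coeff L w m‖) ^ 2 := by
  have contDiff_deriv : ContDiff ℝ 1 (partialDeriv j w) := contDiff_partialDeriv hc (by norm_num) j
  have parseval : Summable fun m => ‖coeff L (partialDeriv j (partialDeriv j w)) m‖ ^ 2 :=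
    (summable_mul_left_iff (pow_ne_zero n hL.ne')).1 (hasSum_sq_coeff hL
      ((hw.partialDeriv j).partialDeriv j) (continuous_partialDeriv contDiff_deriv j)).summable
  refine (parseval.mul_left ((L / (2 * Real.pi)) ^ 4)).congr fun m => ?_
  rw [coeff_partialDeriv hL (hw.partialDeriv j) contDiff_deriv,
    coeff_partialDeriv hL hw (hc.of_le one_le_two)]
  simp only [norm_mul, norm_div, Complex.norm_real, Complex.norm_I, Complex.norm_intCast,
    Complex.norm_ofNat, Real.norm_eq_abs, abs_of_pos hL, abs_of_pos Real.pi_pos, mul_pow, sq_abs]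
  have := hL.ne'
  have := Real.pi_ne_zero
  field_simp

lemma summable_coeff (hn : n ≤ 3) (hL : 0 < L) {w : E n → ℝ} (hw : IsPeriodic L w)
    (hc : ContDiff ℝ 2 w) : Summable (coeff L w) := by
  have summable_majorant : Summable fun m : Fin n → ℤ =>
      ((∑ j, (m j : ℝ) ^ 2) ^ 2)⁻¹ + n * ∑ j, ((m j : ℝ) ^ 2 * ‖coeff L w m‖) ^ 2 :=
    (summable_inv_sum_sq_pow (by omega)).add
      ((summable_sum fun j _ => summable_sq_mul_norm_coeff_sq hL hw hc j).mul_left _)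
  refine summable_majorant.of_norm_bounded_eventually ?_
  rw [Filter.eventually_cofinite]
  refine (Set.finite_singleton (0 : Fin n → ℤ)).subset fun m hm => ?_
  by_contra m_ne_zero
  refine hm ?_
  have q_pos := sum_sq_pos (m_ne_zero : m ≠ 0)
  have cauchy_schwarz : ((∑ j, (m j : ℝ) ^ 2) * ‖coeff L w m‖) ^ 2
      ≤ n * ∑ j, ((m j : ℝ) ^ 2 * ‖coeff L w m‖) ^ 2 := by
    rw [Finset.sum_mul]
    simpa using sq_sum_le_card_mul_sum_sq (s := Finset.univ)
      (f := fun j => (m j : ℝ) ^ 2 * ‖coeff L w m‖)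
  refine le_trans ?_ (add_le_add_right cauchy_schwarz _)
  generalize ∑ j, (m j : ℝ) ^ 2 = q at q_pos
  calc ‖coeff L w m‖ = q⁻¹ * (q * ‖coeff L w m‖) := by field_simp
    _ ≤ (q ^ 2)⁻¹ + (q * ‖coeff L w m‖) ^ 2 := by
      rw [← inv_pow]
      nlinarith [sq_nonneg (q⁻¹ - q * ‖coeff L w m‖), sq_nonneg (q⁻¹ + q * ‖coeff L w m‖)]

/-! ### Calculus of partial derivatives -/

section PartialDeriv

variable {F : Type*} [NormedAddCommGroup F] [NormedSpace ℝ F] {v w : E n → F} {x : E n}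

lemma partialDeriv_apply {k : ℕ} {v : E n → E k} (hv : DifferentiableAt ℝ v x)
    (i : Fin n) (j : Fin k) : partialDeriv i v x j = partialDeriv i (fun y => v y j) x := by
  have hasFDerivAt_component :=
    (EuclideanSpace.proj (𝕜 := ℝ) j).hasFDerivAt.comp x hv.hasFDerivAt
  exact (congrArg (fun f => f (EuclideanSpace.single i 1)) hasFDerivAt_component.fderiv).symm

lemma partialDeriv_sub (hv : DifferentiableAt ℝ v x) (hw : DifferentiableAt ℝ w x) (i : Fin n) :
    partialDeriv i (fun x => v x - w x) x = partialDeriv i v x - partialDeriv i w x := by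
  simp only [partialDeriv, fderiv_fun_sub hv hw, sub_apply]

lemma partialDeriv_sum {ι : Type*} {s : Finset ι} {w : ι → E n → F}
    (hw : ∀ j ∈ s, DifferentiableAt ℝ (w j) x) (i : Fin n) :
    partialDeriv i (fun x => ∑ j ∈ s, w j x) x = ∑ j ∈ s, partialDeriv i (w j) x := by
  simp only [partialDeriv, fderiv_fun_sum hw, sum_apply]

lemma partialDeriv_partialDeriv (hw : ContDiff ℝ 2 w) (i j : Fin n) (x : E n) :
    partialDeriv i (partialDeriv j w) x
      = fderiv ℝ (fderiv ℝ w) x (EuclideanSpace.single i 1) (EuclideanSpace.single j 1) := by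
  have differentiable_fderiv : Differentiable ℝ (fderiv ℝ w) :=
    (hw.fderiv_right (m := 1) (by norm_num)).differentiable one_ne_zero
  have hasFDerivAt_apply := (differentiable_fderiv x).hasFDerivAt.clm_apply
    (hasFDerivAt_const (EuclideanSpace.single j (1 : ℝ)) x)
  simpa using! congrArg (fun f => f (EuclideanSpace.single i 1)) hasFDerivAt_apply.fderiv

lemma partialDeriv_comm (hw : ContDiff ℝ 2 w) (i j : Fin n) (x : E n) :
    partialDeriv i (partialDeriv j w) x = partialDeriv j (partialDeriv i w) x := by
  rw [partialDeriv_partialDeriv hw, partialDeriv_partialDeriv hw]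
  exact (hw.contDiffAt.isSymmSndFDerivAt (by simp)).eq _ _

lemma laplacian_eq_sum (hw : ContDiff ℝ 2 w) (x : E n) :
    (Δ w) x = ∑ j, partialDeriv j (partialDeriv j w) x := by
  rw [InnerProductSpace.laplacian_eq_iteratedFDeriv_orthonormalBasis w
    (EuclideanSpace.basisFun (Fin n) ℝ)]
  refine Finset.sum_congr rfl fun j _ => ?_
  rw [iteratedFDeriv_two_apply, partialDeriv_partialDeriv hw]
  simp

end PartialDeriv

/-! ### The Biot–Savart operator in terms of the vorticity tensor -/

/-- The vorticity tensor `∂_i v_j - ∂_j v_i`, which encodes the curl in every dimension. -/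
noncomputable def vorticityTensor (v : E n → E n) (x : E n) : Matrix (Fin n) (Fin n) ℝ :=
  .of fun i j => partialDeriv i v x j - partialDeriv j v x i

/-- The velocity `∑ⱼ ∂_j (-Δ)⁻¹ W_ij` with vorticity tensor `W`. In dimensions two and three it is
the Biot–Savart operator, with the curl written as a skew-symmetric matrix. -/
noncomputable def tensorBiotSavart (L : ℝ) (W : E n → Matrix (Fin n) (Fin n) ℝ) (x : E n) : E n :=
  WithLp.toLp 2 fun i => ∑ j, gradInvLap L j (fun y => W y i j) x

/-- `V` is a periodic divergence-free field that is controlled in `H¹` by `Y`. The velocity errors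
of the frozen approximation have this property, with `Y` the squared `L²` vorticity error. -/
structure IsVelocityError (L Y : ℝ) (V : E n → E n) : Prop where
  contDiff : ContDiff ℝ 1 V
  periodic : IsPeriodic L V
  div_free : ∀ x, div V x = 0
  sq_le : ∀ i, ∫ x in cell n L, V x i ^ 2 ≤ n * (L ^ 2 + 1) * Y
  deriv_sq_le : ∀ i j, ∫ x in cell n L, partialDeriv j V x i ^ 2 ≤ n * (L ^ 2 + 1) * Y

lemma integral_cell_apply {k : ℕ} {v : E n → E k} (hv : Continuous v) (i : Fin k) :
    ∫ x in cell n L, v x i = (∫ x in cell n L, v x) i :=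
  (EuclideanSpace.proj (𝕜 := ℝ) i).integral_comp_comm (integrableOn_cell hv)

lemma integral_sum_sq_le {ι : Type*} (s : Finset ι) {f : ι → E n → ℝ}
    (hf : ∀ i, Continuous (f i)) :
    ∫ x in cell n L, (∑ i ∈ s, f i x) ^ 2 ≤ s.card * ∑ i ∈ s, ∫ x in cell n L, f i x ^ 2 := by
  rw [← integral_finsetSum _ fun i _ => integrableOn_cell (by fun_prop), ← integral_const_mul]
  exact setIntegral_mono (integrableOn_cell (by fun_prop)) (integrableOn_cell (by fun_prop))
    fun x => sq_sum_le_card_mul_sum_sq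

lemma isPeriodic_sum {F ι : Type*} [AddCommMonoid F] {s : Finset ι} {f : ι → E n → F}
    (hf : ∀ i ∈ s, IsPeriodic L (f i)) : IsPeriodic L fun x => ∑ i ∈ s, f i x :=
  fun x i => Finset.sum_congr rfl fun j hj => hf j hj x i

lemma gradInvLap_neg (j : Fin n) (w : E n → ℝ) :
    gradInvLap L j (fun x => -w x) = fun x => -gradInvLap L j w x := by
  have coeff_neg (m : Fin n → ℤ) : coeff L (fun x => -w x) m = -coeff L w m := by
    simp only [coeff, Complex.ofReal_neg, neg_mul]
    rw [integral_neg, mul_neg]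
  funext x
  simp only [gradInvLap, coeff_neg, fourierSeries, mul_neg, neg_mul, tsum_neg, Complex.neg_re]

lemma gradInvLap_zero (j : Fin n) (x : E n) : gradInvLap L j (fun _ => 0) x = 0 := by
  simp [gradInvLap, coeff, fourierSeries]

lemma coeff_sum {ι : Type*} (s : Finset ι) {w : ι → E n → ℝ} (hw : ∀ i ∈ s, Continuous (w i))
    (m : Fin n → ℤ) : coeff L (fun x => ∑ i ∈ s, w i x) m = ∑ i ∈ s, coeff L (w i) m := by
  have hch := continuous_character (L := L) (-m)
  simp only [coeff, Complex.ofReal_sum, Finset.sum_mul]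
  rw [integral_finsetSum, Finset.mul_sum]
  intro i hi
  have := hw i hi
  exact integrableOn_cell (by fun_prop)

lemma sum_gradInvLap {ι : Type*} (s : Finset ι) (hL : 0 ≤ L) {w : ι → E n → ℝ}
    (hw : ∀ i ∈ s, Continuous (w i)) (hs : ∀ i ∈ s, Summable (coeff L (w i))) (j : Fin n)
    (x : E n) :
    ∑ i ∈ s, gradInvLap L j (w i) x = gradInvLap L j (fun x => ∑ i ∈ s, w i x) x := by
  simp only [gradInvLap, ← Complex.re_sum, fourierSeries]
  rw [← Summable.tsum_finsetSum fun i hi =>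
    summable_mul_character (summable_gradInvLapSymbol_mul hL j (hs i hi)) x]
  simp_rw [coeff_sum s hw, Finset.mul_sum, Finset.sum_mul]

section TensorBiotSavart

variable {W : E n → Matrix (Fin n) (Fin n) ℝ}

lemma contDiff_tensorBiotSavart (hL : 0 ≤ L)
    (hs : ∀ i j, Summable (coeff L fun x => W x i j)) : ContDiff ℝ 1 (tensorBiotSavart L W) :=
  contDiff_euclidean.2 fun i =>
    ContDiff.sum (s := Finset.univ) fun j _ => contDiff_gradInvLap hL j (hs i j)

lemma isPeriodic_tensorBiotSavart (hL : 0 < L) : IsPeriodic L (tensorBiotSavart L W) :=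
  IsPeriodic.comp
    (fun x k => funext fun _ => isPeriodic_sum (fun j _ => isPeriodic_gradInvLap hL j) x k)
    (WithLp.toLp 2)

lemma partialDeriv_tensorBiotSavart (hL : 0 ≤ L)
    (hs : ∀ i j, Summable (coeff L fun x => W x i j)) (k i : Fin n) (x : E n) :
    partialDeriv k (tensorBiotSavart L W) x i
      = ∑ j, partialDeriv k (gradInvLap L j fun y => W y i j) x := by
  rw [partialDeriv_apply ((contDiff_tensorBiotSavart hL hs).differentiable one_ne_zero x)]
  exact partialDeriv_sum (s := Finset.univ)
    (fun j _ => (contDiff_gradInvLap hL j (hs i j)).differentiable one_ne_zero x) k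

lemma div_tensorBiotSavart (hL : 0 < L) (hs : ∀ i j, Summable (coeff L fun x => W x i j))
    (skew : ∀ x i j, W x j i = -W x i j) (x : E n) : div (tensorBiotSavart L W) x = 0 := by
  have swap (i j : Fin n) : partialDeriv i (gradInvLap L j fun y => W y i j) x
      = -partialDeriv j (gradInvLap L i fun y => W y j i) x := by
    simp_rw [partialDeriv_gradInvLap_comm hL j i (hs i j) x, skew _ i j, gradInvLap_neg,
      partialDeriv, fderiv_fun_neg, neg_apply, neg_neg]
  simp only [div, partialDeriv_tensorBiotSavart hL.le hs]
  refine self_eq_neg.1 ?_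
  conv_lhs => rw [Finset.sum_comm]
  simp_rw [← Finset.sum_neg_distrib]
  exact Finset.sum_congr rfl fun i _ => Finset.sum_congr rfl fun j _ => swap j i

lemma isVelocityError_tensorBiotSavart (hL : 0 < L) (hW : ∀ i j, IsPeriodic L fun x => W x i j)
    (hc : ∀ i j, Continuous fun x => W x i j) (hs : ∀ i j, Summable (coeff L fun x => W x i j))
    (skew : ∀ x i j, W x j i = -W x i j) {Y : ℝ}
    (hY : ∀ i, ∑ j, ∫ x in cell n L, W x i j ^ 2 ≤ Y) :
    IsVelocityError L Y (tensorBiotSavart L W) := by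
  have contDiff_summand (i j : Fin n) := contDiff_gradInvLap hL.le j (hs i j)
  have row_le (i : Fin n) {c : ℝ} (hc : 0 ≤ c) (hcL : c ≤ L ^ 2 + 1) {r : Fin n → ℝ}
      (hr : ∀ j, r j ≤ c * ∫ x in cell n L, W x i j ^ 2) :
      (Finset.univ : Finset (Fin n)).card * ∑ j, r j ≤ n * (L ^ 2 + 1) * Y := by
    have Y_nonneg : 0 ≤ Y := le_trans (by positivity) (hY i)
    rw [Finset.card_univ, Fintype.card_fin, mul_assoc]
    gcongr
    calc ∑ j, r j ≤ ∑ j, c * ∫ x in cell n L, W x i j ^ 2 := Finset.sum_le_sum fun j _ => hr j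
      _ = c * ∑ j, ∫ x in cell n L, W x i j ^ 2 := (Finset.mul_sum ..).symm
      _ ≤ (L ^ 2 + 1) * Y := by gcongr; exact hY i
  refine ⟨contDiff_tensorBiotSavart hL.le hs, isPeriodic_tensorBiotSavart hL,
    div_tensorBiotSavart hL hs skew, fun i => ?_, fun i k => ?_⟩
  · exact (integral_sum_sq_le _ fun j => (contDiff_summand i j).continuous).trans <|
      row_le i (sq_nonneg L) (by linarith) fun j =>
        integral_gradInvLap_sq_le hL j (hW i j) (hc i j) (hs i j)
  · simp_rw [partialDeriv_tensorBiotSavart hL.le hs]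
    refine (integral_sum_sq_le _ fun j => continuous_partialDeriv (contDiff_summand i j) k).trans <|
      row_le i zero_le_one (by nlinarith) fun j => ?_
    simpa using integral_partialDeriv_gradInvLap_sq_le hL j k (hW i j) (hc i j) (hs i j)

lemma tensorBiotSavart_sub (hL : 0 ≤ L) {W' : E n → Matrix (Fin n) (Fin n) ℝ}
    (hc : ∀ i j, Continuous fun x => W x i j) (hs : ∀ i j, Summable (coeff L fun x => W x i j))
    (hc' : ∀ i j, Continuous fun x => W' x i j) (hs' : ∀ i j, Summable (coeff L fun x => W' x i j))
    (x : E n) :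
    tensorBiotSavart L (fun x => W x - W' x) x
      = tensorBiotSavart L W x - tensorBiotSavart L W' x := by
  ext i
  simp only [tensorBiotSavart, Matrix.sub_apply, PiLp.sub_apply,
    gradInvLap_sub hL (hc i _) (hc' i _) (hs i _) (hs' i _), Finset.sum_sub_distrib]

end TensorBiotSavart

section VorticityTensor

variable {v : E n → E n}

lemma contDiff_partialDeriv_apply {k l : WithTop ℕ∞} (hc : ContDiff ℝ l v) (hk : k + 1 ≤ l)
    (i j : Fin n) : ContDiff ℝ k fun x => partialDeriv i v x j :=
  contDiff_euclidean.1 (contDiff_partialDeriv hc hk i) j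

lemma contDiff_vorticityTensor {k l : WithTop ℕ∞} (hc : ContDiff ℝ l v) (hk : k + 1 ≤ l)
    (i j : Fin n) : ContDiff ℝ k fun x => vorticityTensor v x i j :=
  (contDiff_partialDeriv_apply hc hk i j).sub (contDiff_partialDeriv_apply hc hk j i)

lemma isPeriodic_vorticityTensor (hv : IsPeriodic L v) (i j : Fin n) :
    IsPeriodic L fun x => vorticityTensor v x i j :=
  (hv.partialDeriv i).comp₂ (hv.partialDeriv j) fun a b => a j - b i

lemma summable_coeff_vorticityTensor (hn : n ≤ 3) (hL : 0 < L) (hv : IsPeriodic L v)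
    (hc : ContDiff ℝ 3 v) (i j : Fin n) : Summable (coeff L fun x => vorticityTensor v x i j) :=
  summable_coeff hn hL (isPeriodic_vorticityTensor hv i j)
    (contDiff_vorticityTensor hc (by norm_num) i j)

lemma tensorBiotSavart_vorticityTensor (hn : n ≤ 3) (hL : 0 < L) (hv : IsPeriodic L v)
    (hc : ContDiff ℝ 3 v) (hdiv : ∀ x, div v x = 0) (mean_zero : ∫ x in cell n L, v x = 0)
    (x : E n) : tensorBiotSavart L (vorticityTensor v) x = v x := by
  ext i
  have periodic (j : Fin n) : IsPeriodic L fun x => v x j := hv.comp fun y => y j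
  have contDiff (j : Fin n) : ContDiff ℝ 3 fun x => v x j := contDiff_euclidean.1 hc j
  have contDiff_one (j : Fin n) : ContDiff ℝ 1 fun x => v x j :=
    (contDiff j).of_le (by norm_num)
  have contDiff_deriv (j k : Fin n) : ContDiff ℝ 2 (partialDeriv j fun x => v x k) :=
    contDiff_partialDeriv (contDiff k) (by norm_num) j
  have summable_deriv (j k : Fin n) : Summable (coeff L (partialDeriv j fun x => v x k)) :=
    summable_coeff hn hL ((periodic k).partialDeriv j) (contDiff_deriv j k)
  have deriv_apply (j k : Fin n) (y : E n) :
      partialDeriv j v y k = partialDeriv j (fun x => v x k) y :=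
    partialDeriv_apply (hc.differentiable (by norm_num) y) j k
  have sum_gradInvLap_div : ∑ j, gradInvLap L i (partialDeriv j fun x => v x j) x = 0 := by
    rw [sum_gradInvLap _ hL.le (fun j _ => (contDiff_deriv j j).continuous)
      fun j _ => summable_deriv j j]
    simp_rw [← deriv_apply]
    exact (congrArg (gradInvLap L i · x) (funext hdiv)).trans (gradInvLap_zero i x)
  have recover_component :
      ∑ j, gradInvLap L j (partialDeriv j fun x => v x i) x = -v x i :=
    sum_gradInvLap_partialDeriv hL (periodic i) (contDiff_one i)
      (summable_coeff hn hL (periodic i) ((contDiff i).of_le (by norm_num)))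
      (fun j => summable_deriv j i)
      (by rw [integral_cell_apply hc.continuous, mean_zero]; rfl) x
  have split (j : Fin n) : gradInvLap L j (fun x => vorticityTensor v x i j) x
      = gradInvLap L i (partialDeriv j fun x => v x j) x
        - gradInvLap L j (partialDeriv j fun x => v x i) x := by
    simp only [vorticityTensor, Matrix.of_apply, deriv_apply]
    rw [gradInvLap_sub hL.le (contDiff_deriv i j).continuous (contDiff_deriv j i).continuous
      (summable_deriv i j) (summable_deriv j i),
      gradInvLap_partialDeriv_comm hL (periodic j) (contDiff_one j)]
  simp only [tensorBiotSavart, split, Finset.sum_sub_distrib, sum_gradInvLap_div,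
    recover_component, zero_sub, neg_neg]

lemma exists_isVelocityError (hn : n ≤ 3) (hL : 0 < L) (hv : IsPeriodic L v)
    (hc : ContDiff ℝ 3 v) (hdiv : ∀ x, div v x = 0) (mean_zero : ∫ x in cell n L, v x = 0)
    {W : E n → Matrix (Fin n) (Fin n) ℝ} (hW : ∀ i j, IsPeriodic L fun x => W x i j)
    (hWc : ∀ i j, ContDiff ℝ 2 fun x => W x i j) (skew : ∀ x i j, W x j i = -W x i j) {Y : ℝ}
    (hY : ∀ i, ∑ j, ∫ x in cell n L, (vorticityTensor v x i j - W x i j) ^ 2 ≤ Y) :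
    ∃ V, IsVelocityError L Y V ∧ ∀ x, tensorBiotSavart L W x = v x - V x := by
  have contDiff_vorticity := contDiff_vorticityTensor (k := 2) hc (by norm_num)
  have periodic_error (i j : Fin n) : IsPeriodic L fun x => vorticityTensor v x i j - W x i j :=
    (isPeriodic_vorticityTensor hv i j).comp₂ (hW i j) (· - ·)
  have contDiff_error (i j : Fin n) := (contDiff_vorticity i j).sub (hWc i j)
  have summable_error (i j : Fin n) :=
    summable_coeff hn hL (periodic_error i j) (contDiff_error i j)
  refine ⟨tensorBiotSavart L fun x => vorticityTensor v x - W x,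
    isVelocityError_tensorBiotSavart hL periodic_error (fun i j => (contDiff_error i j).continuous)
      summable_error (fun x i j => ?_) hY, fun x => ?_⟩
  · simp only [skew x i j, vorticityTensor, Matrix.of_apply]
    ring
  · rw [tensorBiotSavart_sub hL.le (fun i j => (contDiff_vorticity i j).continuous)
      (summable_coeff_vorticityTensor hn hL hv hc) (fun i j => (hWc i j).continuous)
      (fun i j => summable_coeff hn hL (hW i j) (hWc i j)),
      tensorBiotSavart_vorticityTensor hn hL hv hc hdiv mean_zero, sub_sub_cancel]

end VorticityTensor

/-! ### Dimensions two and three -/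

/-- The skew-symmetric matrix that represents a scalar curl. -/
def skew2 (a : ℝ) : Matrix (Fin 2) (Fin 2) ℝ := !![0, a; -a, 0]

/-- The skew-symmetric matrix that represents a vector curl. -/
def skew3 (a : E 3) : Matrix (Fin 3) (Fin 3) ℝ := !![0, a 2, -a 1; -a 2, 0, a 0; a 1, -a 0, 0]

lemma vorticityTensor_eq_skew2 (v : E 2 → E 2) (x : E 2) :
    vorticityTensor v x = skew2 (curl2 v x) := by
  ext i j
  fin_cases i <;> fin_cases j <;> simp [vorticityTensor, skew2, curl2]

lemma vorticityTensor_eq_skew3 (v : E 3 → E 3) (x : E 3) :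
    vorticityTensor v x = skew3 (curl3 v x) := by
  ext i j
  fin_cases i <;> fin_cases j <;> simp [vorticityTensor, skew3, curl3]

lemma biotSavart2_eq_tensorBiotSavart (w : E 2 → ℝ) (x : E 2) :
    biotSavart2 L w x = tensorBiotSavart L (fun y => skew2 (w y)) x := by
  ext i
  fin_cases i <;>
    simp only [biotSavart2, tensorBiotSavart, skew2, Fin.sum_univ_two, Fin.zero_eta, Fin.mk_one,
      Matrix.cons_val', Matrix.cons_val_zero, Matrix.cons_val_one, Matrix.of_apply,
      Matrix.cons_val_fin_one, gradInvLap_zero, gradInvLap_neg, zero_add, add_zero] <;>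
    simp only [gradInvLap, fourierSeries, gradInvLapSymbol, ← tsum_mul_left, ← Complex.neg_re,
      ← tsum_neg] <;>
    · congr 2
      funext m
      ring

lemma biotSavart3_eq_tensorBiotSavart (hL : 0 ≤ L) {w : E 3 → E 3}
    (hs : ∀ i, Summable (coeff L fun y => w y i)) (x : E 3) :
    biotSavart3 L w x = tensorBiotSavart L (fun y => skew3 (w y)) x := by
  have gradInvLap_sub_gradInvLap (i j k l : Fin 3) :
      gradInvLap L i (fun y => w y j) x - gradInvLap L k (fun y => w y l) x
        = (fourierSeries L (fun m => gradInvLapSymbol L i m * coeff L (fun y => w y j) m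
          - gradInvLapSymbol L k m * coeff L (fun y => w y l) m) x).re := by
    rw [fourierSeries_sub (summable_gradInvLapSymbol_mul hL _ (hs _))
      (summable_gradInvLapSymbol_mul hL _ (hs _)), Complex.sub_re]
    rfl
  ext i
  fin_cases i <;>
    simp only [biotSavart3, tensorBiotSavart, skew3, Fin.sum_univ_three, Fin.zero_eta, Fin.mk_one,
      Fin.reduceFinMk, Matrix.cons_val', Matrix.cons_val_zero, Matrix.cons_val_one,
      Matrix.cons_val, Matrix.of_apply, Matrix.cons_val_fin_one, gradInvLap_zero, gradInvLap_neg,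
      zero_add, add_zero, neg_add_eq_sub, ← sub_eq_add_neg, gradInvLap_sub_gradInvLap] <;>
    simp only [fourierSeries, gradInvLapSymbol, ← tsum_mul_left, cross_apply, Matrix.cons_val] <;>
    · congr 2
      funext m
      ring

lemma exists_isVelocityError2 (hL : 0 < L) {v : E 2 → E 2} (hv : IsPeriodic L v)
    (hc : ContDiff ℝ 3 v) (hdiv : ∀ x, div v x = 0) (mean_zero : ∫ x in cell 2 L, v x = 0)
    {w : E 2 → ℝ} (hw : IsPeriodic L w) (hwc : ContDiff ℝ 2 w) :
    ∃ V, IsVelocityError L (∫ x in cell 2 L, (curl2 v x - w x) ^ 2) V ∧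
      ∀ x, biotSavart2 L w x = v x - V x := by
  simp_rw [biotSavart2_eq_tensorBiotSavart]
  refine exists_isVelocityError (by norm_num) hL hv hc hdiv mean_zero
    (fun i j => hw.comp (skew2 · i j)) (fun i j => ?_) (fun x i j => ?_) fun i => le_of_eq ?_
  · fin_cases i <;> fin_cases j <;> first | exact contDiff_const | exact hwc | exact hwc.neg
  · fin_cases i <;> fin_cases j <;> simp [skew2]
  · simp_rw [vorticityTensor_eq_skew2]
    fin_cases i <;> simp [skew2, Fin.sum_univ_two, neg_add_eq_sub, sub_sq_comm (w _)]

lemma exists_isVelocityError3 (hL : 0 < L) {v : E 3 → E 3} (hv : IsPeriodic L v)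
    (hc : ContDiff ℝ 3 v) (hdiv : ∀ x, div v x = 0) (mean_zero : ∫ x in cell 3 L, v x = 0)
    {w : E 3 → E 3} (hw : IsPeriodic L w) (hwc : ContDiff ℝ 2 w) :
    ∃ V, IsVelocityError L (∑ i, ∫ x in cell 3 L, (curl3 v x i - w x i) ^ 2) V ∧
      ∀ x, biotSavart3 L w x = v x - V x := by
  have summable_components (i : Fin 3) : Summable (coeff L fun y => w y i) :=
    summable_coeff le_rfl hL (hw.comp fun y => y i) (by fun_prop)
  simp_rw [biotSavart3_eq_tensorBiotSavart hL.le summable_components]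
  refine exists_isVelocityError le_rfl hL hv hc hdiv mean_zero
    (fun i j => hw.comp (skew3 · i j)) (fun i j => ?_) (fun x i j => ?_) fun i => ?_
  · have contDiff_component (k : Fin 3) : ContDiff ℝ 2 fun x => w x k := contDiff_euclidean.1 hwc k
    fin_cases i <;> fin_cases j <;>
      first
      | exact contDiff_const
      | exact contDiff_component _
      | exact (contDiff_component _).neg
  · fin_cases i <;> fin_cases j <;> simp [skew3]
  · have nonneg (k : Fin 3) : 0 ≤ ∫ x in cell 3 L, (curl3 v x k - w x k) ^ 2 := by positivity
    simp_rw [vorticityTensor_eq_skew3]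
    fin_cases i <;> simp [skew3, Fin.sum_univ_three, neg_add_eq_sub, sub_sq_comm (w _ _)] <;>
      linarith [nonneg 0, nonneg 1, nonneg 2]

/-! ### Energy identities -/

/-- The squared `L²(Q)` norm of the gradient. -/
noncomputable def dissipation (L : ℝ) (z : E n → ℝ) : ℝ :=
  ∑ j, ∫ x in cell n L, partialDeriv j z x ^ 2

lemma dissipation_nonneg (z : E n → ℝ) : 0 ≤ dissipation L z :=
  Finset.sum_nonneg fun _ _ => integral_nonneg fun _ => sq_nonneg _

lemma integral_mul_laplacian (hL : 0 < L) {z : E n → ℝ} (hz : IsPeriodic L z)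
    (hc : ContDiff ℝ 2 z) : ∫ x in cell n L, z x * (Δ z) x = -dissipation L z := by
  have contDiff_deriv (j : Fin n) : ContDiff ℝ 1 (partialDeriv j z) :=
    contDiff_partialDeriv hc (by norm_num) j
  have continuous_deriv₂ (j : Fin n) : Continuous (partialDeriv j (partialDeriv j z)) :=
    continuous_partialDeriv (contDiff_deriv j) j
  have := hc.continuous
  simp_rw [laplacian_eq_sum hc, Finset.mul_sum]
  rw [integral_finsetSum _ fun j _ => integrableOn_cell (by fun_prop), dissipation,
    ← Finset.sum_neg_distrib]
  refine Finset.sum_congr rfl fun j _ => ?_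
  rw [hz.integral_mul_partialDeriv hL (hz.partialDeriv j) (hc.of_le one_le_two) (contDiff_deriv j)]
  simp_rw [sq]

lemma integral_mul_partialDeriv_sq (hL : 0 < L) {z v : E n → ℝ} (hz : IsPeriodic L z)
    (hv : IsPeriodic L v) (hc : ContDiff ℝ 1 z) (hvc : ContDiff ℝ 1 v) (j : Fin n) :
    ∫ x in cell n L, v x * (2 * (z x * partialDeriv j z x))
      = -∫ x in cell n L, partialDeriv j v x * (z x * z x) := by
  have differentiable_z := hc.differentiable one_ne_zero
  rw [← hv.integral_mul_partialDeriv hL (hz.comp₂ hz (· * ·)) hvc (hc.mul hc) j]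
  refine integral_congr_ae (Filter.Eventually.of_forall fun x => ?_)
  simp only [partialDeriv_mul (differentiable_z x) (differentiable_z x)]
  ring

lemma integral_mul_advect_self (hL : 0 < L) {z : E n → ℝ} (hz : IsPeriodic L z)
    (hc : ContDiff ℝ 1 z) {v : E n → E n} (hv : IsPeriodic L v) (hvc : ContDiff ℝ 1 v)
    (hdiv : ∀ x, div v x = 0) : ∫ x in cell n L, z x * advect v z x = 0 := by
  have contDiff_v (j : Fin n) : ContDiff ℝ 1 fun x => v x j := contDiff_euclidean.1 hvc j
  have integrable_transport (j : Fin n) :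
      IntegrableOn (fun x => v x j * (2 * (z x * partialDeriv j z x))) (cell n L) :=
    integrableOn_cell <| (contDiff_v j).continuous.mul <|
      continuous_const.mul (hc.continuous.mul (continuous_partialDeriv hc j))
  have integrable_compression (j : Fin n) :
      IntegrableOn (fun x => partialDeriv j v x j * (z x * z x)) (cell n L) :=
    integrableOn_cell <|
      (contDiff_partialDeriv_apply (k := 0) hvc (by norm_num) j j).continuous.mul
        (hc.continuous.mul hc.continuous)
  have by_parts (j : Fin n) : ∫ x in cell n L, v x j * (2 * (z x * partialDeriv j z x))
      = -∫ x in cell n L, partialDeriv j v x j * (z x * z x) := by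
    simp_rw [partialDeriv_apply (hvc.differentiable one_ne_zero _)]
    exact integral_mul_partialDeriv_sq hL hz (hv.comp fun y => y j) hc (contDiff_v j) j
  suffices 2 * ∫ x in cell n L, z x * advect v z x = 0 by linarith
  calc 2 * ∫ x in cell n L, z x * advect v z x
      = ∫ x in cell n L, ∑ j, v x j * (2 * (z x * partialDeriv j z x)) := by
        rw [← integral_const_mul]
        refine integral_congr_ae (Filter.Eventually.of_forall fun x => ?_)
        simp only [advect, smul_eq_mul, Finset.mul_sum]
        exact Finset.sum_congr rfl fun j _ => by ring
    _ = -∫ x in cell n L, div v x * (z x * z x) := by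
        simp_rw [div, Finset.sum_mul]
        rw [integral_finsetSum _ fun j _ => integrable_transport j,
          integral_finsetSum _ fun j _ => integrable_compression j, ← Finset.sum_neg_distrib]
        exact Finset.sum_congr rfl fun j _ => by_parts j
    _ = 0 := by simp [hdiv]

/-- Joint regularity of a periodic function `z` on `[a, b] × ℝⁿ` with time derivative `zt` on
`(a, b)`: what the energy method requires. -/
structure IsEvolution (L a b : ℝ) (z zt : ℝ → E n → ℝ) : Prop where
  continuousOn : ContinuousOn (fun q : ℝ × E n => z q.1 q.2) (Icc a b ×ˢ univ)
  hasDerivAt : ∀ t ∈ Ioo a b, ∀ x, HasDerivAt (fun s => z s x) (zt t x) t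
  continuousOn_deriv : ContinuousOn (fun q : ℝ × E n => zt q.1 q.2) (Ioo a b ×ˢ univ)
  contDiff : ∀ t ∈ Ioo a b, ContDiff ℝ 2 (z t)
  periodic : ∀ t ∈ Icc a b, IsPeriodic L (z t)

lemma continuous_slice {F : Type*} [TopologicalSpace F] {z : ℝ → E n → F} {s : Set ℝ}
    (h : ContinuousOn (fun q : ℝ × E n => z q.1 q.2) (s ×ˢ univ)) {t : ℝ} (ht : t ∈ s) :
    Continuous (z t) :=
  h.comp_continuous (Continuous.prodMk_right t) fun _ => ⟨ht, mem_univ _⟩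

lemma exists_bound_of_continuousOn {F : Type*} [NormedAddCommGroup F] {z : ℝ → E n → F}
    {a b : ℝ} (h : ContinuousOn (fun q : ℝ × E n => z q.1 q.2) (Icc a b ×ˢ univ)) (R : ℝ) :
    ∃ M, ∀ t ∈ Icc a b, ∀ x ∈ Metric.closedBall (0 : E n) R, ‖z t x‖ ≤ M := by
  obtain ⟨M, hM⟩ :=
    (isCompact_Icc.prod (isCompact_closedBall (0 : E n) R)).exists_bound_of_continuousOn
      (h.mono (prod_mono_right (subset_univ _)))
  exact ⟨M, fun t ht x hx => hM (t, x) ⟨ht, hx⟩⟩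

section IsEvolution

variable {a b : ℝ} {z zt w wt : ℝ → E n → ℝ}

lemma IsEvolution.sub (hz : IsEvolution L a b z zt) (hw : IsEvolution L a b w wt) :
    IsEvolution L a b (fun t x => z t x - w t x) fun t x => zt t x - wt t x where
  continuousOn := hz.continuousOn.sub hw.continuousOn
  hasDerivAt t ht x := (hz.hasDerivAt t ht x).sub (hw.hasDerivAt t ht x)
  continuousOn_deriv := hz.continuousOn_deriv.sub hw.continuousOn_deriv
  contDiff t ht := (hz.contDiff t ht).sub (hw.contDiff t ht)
  periodic t ht := (hz.periodic t ht).comp₂ (hw.periodic t ht) (· - ·)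

lemma IsEvolution.continuousOn_energy (hz : IsEvolution L a b z zt) :
    ContinuousOn (fun t => ∫ x in cell n L, z t x ^ 2) (Icc a b) := by
  obtain ⟨M, hM⟩ := exists_bound_of_continuousOn hz.continuousOn (Real.sqrt (n * L ^ 2))
  refine continuousOn_of_dominated (bound := fun _ => M ^ 2) (fun t ht => ?_) (fun t ht => ?_)
    (integrable_const _) (Filter.Eventually.of_forall fun x => ?_)
  · exact ((continuous_slice hz.continuousOn ht).pow 2).aestronglyMeasurable
  · refine (ae_restrict_iff' measurableSet_cell).2 (Filter.Eventually.of_forall fun x hx => ?_)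
    rw [norm_pow]
    exact pow_le_pow_left₀ (norm_nonneg _) (hM t ht x (cell_subset_closedBall hx)) 2
  · exact (hz.continuousOn.comp (f := fun t : ℝ => ((t, x) : ℝ × E n)) (by fun_prop)
      fun t ht => ⟨ht, mem_univ _⟩).pow 2

lemma IsEvolution.hasDerivAt_energy (hz : IsEvolution L a b z zt) {t : ℝ} (ht : t ∈ Ioo a b) :
    HasDerivAt (fun t => ∫ x in cell n L, z t x ^ 2)
      (∫ x in cell n L, 2 * (z t x * zt t x)) t := by
  obtain ⟨a', lt_a', a'_lt⟩ := exists_between ht.1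
  obtain ⟨b', lt_b', b'_lt⟩ := exists_between ht.2
  have Icc_subset : Icc a' b' ⊆ Ioo a b :=
    fun s hs => ⟨lt_a'.trans_le hs.1, hs.2.trans_lt b'_lt⟩
  have Icc_mem : Icc a' b' ∈ nhds t := Icc_mem_nhds a'_lt lt_b'
  have continuousOn_integrand :
      ContinuousOn (fun q : ℝ × E n => 2 * (z q.1 q.2 * zt q.1 q.2)) (Icc a' b' ×ˢ univ) :=
    continuousOn_const.mul
      ((hz.continuousOn.mono (prod_mono_left (Icc_subset.trans Ioo_subset_Icc_self))).mul
        (hz.continuousOn_deriv.mono (prod_mono_left Icc_subset)))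
  obtain ⟨M, hM⟩ := exists_bound_of_continuousOn (z := fun t x => 2 * (z t x * zt t x))
    continuousOn_integrand (Real.sqrt (n * L ^ 2))
  have continuous_z {s : ℝ} (hs : s ∈ Ioo a b) : Continuous (z s) :=
    continuous_slice hz.continuousOn (Ioo_subset_Icc_self hs)
  refine (hasDerivAt_integral_of_dominated_loc_of_deriv_le
    (F := fun s x => z s x ^ 2) (F' := fun s x => 2 * (z s x * zt s x))
    (bound := fun _ => M) Icc_mem ?_ (integrableOn_cell ((continuous_z ht).pow 2)) ?_ ?_
    (integrable_const _) (Filter.Eventually.of_forall fun x s hs => ?_)).2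
  · filter_upwards [Icc_mem] with s hs
    exact ((continuous_z (Icc_subset hs)).pow 2).aestronglyMeasurable
  · exact (continuous_slice (z := fun s x => 2 * (z s x * zt s x)) continuousOn_integrand
      ⟨a'_lt.le, lt_b'.le⟩).aestronglyMeasurable
  · exact (ae_restrict_iff' measurableSet_cell).2 (Filter.Eventually.of_forall
      fun x hx s hs => hM s hs x (cell_subset_closedBall hx))
  · convert! (hz.hasDerivAt s (Icc_subset hs) x).pow 2 using 1
    simp
    ring

end IsEvolution

/-! ### Fields that are smooth in space and time -/

section JointSmoothness

variable {F : Type*} [NormedAddCommGroup F] [NormedSpace ℝ F]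

/-- `z` is of class `C^k` on `[0, T] × ℝⁿ`. -/
def IsJointlyContDiff (T : ℝ) (k : WithTop ℕ∞) (z : ℝ → E n → F) : Prop :=
  ContDiffOn ℝ k (fun q : ℝ × E n => z q.1 q.2) (Icc 0 T ×ˢ univ)

/-- The time derivative in `[0, T]`, one-sided at the end points. -/
noncomputable def timeDeriv (T : ℝ) (z : ℝ → E n → F) (t : ℝ) (x : E n) : F :=
  derivWithin (fun s => z s x) (Icc 0 T) t

lemma uniqueDiffOn_slab (hT : 0 < T) : UniqueDiffOn ℝ (Icc 0 T ×ˢ univ : Set (ℝ × E n)) :=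
  (uniqueDiffOn_Icc hT).prod uniqueDiffOn_univ

lemma slab_mem_nhds {q : ℝ × E n} (hq : q.1 ∈ Ioo 0 T) : Icc 0 T ×ˢ univ ∈ nhds q :=
  prod_mem_nhds (Icc_mem_nhds hq.1 hq.2) Filter.univ_mem

namespace IsJointlyContDiff

variable {k l : WithTop ℕ∞} {z : ℝ → E n → F} {t : ℝ}

lemma mono (h : IsJointlyContDiff T l z) (hk : k ≤ l) : IsJointlyContDiff T k z :=
  ContDiffOn.of_le h hk

lemma slice (h : IsJointlyContDiff T k z) (ht : t ∈ Icc 0 T) : ContDiff ℝ k (z t) :=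
  contDiffOn_univ.1 <| ContDiffOn.comp (g := fun q : ℝ × E n => z q.1 q.2) h
    (contDiff_prodMk_right t).contDiffOn fun _ _ => ⟨ht, mem_univ _⟩

lemma sub {w : ℝ → E n → F} (h : IsJointlyContDiff T k z) (hw : IsJointlyContDiff T k w) :
    IsJointlyContDiff T k fun t x => z t x - w t x :=
  ContDiffOn.sub h hw

lemma hasFDerivWithinAt (h : IsJointlyContDiff T 1 z) (ht : t ∈ Icc 0 T) (x : E n) :
    HasFDerivWithinAt (fun q : ℝ × E n => z q.1 q.2)
      (fderivWithin ℝ (fun q : ℝ × E n => z q.1 q.2) (Icc 0 T ×ˢ univ) (t, x))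
      (Icc 0 T ×ˢ univ) (t, x) :=
  (ContDiffOn.differentiableOn h one_ne_zero (t, x) ⟨ht, mem_univ _⟩).hasFDerivWithinAt

lemma fderiv_eq (h : IsJointlyContDiff T 1 z) (ht : t ∈ Icc 0 T) (x : E n) :
    fderiv ℝ (z t) x
      = (fderivWithin ℝ (fun q : ℝ × E n => z q.1 q.2) (Icc 0 T ×ˢ univ) (t, x)).comp
        (ContinuousLinearMap.inr ℝ ℝ (E n)) := by
  have hasFDerivWithinAt_slice := (h.hasFDerivWithinAt ht x).comp x
    (hasFDerivAt_prodMk_right t x).hasFDerivWithinAt (s := univ) fun _ _ => ⟨ht, mem_univ _⟩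
  exact (hasFDerivWithinAt_univ.1 hasFDerivWithinAt_slice).fderiv

lemma hasDerivWithinAt (h : IsJointlyContDiff T 1 z) (ht : t ∈ Icc 0 T) (x : E n) :
    HasDerivWithinAt (fun s => z s x) (fderivWithin ℝ (fun q : ℝ × E n => z q.1 q.2)
      (Icc 0 T ×ˢ univ) (t, x) (1, 0)) (Icc 0 T) t :=
  HasFDerivWithinAt.comp_hasDerivWithinAt (l := fun q : ℝ × E n => z q.1 q.2)
    (t := Icc 0 T ×ˢ univ) t
    (h.hasFDerivWithinAt ht x) ((hasDerivWithinAt_id t _).prodMk (hasDerivWithinAt_const t _ x))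
    fun _ hs => ⟨hs, mem_univ _⟩

lemma timeDeriv_eq (hT : 0 < T) (h : IsJointlyContDiff T 1 z) (ht : t ∈ Icc 0 T) (x : E n) :
    timeDeriv T z t x
      = fderivWithin ℝ (fun q : ℝ × E n => z q.1 q.2) (Icc 0 T ×ˢ univ) (t, x) (1, 0) :=
  (h.hasDerivWithinAt ht x).derivWithin (uniqueDiffOn_Icc hT t ht)

lemma hasDerivAt_timeDeriv (h : IsJointlyContDiff T 1 z) (ht : t ∈ Ioo 0 T) (x : E n) :
    HasDerivAt (fun s => z s x) (timeDeriv T z t x) t := by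
  rw [timeDeriv_eq (ht.1.trans ht.2) h (Ioo_subset_Icc_self ht)]
  exact (h.hasDerivWithinAt (Ioo_subset_Icc_self ht) x).hasDerivAt (Icc_mem_nhds ht.1 ht.2)

protected lemma fderiv (hT : 0 < T) (h : IsJointlyContDiff T l z) (hk : k + 1 ≤ l) :
    IsJointlyContDiff T k fun t => fderiv ℝ (z t) :=
  ((ContDiffOn.fderivWithin h (uniqueDiffOn_slab hT) hk).clm_comp contDiffOn_const).congr
    fun q hq => fderiv_eq (h.mono (le_add_self.trans hk)) hq.1 q.2

protected lemma partialDeriv (hT : 0 < T) (h : IsJointlyContDiff T l z) (hk : k + 1 ≤ l)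
    (j : Fin n) :
    IsJointlyContDiff T k fun t => partialDeriv j (z t) :=
  ContDiffOn.clm_apply (h.fderiv hT hk) contDiffOn_const

protected lemma timeDeriv (hT : 0 < T) (h : IsJointlyContDiff T l z) (hk : k + 1 ≤ l) :
    IsJointlyContDiff T k (timeDeriv T z) :=
  ((ContDiffOn.fderivWithin h (uniqueDiffOn_slab hT) hk).clm_apply contDiffOn_const).congr
    fun q hq => timeDeriv_eq hT (h.mono (le_add_self.trans hk)) hq.1 q.2

lemma timeDeriv_partialDeriv (h : IsJointlyContDiff T 2 z) (ht : t ∈ Ioo 0 T) (x : E n)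
    (j : Fin n) :
    timeDeriv T (fun t => partialDeriv j (z t)) t x
      = partialDeriv j (timeDeriv T z t) x := by
  have hT := ht.1.trans ht.2
  have t_mem := Ioo_subset_Icc_self ht
  set Z : ℝ × E n → F := fun q => z q.1 q.2
  have contDiffAt : ContDiffAt ℝ 2 Z (t, x) := ContDiffOn.contDiffAt h (slab_mem_nhds ht)
  have fderiv_differentiableAt : DifferentiableAt ℝ (fderiv ℝ Z) (t, x) :=
    (contDiffAt.fderiv_right (m := 1) (by norm_num)).differentiableAt one_ne_zero
  have fderiv_fderiv_apply (a b : ℝ × E n) : fderiv ℝ (fun q => fderiv ℝ Z q a) (t, x) b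
      = fderiv ℝ (fderiv ℝ Z) (t, x) b a := by
    have := (fderiv_differentiableAt.hasFDerivAt.clm_apply (hasFDerivAt_const a (t, x))).fderiv
    simpa using! congrArg (fun f => f b) this
  have eventually_interior : ∀ᶠ q : ℝ × E n in nhds (t, x), q.1 ∈ Ioo 0 T :=
    continuous_fst.continuousAt.eventually (Ioo_mem_nhds ht.1 ht.2)
  have partialDeriv_eventuallyEq :
      (fun q : ℝ × E n => partialDeriv j (z q.1) q.2) =ᶠ[nhds (t, x)]
        fun q => fderiv ℝ Z q (0, EuclideanSpace.single j 1) := by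
    filter_upwards [eventually_interior] with q hq
    rw [partialDeriv, (h.mono one_le_two).fderiv_eq (Ioo_subset_Icc_self hq),
      fderivWithin_of_mem_nhds (slab_mem_nhds hq)]
    rfl
  have timeDeriv_eventuallyEq :
      (fun q : ℝ × E n => timeDeriv T z q.1 q.2) =ᶠ[nhds (t, x)]
        fun q => fderiv ℝ Z q (1, 0) := by
    filter_upwards [eventually_interior] with q hq
    rw [timeDeriv_eq hT (h.mono one_le_two) (Ioo_subset_Icc_self hq),
      fderivWithin_of_mem_nhds (slab_mem_nhds hq)]
  rw [timeDeriv_eq hT (h.partialDeriv hT (by norm_num) j) t_mem, partialDeriv,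
    fderiv_eq (h.timeDeriv hT (by norm_num)) t_mem, fderivWithin_of_mem_nhds (slab_mem_nhds ht),
    fderivWithin_of_mem_nhds (slab_mem_nhds ht), partialDeriv_eventuallyEq.fderiv_eq,
    timeDeriv_eventuallyEq.fderiv_eq, fderiv_fderiv_apply]
  simpa only [ContinuousLinearMap.comp_apply, ContinuousLinearMap.inr_apply, fderiv_fderiv_apply]
    using (contDiffAt.isSymmSndFDerivAt (by simp)).eq _ _

lemma exists_bound (h : IsJointlyContDiff T 0 z) (L : ℝ) :
    ∃ M, ∀ t ∈ Icc 0 T, ∀ x ∈ cell n L, ‖z t x‖ ≤ M := by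
  obtain ⟨M, hM⟩ := exists_bound_of_continuousOn (ContDiffOn.continuousOn h) (Real.sqrt (n * L ^ 2))
  exact ⟨M, fun t ht x hx => hM t ht x (cell_subset_closedBall hx)⟩

lemma exists_lipschitz (hT : 0 < T) (h : IsJointlyContDiff T 1 z) (L : ℝ) :
    ∃ Λ, ∀ s ∈ Icc 0 T, ∀ t ∈ Icc 0 T, ∀ x ∈ cell n L, ‖z t x - z s x‖ ≤ Λ * |t - s| := by
  obtain ⟨Λ, hΛ⟩ := (h.timeDeriv (k := 0) hT (by norm_num)).exists_bound L
  refine ⟨Λ, fun s hs t ht x hx => ?_⟩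
  refine (convex_Icc 0 T).norm_image_sub_le_of_norm_hasDerivWithin_le (f := fun s => z s x)
    (fun r hr => h.hasDerivWithinAt hr x) (fun r hr => ?_) hs ht
  rw [← timeDeriv_eq hT h hr]
  exact hΛ r hr x hx

lemma isEvolution {z : ℝ → E n → ℝ} (h : IsJointlyContDiff T 2 z) (hT : 0 < T)
    (hz : ∀ t ∈ Icc 0 T, IsPeriodic L (z t)) {a b : ℝ} (ha : 0 ≤ a) (hb : b ≤ T) :
    IsEvolution L a b z (timeDeriv T z) where
  continuousOn := (ContDiffOn.continuousOn h).mono (prod_mono_left (Icc_subset_Icc ha hb))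
  hasDerivAt t ht x := (h.mono one_le_two).hasDerivAt_timeDeriv (Ioo_subset_Ioo ha hb ht) x
  continuousOn_deriv := (ContDiffOn.continuousOn (h.timeDeriv hT (k := 1) (by norm_num))).mono
    (prod_mono_left (Ioo_subset_Icc_self.trans (Icc_subset_Icc ha hb)))
  contDiff t ht := h.slice (Icc_subset_Icc ha hb (Ioo_subset_Icc_self ht))
  periodic t ht := hz t (Icc_subset_Icc ha hb ht)

lemma apply {k : ℕ} {z : ℝ → E n → E k} (h : IsJointlyContDiff T l z) (i : Fin k) :
    IsJointlyContDiff T l fun t x => z t x i :=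
  (EuclideanSpace.proj (𝕜 := ℝ) i).contDiff.comp_contDiffOn h

lemma timeDeriv_apply {k : ℕ} {z : ℝ → E n → E k} (h : IsJointlyContDiff T 1 z) (ht : t ∈ Ioo 0 T)
    (x : E n) (i : Fin k) :
    timeDeriv T z t x i = timeDeriv T (fun t x => z t x i) t x :=
  ((EuclideanSpace.proj (𝕜 := ℝ) i).hasFDerivAt.comp_hasDerivAt t
    (h.hasDerivAt_timeDeriv ht x)).unique ((h.apply i).hasDerivAt_timeDeriv ht x)

lemma timeDeriv_sub {w : ℝ → E n → F} (h : IsJointlyContDiff T 1 z) (hw : IsJointlyContDiff T 1 w)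
    (ht : t ∈ Ioo 0 T) (x : E n) : timeDeriv T (fun t x => z t x - w t x) t x
      = timeDeriv T z t x - timeDeriv T w t x :=
  ((h.sub hw).hasDerivAt_timeDeriv ht x).unique
    ((h.hasDerivAt_timeDeriv ht x).sub (hw.hasDerivAt_timeDeriv ht x))

end IsJointlyContDiff

end JointSmoothness

/-! ### The vorticity equation -/

section PartialDeriv

variable {F : Type*} [NormedAddCommGroup F] [NormedSpace ℝ F] {v w : E n → F} {x : E n}

lemma partialDeriv_add (hv : DifferentiableAt ℝ v x) (hw : DifferentiableAt ℝ w x) (i : Fin n) :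
    partialDeriv i (fun x => v x + w x) x = partialDeriv i v x + partialDeriv i w x := by
  simp only [partialDeriv, fderiv_fun_add hv hw, add_apply]

lemma partialDeriv_const_smul (hw : DifferentiableAt ℝ w x) (c : ℝ) (i : Fin n) :
    partialDeriv i (fun x => c • w x) x = c • partialDeriv i w x := by
  simp only [partialDeriv, fderiv_fun_const_smul hw, smul_apply]

lemma partialDeriv_smul {c : E n → ℝ} (hc : DifferentiableAt ℝ c x) (hw : DifferentiableAt ℝ w x)
    (i : Fin n) : partialDeriv i (fun x => c x • w x) x
      = c x • partialDeriv i w x + partialDeriv i c x • w x := by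
  simp [partialDeriv, fderiv_fun_smul hc hw]

lemma contDiff_laplacian (hw : ContDiff ℝ 3 w) : ContDiff ℝ 1 (Δ w) := by
  rw [funext (laplacian_eq_sum (hw.of_le (by norm_num)))]
  exact ContDiff.sum fun j _ => contDiff_partialDeriv (k := 1)
    (contDiff_partialDeriv (k := 2) hw (by norm_num) j) (by norm_num) j

lemma partialDeriv_laplacian (hw : ContDiff ℝ 3 w) (k : Fin n) (x : E n) :
    partialDeriv k (Δ w) x = (Δ (partialDeriv k w)) x := by
  have hw₂ : ContDiff ℝ 2 w := hw.of_le (by norm_num)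
  have contDiff_deriv (j : Fin n) : ContDiff ℝ 2 (partialDeriv j w) :=
    contDiff_partialDeriv hw (by norm_num) j
  have contDiff_deriv₂ (j : Fin n) : ContDiff ℝ 1 (partialDeriv j (partialDeriv j w)) :=
    contDiff_partialDeriv (contDiff_deriv j) (by norm_num) j
  rw [laplacian_eq_sum (contDiff_deriv k), funext (laplacian_eq_sum hw₂),
    partialDeriv_sum fun j _ => (contDiff_deriv₂ j).differentiable one_ne_zero x]
  refine Finset.sum_congr rfl fun j _ => ?_
  rw [partialDeriv_comm (contDiff_deriv j), funext fun y => partialDeriv_comm hw₂ k j y]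

lemma laplacian_apply {k : ℕ} {v : E n → E k} (hv : ContDiff ℝ 2 v) (x : E n) (i : Fin k) :
    (Δ v) x i = (Δ fun y => v y i) x :=
  (hv.contDiffAt.laplacian_CLM_comp_left (l := EuclideanSpace.proj (𝕜 := ℝ) i)).symm

lemma contDiff_advect {v : E n → E n} (hv : ContDiff ℝ 1 v) (hw : ContDiff ℝ 2 w) :
    ContDiff ℝ 1 (advect v w) :=
  ContDiff.sum fun j _ => (contDiff_euclidean.1 hv j).smul
    (contDiff_partialDeriv hw (by norm_num) j)

lemma partialDeriv_advect {v : E n → E n} (hv : DifferentiableAt ℝ v x) (hw : ContDiff ℝ 2 w)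
    (k : Fin n) : partialDeriv k (advect v w) x
      = advect v (partialDeriv k w) x + advect (partialDeriv k v) w x := by
  have differentiable_component (j : Fin n) : DifferentiableAt ℝ (fun y => v y j) x :=
    differentiableAt_euclidean.1 hv j
  have differentiable_deriv (j : Fin n) : DifferentiableAt ℝ (partialDeriv j w) x :=
    (contDiff_partialDeriv (k := 1) hw (by norm_num) j).differentiable one_ne_zero x
  change partialDeriv k (fun y => ∑ j, v y j • partialDeriv j w y) x = _
  simp only [advect, ← Finset.sum_add_distrib]
  rw [partialDeriv_sum fun j _ => (differentiable_component j).fun_smul (differentiable_deriv j)]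
  refine Finset.sum_congr rfl fun j _ => ?_
  rw [partialDeriv_smul (differentiable_component j) (differentiable_deriv j),
    partialDeriv_apply hv, partialDeriv_comm hw]

lemma advect_apply {k : ℕ} {v : E n → E n} {w : E n → E k} (hw : DifferentiableAt ℝ w x)
    (i : Fin k) : advect v w x i = advect v (fun y => w y i) x := by
  simp [advect, partialDeriv_apply hw]

lemma advect_sub {u : E n → E n} (hv : DifferentiableAt ℝ v x) (hw : DifferentiableAt ℝ w x) :
    advect u (fun x => v x - w x) x = advect u v x - advect u w x := by
  simp only [advect, partialDeriv_sub hv hw, smul_sub, Finset.sum_sub_distrib]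

lemma contDiff_gradient {q : E n → ℝ} (hq : ContDiff ℝ 2 q) : ContDiff ℝ 1 (gradient q) :=
  (InnerProductSpace.toDual ℝ (E n)).symm.contDiff.comp (hq.fderiv_right (by norm_num))

lemma gradient_apply (q : E n → ℝ) (x : E n) (i : Fin n) :
    gradient q x i = partialDeriv i q x := by
  calc gradient q x i = inner ℝ (gradient q x) (EuclideanSpace.single i (1 : ℝ)) := by
        rw [EuclideanSpace.inner_single_right]; simp
    _ = partialDeriv i q x := by rw [inner_gradient_left]; rfl

lemma partialDeriv_gradient_apply_comm {q : E n → ℝ} (hq : ContDiff ℝ 2 q) (k i : Fin n)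
    (x : E n) : partialDeriv k (gradient q) x i = partialDeriv i (gradient q) x k := by
  have differentiable_gradient := (contDiff_gradient hq).differentiable one_ne_zero x
  simp only [partialDeriv_apply differentiable_gradient, gradient_apply]
  exact partialDeriv_comm hq k i x

end PartialDeriv

namespace IsNSESolution

variable {f : ℝ → E n → E n} {φ : E n → E n} {u : ℝ → E n → E n} {p : ℝ → E n → ℝ} {t : ℝ}

lemma isJointlyContDiff (h : IsNSESolution L T σ f φ u p) : IsJointlyContDiff T 3 u :=
  h.smooth_velocity

lemma partialDeriv_force (h : IsNSESolution L T σ f φ u p) (ht : t ∈ Ioo 0 T) (x : E n)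
    (k : Fin n) : partialDeriv k (f t) x
      = partialDeriv k (gradient (p t)) x
        + (advect (u t) (partialDeriv k (u t)) x + advect (partialDeriv k (u t)) (u t) x)
        - (σ ^ 2 / 2) • (Δ (partialDeriv k (u t))) x
        - timeDeriv T (fun t => partialDeriv k (u t)) t x := by
  have t_mem := Ioo_subset_Ico_self ht
  have smooth := h.isJointlyContDiff
  have smooth_slice : ContDiff ℝ 3 (u t) := smooth.slice (Ioo_subset_Icc_self ht)
  have smooth_slice₂ : ContDiff ℝ 2 (u t) := smooth_slice.of_le (by norm_num)
  have force_eq : f t = fun x => gradient (p t) x + advect (u t) (u t) x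
      - (σ ^ 2 / 2) • (Δ (u t)) x - timeDeriv T u t x := by
    funext x
    rw [← sub_eq_zero, ← h.momentum t t_mem x, timeDeriv]
    abel
  have diff_gradient : DifferentiableAt ℝ (gradient (p t)) x :=
    (contDiff_gradient (h.smooth_pressure t t_mem)).differentiable one_ne_zero x
  have diff_advect : DifferentiableAt ℝ (advect (u t) (u t)) x :=
    (contDiff_advect (smooth_slice.of_le (by norm_num)) smooth_slice₂).differentiable one_ne_zero x
  have diff_laplacian : DifferentiableAt ℝ (Δ (u t)) x :=
    (contDiff_laplacian smooth_slice).differentiable one_ne_zero x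
  have diff_timeDeriv : DifferentiableAt ℝ (timeDeriv T u t) x :=
    ((smooth.timeDeriv (k := 2) (ht.1.trans ht.2) (by norm_num)).slice
      (Ioo_subset_Icc_self ht)).differentiable two_ne_zero x
  rw [force_eq, partialDeriv_sub (by fun_prop) diff_timeDeriv,
    partialDeriv_sub (by fun_prop) (by fun_prop), partialDeriv_add diff_gradient diff_advect,
    partialDeriv_const_smul diff_laplacian, partialDeriv_laplacian smooth_slice,
    partialDeriv_advect (smooth_slice.differentiable (by norm_num) x) smooth_slice₂,
    (smooth.mono (by norm_num)).timeDeriv_partialDeriv ht]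

lemma vorticityTensor_equation (h : IsNSESolution L T σ f φ u p) (ht : t ∈ Ioo 0 T) (x : E n)
    (k i : Fin n) :
    timeDeriv T (fun t x => vorticityTensor (u t) x k i) t x
      + σ ^ 2 / 2 * (Δ fun x => vorticityTensor (u t) x k i) x
      - advect (u t) (fun x => vorticityTensor (u t) x k i) x
      - (advect (partialDeriv k (u t)) (u t) x i - advect (partialDeriv i (u t)) (u t) x k)
      + vorticityTensor (f t) x k i = 0 := by
  have smooth_deriv (j : Fin n) : IsJointlyContDiff T 2 fun t => partialDeriv j (u t) :=
    h.isJointlyContDiff.partialDeriv (ht.1.trans ht.2) (by norm_num) j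
  have smooth_slice (j : Fin n) : ContDiff ℝ 2 (partialDeriv j (u t)) :=
    (smooth_deriv j).slice (Ioo_subset_Icc_self ht)
  have smooth_component (j l : Fin n) : ContDiff ℝ 2 fun x => partialDeriv j (u t) x l :=
    contDiff_euclidean.1 (smooth_slice j) l
  have diff_component (j l : Fin n) : DifferentiableAt ℝ (fun x => partialDeriv j (u t) x l) x :=
    (smooth_component j l).differentiable two_ne_zero x
  have force_apply (j l : Fin n) : partialDeriv j (f t) x l
      = partialDeriv j (gradient (p t)) x l
        + (advect (u t) (fun x => partialDeriv j (u t) x l) x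
          + advect (partialDeriv j (u t)) (u t) x l)
        - σ ^ 2 / 2 * (Δ fun x => partialDeriv j (u t) x l) x
        - timeDeriv T (fun t x => partialDeriv j (u t) x l) t x := by
    rw [h.partialDeriv_force ht, ← ((smooth_deriv j).mono one_le_two).timeDeriv_apply ht,
      ← laplacian_apply (smooth_slice j),
      ← advect_apply ((smooth_slice j).differentiable two_ne_zero x)]
    rfl
  have time_sub := (((smooth_deriv k).mono one_le_two).apply i).timeDeriv_sub
    (((smooth_deriv i).mono one_le_two).apply k) ht x
  have laplacian_sub : (Δ fun x => partialDeriv k (u t) x i - partialDeriv i (u t) x k) x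
      = (Δ fun x => partialDeriv k (u t) x i) x - (Δ fun x => partialDeriv i (u t) x k) x :=
    (smooth_component k i).contDiffAt.laplacian_sub (smooth_component i k).contDiffAt
  simp only [vorticityTensor, Matrix.of_apply, time_sub, laplacian_sub,
    advect_sub (diff_component k i) (diff_component i k), force_apply,
    partialDeriv_gradient_apply_comm (h.smooth_pressure t (Ioo_subset_Ico_self ht)) k i]
  ring

end IsNSESolution

lemma curl2_eq_vorticityTensor (v : E 2 → E 2) (x : E 2) : curl2 v x = vorticityTensor v x 0 1 := by
  simp [vorticityTensor_eq_skew2, skew2]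

lemma curl3_apply_eq_vorticityTensor (v : E 3 → E 3) (x : E 3) (i : Fin 3) :
    curl3 v x i = vorticityTensor v x (i + 1) (i + 2) := by
  rw [vorticityTensor_eq_skew3]
  fin_cases i <;> simp [skew3]

lemma advect_partialDeriv_sub_eq_div_mul_curl2 (v : E 2 → E 2) (x : E 2) :
    advect (partialDeriv 0 v) v x 1 - advect (partialDeriv 1 v) v x 0 = div v x * curl2 v x := by
  simp only [advect, div, curl2, Fin.sum_univ_two, PiLp.add_apply, PiLp.smul_apply, smul_eq_mul]
  ring

lemma advect_partialDeriv_sub_eq_div_mul_curl3_sub (v : E 3 → E 3) (x : E 3) (i : Fin 3) :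
    advect (partialDeriv (i + 1) v) v x (i + 2) - advect (partialDeriv (i + 2) v) v x (i + 1)
      = div v x * curl3 v x i - advect (curl3 v) v x i := by
  simp only [advect, div, curl3, Fin.sum_univ_three, PiLp.add_apply, PiLp.smul_apply, smul_eq_mul]
  fin_cases i <;> simp <;> ring

namespace IsNSESolution

section DimensionTwo

variable {f : ℝ → E 2 → E 2} {φ : E 2 → E 2} {u : ℝ → E 2 → E 2} {p : ℝ → E 2 → ℝ} {t : ℝ}

lemma isJointlyContDiff_curl2 (h : IsNSESolution L T σ f φ u p) (hT : 0 < T) :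
    IsJointlyContDiff T 2 fun t => curl2 (u t) :=
  ((h.isJointlyContDiff.partialDeriv hT (by norm_num) 0).apply 1).sub
    ((h.isJointlyContDiff.partialDeriv hT (by norm_num) 1).apply 0)

lemma curl2_equation (h : IsNSESolution L T σ f φ u p) (ht : t ∈ Ioo 0 T) (x : E 2) :
    timeDeriv T (fun t => curl2 (u t)) t x + σ ^ 2 / 2 * (Δ (curl2 (u t))) x
      - advect (u t) (curl2 (u t)) x + curl2 (f t) x = 0 := by
  simpa only [advect_partialDeriv_sub_eq_div_mul_curl2, h.div_free t (Ioo_subset_Icc_self ht) x,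
    zero_mul, ← curl2_eq_vorticityTensor, sub_zero] using h.vorticityTensor_equation ht x 0 1

end DimensionTwo

section DimensionThree

variable {f : ℝ → E 3 → E 3} {φ : E 3 → E 3} {u : ℝ → E 3 → E 3} {p : ℝ → E 3 → ℝ} {t : ℝ}

lemma isJointlyContDiff_curl3 (h : IsNSESolution L T σ f φ u p) (hT : 0 < T) :
    IsJointlyContDiff T 2 fun t => curl3 (u t) := by
  refine contDiffOn_euclidean.2 fun i => ?_
  simp only [curl3_apply_eq_vorticityTensor]
  exact ((h.isJointlyContDiff.partialDeriv hT (by norm_num) (i + 1)).apply (i + 2)).sub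
    ((h.isJointlyContDiff.partialDeriv hT (by norm_num) (i + 2)).apply (i + 1))

lemma curl3_equation (h : IsNSESolution L T σ f φ u p) (ht : t ∈ Ioo 0 T) (x : E 3) (i : Fin 3) :
    timeDeriv T (fun t x => curl3 (u t) x i) t x + σ ^ 2 / 2 * (Δ fun x => curl3 (u t) x i) x
      - advect (u t) (fun x => curl3 (u t) x i) x + advect (curl3 (u t)) (u t) x i
      + curl3 (f t) x i = 0 := by
  simpa only [advect_partialDeriv_sub_eq_div_mul_curl3_sub,
    h.div_free t (Ioo_subset_Icc_self ht) x, zero_mul, zero_sub,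
    ← curl3_apply_eq_vorticityTensor, sub_neg_eq_add]
    using h.vorticityTensor_equation ht x (i + 1) (i + 2)

end DimensionThree

end IsNSESolution

lemma IsPeriodic.curl2 {v : E 2 → E 2} (hv : IsPeriodic L v) : IsPeriodic L (curl2 v) :=
  (hv.partialDeriv 0).comp₂ (hv.partialDeriv 1) fun a b => a 1 - b 0

lemma IsPeriodic.curl3 {v : E 3 → E 3} (hv : IsPeriodic L v) : IsPeriodic L (curl3 v) := by
  intro x i
  ext j
  simp only [curl3_apply_eq_vorticityTensor]
  exact isPeriodic_vorticityTensor hv (j + 1) (j + 2) x i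

/-! ### The Sobolev inequality on the period cell -/

lemma sq_integral_mul_le {f g : E n → ℝ} (hf : Continuous f) (hg : Continuous g) :
    (∫ x in cell n L, f x * g x) ^ 2
      ≤ (∫ x in cell n L, f x ^ 2) * ∫ x in cell n L, g x ^ 2 := by
  have quadratic_nonneg (s : ℝ) : 0 ≤ (∫ x in cell n L, f x ^ 2) * (s * s)
      + (2 * ∫ x in cell n L, f x * g x) * s + ∫ x in cell n L, g x ^ 2 := by
    have square_nonneg : 0 ≤ ∫ x in cell n L, (s * f x + g x) ^ 2 :=
      integral_nonneg fun _ => sq_nonneg _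
    have expand (x : E n) :
        (s * f x + g x) ^ 2 = s * s * f x ^ 2 + 2 * s * (f x * g x) + g x ^ 2 := by ring
    simp_rw [expand] at square_nonneg
    rw [integral_add (integrableOn_cell (by fun_prop)) (integrableOn_cell (by fun_prop)),
      integral_add (integrableOn_cell (by fun_prop)) (integrableOn_cell (by fun_prop)),
      integral_const_mul, integral_const_mul] at square_nonneg
    linarith
  have := discrim_le_zero quadratic_nonneg
  rw [discrim] at this
  linarith

lemma exists_closedBall_subset_iUnion_cell (hL : 0 < L) (n : ℕ) (R : ℝ) :
    ∃ S : Finset (Fin n → ℤ), Metric.closedBall (0 : E n) R ⊆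
      ⋃ m : S, (fun x => x + WithLp.toLp 2 fun i => (m : Fin n → ℤ) i * L) ⁻¹' cell n L := by
  refine ⟨Fintype.piFinset fun _ => Finset.Icc (-⌈(R + L) / L⌉) ⌈(R + L) / L⌉, fun x hx => ?_⟩
  set m : Fin n → ℤ := fun i => -toIocDiv hL 0 (x i)
  have translate_mem (i : Fin n) : x i + m i * L ∈ Ioc 0 L := by
    simpa [m, sub_eq_add_neg] using sub_toIocDiv_zsmul_mem_Ioc hL 0 (x i)
  have abs_le_radius (i : Fin n) : |x i| ≤ R :=
    (PiLp.norm_apply_le x i).trans (mem_closedBall_zero_iff.1 hx)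
  refine mem_iUnion.2 ⟨⟨m, Fintype.mem_piFinset.2 fun i => ?_⟩, translate_mem⟩
  rw [Finset.mem_Icc, ← abs_le, ← Int.cast_le (R := ℝ), Int.cast_abs]
  refine le_trans ?_ (Int.le_ceil _)
  have := abs_le.1 (abs_le_radius i)
  have := translate_mem i
  rw [le_div_iff₀ hL, ← abs_of_pos hL, ← abs_mul, abs_of_pos hL, abs_le]
  constructor <;> linarith [this.1, this.2]

lemma exists_setIntegral_closedBall_le (hL : 0 < L) (n : ℕ) (R : ℝ) :
    ∃ M : ℝ, 0 ≤ M ∧ ∀ q : E n → ℝ, IsPeriodic L q → Continuous q → (∀ x, 0 ≤ q x) →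
      ∫ x in Metric.closedBall 0 R, q x ≤ M * ∫ x in cell n L, q x := by
  obtain ⟨S, ball_subset⟩ := exists_closedBall_subset_iUnion_cell hL n R
  refine ⟨S.card, by positivity, fun q hq hc q_nonneg => ?_⟩
  have ae_nonneg (s : Set (E n)) : 0 ≤ᵐ[volume.restrict s] q :=
    Filter.Eventually.of_forall q_nonneg
  have integrable_ball : IntegrableOn q (Metric.closedBall 0 R) :=
    hc.continuousOn.integrableOn_compact (isCompact_closedBall _ _)
  let translation (m : Fin n → ℤ) : E n := WithLp.toLp 2 fun i => m i * L
  have lintegral_translate (m : Fin n → ℤ) :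
      ∫⁻ x in (fun x => x + translation m) ⁻¹' cell n L, ENNReal.ofReal (q x)
        = ∫⁻ x in cell n L, ENNReal.ofReal (q x) := by
    rw [← (measurePreserving_add_right volume (translation m)).setLIntegral_comp_preimage
      measurableSet_cell (f := fun x => ENNReal.ofReal (q x)) (by fun_prop)]
    refine lintegral_congr fun x => ?_
    rw [hq.eq_of_int (x := x) (y := x + translation m) fun i => ⟨m i, by simp [translation]⟩]
  rw [← ENNReal.ofReal_le_ofReal_iff
    (mul_nonneg (by positivity) (integral_nonneg q_nonneg)), ENNReal.ofReal_mul (by positivity),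
    ofReal_integral_eq_lintegral_ofReal integrable_ball (ae_nonneg _),
    ofReal_integral_eq_lintegral_ofReal (integrableOn_cell hc) (ae_nonneg _)]
  calc ∫⁻ x in Metric.closedBall 0 R, ENNReal.ofReal (q x)
      ≤ ∫⁻ x in ⋃ m : S, (fun x => x + translation m) ⁻¹' cell n L, ENNReal.ofReal (q x) :=
        lintegral_mono_set ball_subset
    _ ≤ ∑' m : S, ∫⁻ x in (fun x => x + translation m) ⁻¹' cell n L, ENNReal.ofReal (q x) :=
        lintegral_iUnion_le _ _
    _ = ENNReal.ofReal S.card * ∫⁻ x in cell n L, ENNReal.ofReal (q x) := by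
        simp [lintegral_translate, tsum_fintype]

lemma norm_fderiv_sq_le (z : E n → ℝ) (x : E n) :
    ‖fderiv ℝ z x‖ ^ 2 ≤ n * ∑ j, partialDeriv j z x ^ 2 := by
  have norm_le : ‖fderiv ℝ z x‖ ≤ ∑ j, |partialDeriv j z x| := by
    refine ContinuousLinearMap.opNorm_le_bound _ (Finset.sum_nonneg fun _ _ => abs_nonneg _)
      fun v => ?_
    have basis_expansion : v = ∑ j, v j • EuclideanSpace.single j (1 : ℝ) := by
      ext i; simp [Finset.sum_apply, Pi.single_apply]
    conv_lhs => rw [basis_expansion]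
    rw [map_sum, Finset.sum_mul]
    refine (norm_sum_le _ _).trans (Finset.sum_le_sum fun j _ => ?_)
    rw [map_smul, norm_smul, mul_comm]
    exact mul_le_mul_of_nonneg_left (PiLp.norm_apply_le v j) (norm_nonneg _)
  calc ‖fderiv ℝ z x‖ ^ 2 ≤ (∑ j, |partialDeriv j z x|) ^ 2 := by gcongr
    _ ≤ n * ∑ j, |partialDeriv j z x| ^ 2 := by
      simpa using sq_sum_le_card_mul_sum_sq (s := Finset.univ) (f := fun j => |partialDeriv j z x|)
    _ = n * ∑ j, partialDeriv j z x ^ 2 := by simp_rw [sq_abs]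

lemma exists_integral_norm_pow_six_le : ∃ K : ℝ, ∀ g : E 3 → ℝ, ContDiff ℝ 1 g →
    HasCompactSupport g → ∫ x, ‖g x‖ ^ 6 ≤ K ^ 6 * (∫ x, ‖fderiv ℝ g x‖ ^ 2) ^ 3 := by
  set K : ℝ := NNReal.toReal (SNormLESNormFDerivOfEqConst ℝ (volume : Measure (E 3)) 2) with hK
  refine ⟨K, fun g hc hg => ?_⟩
  have memLp_six : MemLp g 6 volume := hc.continuous.memLp_of_hasCompactSupport hg
  have memLp_fderiv : MemLp (fderiv ℝ g) 2 volume :=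
    (hc.continuous_fderiv one_ne_zero).memLp_of_hasCompactSupport (hg.fderiv ℝ)
  have eLpNorm_le : eLpNorm g 6 volume ≤ ENNReal.ofReal K * eLpNorm (fderiv ℝ g) 2 volume := by
    rw [hK, ENNReal.ofReal_coe_nnreal]
    exact_mod_cast eLpNorm_le_eLpNorm_fderiv_of_eq (volume : Measure (E 3)) hc hg
      (p := 2) (p' := 6) (by norm_num) (by simp) (by simp; norm_num)
  rw [memLp_six.eLpNorm_eq_integral_rpow_norm (by norm_num) (by norm_num),
    memLp_fderiv.eLpNorm_eq_integral_rpow_norm (by norm_num) (by norm_num),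
    ← ENNReal.ofReal_mul (by positivity), ENNReal.ofReal_le_ofReal_iff (by positivity)]
    at eLpNorm_le
  norm_num at eLpNorm_le
  have six_nonneg : 0 ≤ ∫ x, |g x| ^ 6 := integral_nonneg fun _ => by positivity
  have fderiv_nonneg : 0 ≤ ∫ x, ‖fderiv ℝ g x‖ ^ 2 := integral_nonneg fun _ => by positivity
  have sixth_power := pow_le_pow_left₀ (by positivity) eLpNorm_le 6
  rw [mul_pow, ← Real.rpow_natCast (_ ^ (_ : ℝ)) 6, ← Real.rpow_natCast (_ ^ (_ : ℝ)) 6,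
    ← Real.rpow_mul six_nonneg, ← Real.rpow_mul fderiv_nonneg] at sixth_power
  norm_num at sixth_power
  simpa using sixth_power

lemma norm_fderiv_mul_sq_le {χ z : E 3 → ℝ} {x : E 3} (hχ : DifferentiableAt ℝ χ x)
    (hz : DifferentiableAt ℝ z x) {A : ℝ} (hA : ‖fderiv ℝ χ x‖ ≤ A) (hχ₁ : ‖χ x‖ ≤ 1) :
    ‖fderiv ℝ (fun y => χ y * z y) x‖ ^ 2
      ≤ (2 * A ^ 2 + 6) * (z x ^ 2 + ∑ j, partialDeriv j z x ^ 2) := by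
  have norm_le : ‖fderiv ℝ (fun y => χ y * z y) x‖ ≤ ‖fderiv ℝ z x‖ + A * |z x| := by
    rw [fderiv_fun_mul hχ hz]
    refine (norm_add_le _ _).trans (add_le_add ?_ ?_)
    · rw [norm_smul]
      exact mul_le_of_le_one_left (norm_nonneg _) hχ₁
    · rw [norm_smul, mul_comm, Real.norm_eq_abs]
      exact mul_le_mul_of_nonneg_right hA (abs_nonneg _)
  have fderiv_le := norm_fderiv_sq_le z x
  push_cast at fderiv_le
  have gradient_nonneg : 0 ≤ ∑ j, partialDeriv j z x ^ 2 := Finset.sum_nonneg fun _ _ => sq_nonneg _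
  calc ‖fderiv ℝ (fun y => χ y * z y) x‖ ^ 2
      ≤ (‖fderiv ℝ z x‖ + A * |z x|) ^ 2 := pow_le_pow_left₀ (norm_nonneg _) norm_le 2
    _ ≤ 2 * (‖fderiv ℝ z x‖ ^ 2 + (A * |z x|) ^ 2) := add_sq_le
    _ = 2 * ‖fderiv ℝ z x‖ ^ 2 + 2 * A ^ 2 * z x ^ 2 := by rw [mul_pow, sq_abs]; ring
    _ ≤ (2 * A ^ 2 + 6) * (z x ^ 2 + ∑ j, partialDeriv j z x ^ 2) := by
      nlinarith [mul_nonneg (sq_nonneg A) gradient_nonneg, sq_nonneg (z x)]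

lemma integral_norm_fderiv_bump_mul_sq_le {R M A : ℝ}
    (hM : ∀ q : E 3 → ℝ, IsPeriodic L q → Continuous q → (∀ x, 0 ≤ q x) →
      ∫ x in Metric.closedBall 0 R, q x ≤ M * ∫ x in cell 3 L, q x)
    {χ : ContDiffBump (0 : E 3)} (hR : χ.rOut = R)
    (hA : ∀ x ∈ Metric.closedBall (0 : E 3) R, ‖fderiv ℝ χ x‖ ≤ A)
    {z : E 3 → ℝ} (hz : IsPeriodic L z) (hc : ContDiff ℝ 1 z) :
    ∫ x, ‖fderiv ℝ (fun y => χ y * z y) x‖ ^ 2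
      ≤ (2 * A ^ 2 + 6) * M * ((∫ x in cell 3 L, z x ^ 2) + dissipation L z) := by
  have hχ : ContDiff ℝ 1 χ := χ.contDiff
  have continuous_deriv (j : Fin 3) : Continuous (partialDeriv j z) := continuous_partialDeriv hc j
  have continuous_z := hc.continuous
  set q : E 3 → ℝ := fun x => z x ^ 2 + ∑ j, partialDeriv j z x ^ 2 with hq
  have continuous_q : Continuous q := by fun_prop
  have periodic_q : IsPeriodic L q :=
    (hz.comp (· ^ 2)).comp₂ (isPeriodic_sum fun j _ => (hz.partialDeriv j).comp (· ^ 2)) (· + ·)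
  have integral_q : ∫ x in cell 3 L, q x = (∫ x in cell 3 L, z x ^ 2) + dissipation L z := by
    rw [hq, integral_add (integrableOn_cell (by fun_prop)) (integrableOn_cell (by fun_prop)),
      integral_finsetSum _ fun j _ => integrableOn_cell (by fun_prop), dissipation]
  have continuous_product :=
    ((hχ.mul hc).continuous_fderiv one_ne_zero).norm.pow 2
  have support_subset : Function.support (fun x => ‖fderiv ℝ (fun y => χ y * z y) x‖ ^ 2)
      ⊆ Metric.closedBall 0 R := by
    intro x hx
    have x_mem : x ∈ Function.support (fderiv ℝ fun y => χ y * z y) := fun h => hx (by simp [h])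
    exact hR ▸ (closure_minimal ((Function.support_mul_subset_left _ _).trans
      (subset_tsupport _)) (isClosed_tsupport _)).trans χ.tsupport_eq.subset
        (support_fderiv_subset ℝ x_mem)
  calc ∫ x, ‖fderiv ℝ (fun y => χ y * z y) x‖ ^ 2
      = ∫ x in Metric.closedBall 0 R, ‖fderiv ℝ (fun y => χ y * z y) x‖ ^ 2 :=
        (setIntegral_eq_integral_of_forall_compl_eq_zero fun x hx =>
          Function.notMem_support.1 fun h => hx (support_subset h)).symm
    _ ≤ ∫ x in Metric.closedBall 0 R, (2 * A ^ 2 + 6) * q x :=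
        setIntegral_mono_on
          (continuous_product.continuousOn.integrableOn_compact (isCompact_closedBall _ _))
          ((continuous_const.mul continuous_q).continuousOn.integrableOn_compact
            (isCompact_closedBall _ _))
          measurableSet_closedBall fun x hx =>
            norm_fderiv_mul_sq_le (hχ.differentiable one_ne_zero x)
              (hc.differentiable one_ne_zero x) (hA x hx)
              ((Real.norm_of_nonneg χ.nonneg).trans_le χ.le_one)
    _ ≤ (2 * A ^ 2 + 6) * (M * ∫ x in cell 3 L, q x) := by
        rw [integral_const_mul]
        gcongr
        exact hM q periodic_q continuous_q fun x => by positivity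
    _ = (2 * A ^ 2 + 6) * M * ((∫ x in cell 3 L, z x ^ 2) + dissipation L z) := by
        rw [integral_q]; ring

-- Localize with a cutoff that is one on a ball containing the period cell; both sides of the
-- Gagliardo–Nirenberg–Sobolev inequality of `ℝ³` are then comparable with integrals over the cell.
lemma exists_integral_cell_pow_six_le (hL : 0 < L) :
    ∃ C : ℝ, 0 ≤ C ∧ ∀ z : E 3 → ℝ, IsPeriodic L z → ContDiff ℝ 1 z →
      ∫ x in cell 3 L, z x ^ 6 ≤ C * ((∫ x in cell 3 L, z x ^ 2) + dissipation L z) ^ 3 := by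
  set R : ℝ := Real.sqrt ((3 : ℕ) * L ^ 2) + 1 with hR
  let χ : ContDiffBump (0 : E 3) := ⟨R, R + 1, by positivity, by linarith⟩
  have hχ : ContDiff ℝ 1 χ := χ.contDiff
  obtain ⟨M, hM₀, hM⟩ := exists_setIntegral_closedBall_le hL 3 (R + 1)
  obtain ⟨A, hA⟩ := (isCompact_closedBall (0 : E 3) (R + 1)).exists_bound_of_continuousOn
    (hχ.continuous_fderiv one_ne_zero).continuousOn
  obtain ⟨K, hK⟩ := exists_integral_norm_pow_six_le
  refine ⟨K ^ 6 * ((2 * A ^ 2 + 6) * M) ^ 3, by positivity, fun z hz hc => ?_⟩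
  have cutoff_eq_one {x : E 3} (hx : x ∈ cell 3 L) : χ x = 1 := χ.one_of_mem_closedBall
    (Metric.closedBall_subset_closedBall (by simp [χ, hR]) (cell_subset_closedBall hx))
  have hasCompactSupport : HasCompactSupport fun x => χ x * z x :=
    χ.hasCompactSupport.mul_right
  have integrable_pow_six : Integrable fun x => ‖χ x * z x‖ ^ 6 :=
    ((hχ.mul hc).continuous.norm.pow 6).integrable_of_hasCompactSupport <|
      hasCompactSupport.mono fun x hx h => hx (by simpa using h)
  calc ∫ x in cell 3 L, z x ^ 6 = ∫ x in cell 3 L, ‖χ x * z x‖ ^ 6 :=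
        setIntegral_congr_fun measurableSet_cell fun x hx => by
          simp only [cutoff_eq_one hx, one_mul, Real.norm_eq_abs, Even.pow_abs ⟨3, rfl⟩]
    _ ≤ ∫ x, ‖χ x * z x‖ ^ 6 :=
        setIntegral_le_integral integrable_pow_six
          (Filter.Eventually.of_forall fun x => by positivity)
    _ ≤ K ^ 6 * (∫ x, ‖fderiv ℝ (fun y => χ y * z y) x‖ ^ 2) ^ 3 :=
        hK _ (hχ.mul hc) hasCompactSupport
    _ ≤ K ^ 6 * ((2 * A ^ 2 + 6) * M * ((∫ x in cell 3 L, z x ^ 2) + dissipation L z)) ^ 3 := by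
        gcongr
        exact integral_norm_fderiv_bump_mul_sq_le hM rfl hA hz hc
    _ = K ^ 6 * ((2 * A ^ 2 + 6) * M) ^ 3
          * ((∫ x in cell 3 L, z x ^ 2) + dissipation L z) ^ 3 := by rw [mul_pow]; ring

lemma le_add_div_of_pow_four_le {ε a s I : ℝ} (hε : 0 < ε) (ha : 0 ≤ a) (hs : 0 ≤ s)
    (h : I ^ 4 ≤ a * s ^ 3) : I ≤ ε * s + a / ε ^ 3 := by
  rcases le_or_gt I (ε * s) with hle | hlt
  · exact hle.trans (le_add_of_nonneg_right (by positivity))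
  have I_pos : 0 < I := lt_of_le_of_lt (by positivity) hlt
  have I_le : I ≤ a / ε ^ 3 := by
    rw [le_div_iff₀ (by positivity)]
    refine le_of_mul_le_mul_right ?_ (pow_pos I_pos 3)
    calc I * ε ^ 3 * I ^ 3 = I ^ 4 * ε ^ 3 := by ring
      _ ≤ a * s ^ 3 * ε ^ 3 := by gcongr
      _ = a * (ε * s) ^ 3 := by ring
      _ ≤ a * I ^ 3 := by gcongr
  exact I_le.trans (le_add_of_nonneg_left (by positivity))

-- Interpolation: `‖z² e‖₁ ≤ ‖z‖₄² ‖e‖₂ ≤ ‖z‖₂^(1/2) ‖z‖₆^(3/2) ‖e‖₂`, then Young's inequality.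
lemma exists_integral_sq_mul_abs_le (hL : 0 < L) {ε : ℝ} (hε : 0 < ε) :
    ∃ C : ℝ, 0 ≤ C ∧ ∀ z : E 3 → ℝ, IsPeriodic L z → ContDiff ℝ 1 z →
      ∀ e : E 3 → ℝ, Continuous e → ∀ A : ℝ, ∫ x in cell 3 L, e x ^ 2 ≤ A →
        ∫ x in cell 3 L, z x ^ 2 * |e x|
          ≤ ε * dissipation L z + C * (1 + A ^ 2) * ∫ x in cell 3 L, z x ^ 2 := by
  obtain ⟨C, hC₀, hC⟩ := exists_integral_cell_pow_six_le hL
  refine ⟨ε + C / ε ^ 3, by positivity, fun z hz hc e he A hA => ?_⟩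
  have continuous_z := hc.continuous
  set y := ∫ x in cell 3 L, z x ^ 2
  have y_nonneg : 0 ≤ y := integral_nonneg fun _ => sq_nonneg _
  have dissipation_nonneg := dissipation_nonneg (L := L) z
  set I := ∫ x in cell 3 L, z x ^ 2 * |e x|
  have fourth_nonneg : 0 ≤ ∫ x in cell 3 L, z x ^ 4 := integral_nonneg fun _ => by positivity
  have sq_le : I ^ 2 ≤ (∫ x in cell 3 L, z x ^ 4) * A := by
    have cauchy_schwarz := sq_integral_mul_le (L := L) (continuous_z.pow 2) he.abs
    simp only [Pi.pow_apply, ← pow_mul, sq_abs, Nat.reduceMul] at cauchy_schwarz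
    exact cauchy_schwarz.trans (mul_le_mul_of_nonneg_left hA fourth_nonneg)
  have sq_fourth_le :
      (∫ x in cell 3 L, z x ^ 4) ^ 2 ≤ y * (C * (y + dissipation L z) ^ 3) := by
    have cauchy_schwarz := sq_integral_mul_le (L := L) continuous_z (continuous_z.pow 3)
    simp only [Pi.pow_apply, ← pow_mul, ← pow_succ'] at cauchy_schwarz
    exact cauchy_schwarz.trans (mul_le_mul_of_nonneg_left (hC z hz hc) y_nonneg)
  have pow_four_le : I ^ 4 ≤ A ^ 2 * C * y * (y + dissipation L z) ^ 3 := by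
    calc I ^ 4 = (I ^ 2) ^ 2 := by ring
      _ ≤ ((∫ x in cell 3 L, z x ^ 4) * A) ^ 2 := by gcongr
      _ = A ^ 2 * (∫ x in cell 3 L, z x ^ 4) ^ 2 := by ring
      _ ≤ A ^ 2 * (y * (C * (y + dissipation L z) ^ 3)) := by gcongr
      _ = A ^ 2 * C * y * (y + dissipation L z) ^ 3 := by ring
  calc I ≤ ε * (y + dissipation L z) + A ^ 2 * C * y / ε ^ 3 :=
        le_add_div_of_pow_four_le hε (by positivity) (by positivity) pow_four_le
    _ = ε * dissipation L z + (ε + A ^ 2 * (C / ε ^ 3)) * y := by ring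
    _ ≤ ε * dissipation L z + (ε + C / ε ^ 3) * (1 + A ^ 2) * y := by
        have : 0 ≤ C / ε ^ 3 := by positivity
        gcongr
        nlinarith [mul_nonneg hε.le (sq_nonneg A)]

/-! ### Accumulation of errors over the time steps -/

lemma le_exp_mul_of_neg_le_deriv {a b c d : ℝ} (hc : 0 ≤ c) (hd : 0 ≤ d) {y : ℝ → ℝ}
    (hy : ContinuousOn y (Icc a b)) (hy' : ∀ t ∈ Ioo a b, DifferentiableAt ℝ y t)
    (h : ∀ t ∈ Ioo a b, -(c * y t + d) ≤ deriv y t) {t : ℝ} (ht : t ∈ Icc a b) :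
    y t ≤ Real.exp (c * (b - t)) * (y b + d * (b - t)) := by
  have hasDerivAt {t : ℝ} (ht : t ∈ Ioo a b) :
      HasDerivAt (fun t => Real.exp (c * (t - b)) * y t + d * (t - b))
        (Real.exp (c * (t - b)) * (c * 1) * y t + Real.exp (c * (t - b)) * deriv y t + d * 1)
        t := by
    have hasDerivAt_sub : HasDerivAt (fun t => t - b) 1 t := (hasDerivAt_id t).sub_const b
    exact (((hasDerivAt_sub.const_mul c).exp).mul (hy' t ht).hasDerivAt).add
      (hasDerivAt_sub.const_mul d)
  have monotoneOn :
      MonotoneOn (fun t => Real.exp (c * (t - b)) * y t + d * (t - b)) (Icc a b) := by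
    refine monotoneOn_of_deriv_nonneg (convex_Icc a b) (by fun_prop) ?_ ?_ <;> rw [interior_Icc]
    · exact fun t ht => (hasDerivAt ht).differentiableAt.differentiableWithinAt
    · intro t ht
      rw [(hasDerivAt ht).deriv]
      have exp_le_one : Real.exp (c * (t - b)) ≤ 1 :=
        Real.exp_le_one_iff.2 (mul_nonpos_of_nonneg_of_nonpos hc (by linarith [ht.2]))
      nlinarith [mul_le_mul_of_nonneg_left (h t ht) (Real.exp_pos (c * (t - b))).le]
  have le_at_end := monotoneOn ht ⟨ht.1.trans ht.2, le_rfl⟩ ht.2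
  simp only [sub_self, mul_zero, Real.exp_zero, one_mul, add_zero] at le_at_end
  have exp_mul_exp : Real.exp (c * (b - t)) * Real.exp (c * (t - b)) = 1 := by
    rw [← Real.exp_add]; simp [← mul_add]
  calc y t = Real.exp (c * (b - t)) * (Real.exp (c * (t - b)) * y t) := by
        rw [← mul_assoc, exp_mul_exp, one_mul]
    _ ≤ Real.exp (c * (b - t)) * (y b + d * (b - t)) := by
        gcongr
        linarith

/-- `y` behaves like the squared error of a first-order method on the step `[a, b]`, run backwards
from `b`: it grows at a rate depending on its value `y b` at the start of the step, and is driven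
by the square `(b - a)²` of the consistency error. -/
structure IsStepEnergy (C a b : ℝ) (y : ℝ → ℝ) : Prop where
  continuousOn : ContinuousOn y (Icc a b)
  nonneg : ∀ t ∈ Icc a b, 0 ≤ y t
  differentiableAt : ∀ t ∈ Ioo a b, DifferentiableAt ℝ y t
  neg_le_deriv : ∀ t ∈ Ioo a b,
    -(C * (1 + y b ^ 2) * y t + C * ((b - a) ^ 2 + y b)) ≤ deriv y t

lemma IsStepEnergy.le_exp_mul {C a b Y : ℝ} {y : ℝ → ℝ} (hy : IsStepEnergy C a b y)
    (hC : 0 ≤ C) (hab : a ≤ b) (hY : y b ≤ Y) {t : ℝ} (ht : t ∈ Icc a b) :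
    y t ≤ Real.exp (C * (1 + Y ^ 2) * (b - a)) * (Y + C * ((b - a) ^ 2 + Y) * (b - a)) := by
  have end_nonneg : 0 ≤ y b := hy.nonneg b ⟨hab, le_rfl⟩
  have Y_nonneg : 0 ≤ Y := end_nonneg.trans hY
  have step_nonneg : 0 ≤ b - a := sub_nonneg.2 hab
  have sub_nonneg : 0 ≤ b - t := sub_nonneg.2 ht.2
  have sub_le : b - t ≤ b - a := sub_le_sub_left ht.1 b
  refine (le_exp_mul_of_neg_le_deriv (by positivity) (by positivity) hy.continuousOn
    hy.differentiableAt hy.neg_le_deriv ht).trans ?_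
  gcongr

lemma IsStepEnergy.le_exp_mul_of_le_one {C a b Y : ℝ} {y : ℝ → ℝ} (hy : IsStepEnergy C a b y)
    (hC : 0 ≤ C) (hab : a ≤ b) (hY : y b ≤ Y) (hY₁ : Y ≤ 1) {t : ℝ} (ht : t ∈ Icc a b) :
    y t ≤ Real.exp (3 * C * (b - a)) * (Y + C * (b - a) ^ 3) := by
  have Y_nonneg : 0 ≤ Y := (hy.nonneg b ⟨hab, le_rfl⟩).trans hY
  have bound := hy.le_exp_mul hC hab hY ht
  have step_nonneg : 0 ≤ b - a := sub_nonneg.2 hab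
  set h := b - a
  have Ch_nonneg : 0 ≤ C * h := by positivity
  have Ch3_nonneg : 0 ≤ C * h ^ 3 := by positivity
  have rate_le : C * (1 + Y ^ 2) * h ≤ 2 * C * h := by
    nlinarith [pow_le_one₀ (n := 2) Y_nonneg hY₁]
  have source_le : Y + C * (h ^ 2 + Y) * h ≤ Real.exp (C * h) * (Y + C * h ^ 3) := by
    nlinarith [mul_le_mul_of_nonneg_right (Real.add_one_le_exp (C * h))
      (add_nonneg Y_nonneg Ch3_nonneg), mul_nonneg Ch_nonneg Ch3_nonneg]
  calc y t ≤ Real.exp (C * (1 + Y ^ 2) * h) * (Y + C * (h ^ 2 + Y) * h) := bound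
    _ ≤ Real.exp (2 * C * h) * (Real.exp (C * h) * (Y + C * h ^ 3)) := by gcongr
    _ = Real.exp (3 * C * h) * (Y + C * h ^ 3) := by
        rw [← mul_assoc, ← Real.exp_add]; ring_nf

lemma gridTime_succ_sub (T : ℝ) (N k : ℕ) : gridTime T N (k + 1) - gridTime T N k = T / N := by
  simp only [gridTime]
  push_cast
  ring

lemma gridTime_le_succ (hT : 0 ≤ T) (N k : ℕ) : gridTime T N k ≤ gridTime T N (k + 1) :=
  sub_nonneg.1 (by rw [gridTime_succ_sub]; positivity)

/-- The squared errors `y k` on the `N` steps `[t_k, t_{k+1}]` of a first-order method that runs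
backwards from an exact value at `T`. -/
structure IsGridEnergy (C T : ℝ) (N : ℕ) (y : ℕ → ℝ → ℝ) : Prop where
  step : ∀ k < N, IsStepEnergy C (gridTime T N k) (gridTime T N (k + 1)) (y k)
  terminal : ∀ k < N, y k (gridTime T N (k + 1))
    = if k + 1 = N then 0 else y (k + 1) (gridTime T N (k + 1))

section IsGridEnergy

variable {C : ℝ} {N : ℕ} {y : ℕ → ℝ → ℝ}

lemma IsGridEnergy.le_of_step_le (hy : IsGridEnergy C T N y) (hT : 0 ≤ T) {B : ℕ → ℝ}
    (hB₀ : 0 ≤ B 0)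
    (hB : ∀ j k, k + j + 1 = N → y k (gridTime T N (k + 1)) ≤ B j →
      ∀ t ∈ Icc (gridTime T N k) (gridTime T N (k + 1)), y k t ≤ B (j + 1)) :
    ∀ j k, k + j + 1 = N →
      ∀ t ∈ Icc (gridTime T N k) (gridTime T N (k + 1)), y k t ≤ B (j + 1) := by
  intro j
  induction j with
  | zero =>
    intro k hk
    refine hB 0 k hk ?_
    rwa [hy.terminal k (by lia), if_pos (by lia)]
  | succ j ih =>
    intro k hk
    refine hB (j + 1) k hk ?_
    rw [hy.terminal k (by lia), if_neg (by lia)]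
    exact ih (k + 1) (by lia) _ ⟨le_rfl, gridTime_le_succ hT N _⟩

/-- The bound at the end of a step of length at most `T` in terms of the bound `Y` at its start. -/
noncomputable def coarseStep (C T Y : ℝ) : ℝ :=
  Real.exp (C * (1 + Y ^ 2) * T) * (Y + C * (T ^ 2 + Y) * T)

lemma le_coarseStep (hC : 0 ≤ C) (hT : 0 ≤ T) {Y : ℝ} (hY : 0 ≤ Y) : Y ≤ coarseStep C T Y := by
  have one_le_exp : 1 ≤ Real.exp (C * (1 + Y ^ 2) * T) := Real.one_le_exp (by positivity)
  have source_nonneg : 0 ≤ C * (T ^ 2 + Y) * T := by positivity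
  calc Y ≤ 1 * (Y + C * (T ^ 2 + Y) * T) := by linarith
    _ ≤ coarseStep C T Y := by rw [coarseStep]; gcongr

lemma coarseStep_iterate_nonneg (hC : 0 ≤ C) (hT : 0 ≤ T) (j : ℕ) :
    0 ≤ (coarseStep C T)^[j] 0 := by
  induction j with
  | zero => exact le_rfl
  | succ j ih =>
    rw [Function.iterate_succ_apply']
    exact ih.trans (le_coarseStep hC hT ih)

lemma monotone_coarseStep_iterate (hC : 0 ≤ C) (hT : 0 ≤ T) :
    Monotone fun j => (coarseStep C T)^[j] 0 :=
  monotone_nat_of_le_succ fun j => by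
    simp only [Function.iterate_succ_apply']
    exact le_coarseStep hC hT (coarseStep_iterate_nonneg hC hT j)

lemma IsGridEnergy.le_coarseStep_iterate (hy : IsGridEnergy C T N y) (hC : 0 ≤ C) (hT : 0 ≤ T)
    {j k : ℕ} (hk : k + j + 1 = N) {t : ℝ}
    (ht : t ∈ Icc (gridTime T N k) (gridTime T N (k + 1))) :
    y k t ≤ (coarseStep C T)^[j + 1] 0 := by
  refine hy.le_of_step_le hT (B := fun j => (coarseStep C T)^[j] 0) le_rfl ?_ j k hk t ht
  intro j k hk start_le t ht
  have Y_nonneg := coarseStep_iterate_nonneg hC hT j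
  have step_le : T / N ≤ T := div_le_self hT (by norm_cast; lia)
  have bound := (hy.step k (by lia)).le_exp_mul hC (gridTime_le_succ hT N k) start_le ht
  rw [gridTime_succ_sub] at bound
  simp only [Function.iterate_succ_apply', coarseStep] at Y_nonneg bound ⊢
  refine bound.trans ?_
  gcongr

lemma mul_exp_mul_cube_le {h : ℝ} (hC : 0 ≤ C) (hh : 0 ≤ h) {j : ℕ} (hj : j * h ≤ T) :
    j * Real.exp (3 * C * h * j) * (C * h ^ 3) ≤ T * Real.exp (3 * C * T) * C * h ^ 2 := by
  have T_nonneg : 0 ≤ T := (mul_nonneg j.cast_nonneg hh).trans hj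
  have exponent_le : 3 * C * h * j ≤ 3 * C * T := by
    nlinarith [mul_le_mul_of_nonneg_left hj hC]
  calc j * Real.exp (3 * C * h * j) * (C * h ^ 3)
      = j * h * Real.exp (3 * C * h * j) * C * h ^ 2 := by ring
    _ ≤ T * Real.exp (3 * C * T) * C * h ^ 2 := by gcongr

-- As long as the accumulated bound is at most one, the rate of growth is at most `2C`, and this
-- keeps the accumulated bound of order `h²`; for small `h` the induction therefore closes.
lemma IsGridEnergy.le_mul_exp_mul_cube (hy : IsGridEnergy C T N y) (hC : 0 ≤ C) (hT : 0 ≤ T)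
    (small : T * Real.exp (3 * C * T) * C * (T / N) ^ 2 ≤ 1)
    {j k : ℕ} (hk : k + j + 1 = N) {t : ℝ}
    (ht : t ∈ Icc (gridTime T N k) (gridTime T N (k + 1))) :
    y k t ≤ (j + 1 : ℕ) * Real.exp (3 * C * (T / N) * (j + 1 : ℕ)) * (C * (T / N) ^ 3) := by
  set h := T / N with hh
  have h_nonneg : 0 ≤ h := by positivity
  refine hy.le_of_step_le hT (B := fun j => j * Real.exp (3 * C * h * j) * (C * h ^ 3))
    (by simp) ?_ j k hk t ht
  intro j k hk start_le t ht
  have elapsed_le : j * h ≤ T := by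
    rw [hh, mul_div_left_comm]
    exact mul_le_of_le_one_right hT (div_le_one_of_le₀ (by norm_cast; lia) (by positivity))
  have bound := (hy.step k (by lia)).le_exp_mul_of_le_one hC (gridTime_le_succ hT N k) start_le
    ((mul_exp_mul_cube_le hC h_nonneg elapsed_le).trans small) ht
  rw [gridTime_succ_sub] at bound
  have source_le : C * h ^ 3 ≤ Real.exp (3 * C * h * j) * (C * h ^ 3) :=
    le_mul_of_one_le_left (by positivity) (Real.one_le_exp (by positivity))
  calc y k t
      ≤ Real.exp (3 * C * h) * (j * Real.exp (3 * C * h * j) * (C * h ^ 3) + C * h ^ 3) := bound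
    _ ≤ Real.exp (3 * C * h) * (j * Real.exp (3 * C * h * j) * (C * h ^ 3)
          + Real.exp (3 * C * h * j) * (C * h ^ 3)) :=
        mul_le_mul_of_nonneg_left (by linarith) (Real.exp_pos _).le
    _ = (j + 1) * (Real.exp (3 * C * h) * Real.exp (3 * C * h * j)) * (C * h ^ 3) := by ring
    _ = (j + 1 : ℕ) * Real.exp (3 * C * h * (j + 1 : ℕ)) * (C * h ^ 3) := by
        rw [← Real.exp_add]; push_cast; ring_nf

end IsGridEnergy

-- Only finitely many `N` violate the smallness condition of `IsGridEnergy.le_mul_exp_mul_cube`,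
-- and for those a bound that is uniform in the approximation suffices.
theorem exists_sqrt_gridEnergy_le {C : ℝ} (hC : 0 ≤ C) (hT : 0 ≤ T) :
    ∃ K : ℝ, ∀ N y, IsGridEnergy C T N y →
      ∀ k < N, ∀ t ∈ Icc (gridTime T N k) (gridTime T N (k + 1)),
        Real.sqrt (y k t) ≤ K * (T / N) := by
  set K : ℝ := T * Real.exp (3 * C * T) * C
  have K_nonneg : 0 ≤ K := by positivity
  set B := (coarseStep C T)^[⌈T ^ 2 * K⌉₊] 0
  have B_nonneg : 0 ≤ B := coarseStep_iterate_nonneg hC hT _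
  refine ⟨Real.sqrt (K * (1 + B)), fun N y hy k hk t ht => ?_⟩
  have N_pos : (0 : ℝ) < N := by norm_cast; lia
  obtain ⟨j, hj⟩ : ∃ j, k + j + 1 = N := ⟨N - 1 - k, by lia⟩
  rw [Real.sqrt_le_left (by positivity), mul_pow, Real.sq_sqrt (by positivity)]
  rcases le_or_gt (K * (T / N) ^ 2) 1 with small | large
  · have elapsed_le : (j + 1 : ℕ) * (T / N) ≤ T := by
      rw [mul_div_left_comm]
      exact mul_le_of_le_one_right hT (div_le_one_of_le₀ (by norm_cast; lia) N_pos.le)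
    calc y k t ≤ K * (T / N) ^ 2 := (hy.le_mul_exp_mul_cube hC hT small hj ht).trans
          (mul_exp_mul_cube_le hC (by positivity) elapsed_le)
      _ ≤ K * (1 + B) * (T / N) ^ 2 := by
          gcongr
          exact le_mul_of_one_le_right K_nonneg (by linarith)
  · have N_le : N ≤ ⌈T ^ 2 * K⌉₊ := by
      have sq_lt : (N : ℝ) ^ 2 < T ^ 2 * K := by
        rwa [div_pow, mul_div_assoc', one_lt_div (by positivity), mul_comm K] at large
      have N_le_sq : (N : ℝ) ≤ (N : ℝ) ^ 2 := by norm_cast; exact Nat.le_self_pow two_ne_zero N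
      exact_mod_cast (N_le_sq.trans sq_lt.le).trans (Nat.le_ceil _)
    calc y k t ≤ B := (hy.le_coarseStep_iterate hC hT hj ht).trans
          (monotone_coarseStep_iterate hC hT (by lia))
      _ ≤ (1 + B) * 1 := by linarith
      _ ≤ (1 + B) * (K * (T / N) ^ 2) := by gcongr
      _ = K * (1 + B) * (T / N) ^ 2 := by ring

/-! ### Energy estimates -/

lemma continuous_advect {F : Type*} [NormedAddCommGroup F] [NormedSpace ℝ F] {v : E n → E n}
    {w : E n → F} (hv : Continuous v) (hw : ContDiff ℝ 1 w) : Continuous (advect v w) :=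
  continuous_finsetSum _ fun j _ =>
    ((EuclideanSpace.proj (𝕜 := ℝ) j).continuous.comp hv).smul (continuous_partialDeriv hw j)

lemma continuous_laplacian {z : E n → ℝ} (hz : ContDiff ℝ 2 z) : Continuous (Δ z) := by
  rw [funext (laplacian_eq_sum hz)]
  exact continuous_finsetSum _ fun j _ =>
    continuous_partialDeriv (contDiff_partialDeriv hz (by norm_num) j) j

lemma IsEvolution.hasDerivAt_energy_of_equation {a b t : ℝ} {z zt : ℝ → E n → ℝ}
    (hz : IsEvolution L a b z zt) (hL : 0 < L) (ht : t ∈ Ioo a b) {v : E n → E n}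
    (hv : IsPeriodic L v) (hvc : ContDiff ℝ 1 v) (hdiv : ∀ x, div v x = 0) {r : E n → ℝ}
    (hr : Continuous r)
    (heq : ∀ x, zt t x = -(σ ^ 2 / 2 * (Δ (z t)) x) + advect v (z t) x + r x) :
    HasDerivAt (fun t => ∫ x in cell n L, z t x ^ 2)
      (σ ^ 2 * dissipation L (z t) + 2 * ∫ x in cell n L, z t x * r x) t := by
  have contDiff_z := hz.contDiff t ht
  have contDiff_z₁ : ContDiff ℝ 1 (z t) := contDiff_z.of_le one_le_two
  have continuous_z := contDiff_z.continuous
  have periodic_z := hz.periodic t (Ioo_subset_Icc_self ht)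
  have integrable_laplacian : IntegrableOn (fun x => -σ ^ 2 * (z t x * (Δ (z t)) x)) (cell n L) :=
    integrableOn_cell (continuous_const.mul (continuous_z.mul (continuous_laplacian contDiff_z)))
  have integrable_transport : IntegrableOn (fun x => 2 * (z t x * advect v (z t) x)) (cell n L) :=
    integrableOn_cell
      (continuous_const.mul (continuous_z.mul (continuous_advect hvc.continuous contDiff_z₁)))
  have integrable_source : IntegrableOn (fun x => 2 * (z t x * r x)) (cell n L) :=
    integrableOn_cell (continuous_const.mul (continuous_z.mul hr))
  have integrand_eq (x : E n) : 2 * (z t x * zt t x) = -σ ^ 2 * (z t x * (Δ (z t)) x)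
      + 2 * (z t x * advect v (z t) x) + 2 * (z t x * r x) := by
    rw [heq]; ring
  convert! hz.hasDerivAt_energy ht using 1
  simp_rw [integrand_eq]
  rw [integral_add (integrable_laplacian.fun_add integrable_transport) integrable_source,
    integral_add integrable_laplacian integrable_transport]
  simp only [integral_const_mul]
  rw [integral_mul_laplacian hL periodic_z contDiff_z,
    integral_mul_advect_self hL periodic_z contDiff_z₁ hv hvc hdiv]
  ring

lemma neg_add_le_two_mul_integral_mul {z r : E n → ℝ} (hz : Continuous z) (hr : Continuous r) :
    -((∫ x in cell n L, z x ^ 2) + ∫ x in cell n L, r x ^ 2)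
      ≤ 2 * ∫ x in cell n L, z x * r x := by
  rw [← integral_add (integrableOn_cell (by fun_prop)) (integrableOn_cell (by fun_prop)),
    ← integral_neg, ← integral_const_mul]
  refine setIntegral_mono (integrableOn_cell (by fun_prop)) (integrableOn_cell (by fun_prop))
    fun x => ?_
  dsimp only
  linarith [sq_nonneg (z x + r x)]

lemma integral_mul_sq_le {c q : E n → ℝ} (hc : Continuous c) (hq : Continuous q) {M : ℝ}
    (hM : ∀ x ∈ cell n L, |c x| ≤ M) :
    ∫ x in cell n L, (c x * q x) ^ 2 ≤ M ^ 2 * ∫ x in cell n L, q x ^ 2 := by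
  rw [← integral_const_mul]
  refine setIntegral_mono_on (integrableOn_cell (by fun_prop)) (integrableOn_cell (by fun_prop))
    measurableSet_cell fun x hx => ?_
  rw [mul_pow, ← sq_abs (c x)]
  gcongr
  exact hM x hx

lemma integral_sum_mul_sq_le {c q : Fin n → E n → ℝ} (hc : ∀ j, Continuous (c j))
    (hq : ∀ j, Continuous (q j)) {M : ℝ} (hM : ∀ j, ∀ x ∈ cell n L, |c j x| ≤ M) :
    ∫ x in cell n L, (∑ j, c j x * q j x) ^ 2
      ≤ n * M ^ 2 * ∑ j, ∫ x in cell n L, q j x ^ 2 := by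
  calc ∫ x in cell n L, (∑ j, c j x * q j x) ^ 2
      ≤ n * ∑ j, ∫ x in cell n L, (c j x * q j x) ^ 2 := by
        simpa using integral_sum_sq_le Finset.univ fun j => (hc j).mul (hq j)
    _ ≤ n * ∑ j, M ^ 2 * ∫ x in cell n L, q j x ^ 2 := by
        gcongr with j
        exact integral_mul_sq_le (hc j) (hq j) (hM j)
    _ = n * M ^ 2 * ∑ j, ∫ x in cell n L, q j x ^ 2 := by rw [← Finset.mul_sum, mul_assoc]

section Advect

variable {v : E n → E n} {w : E n → ℝ} {M : ℝ}

lemma integral_advect_sq_le_of_abs_le (hv : Continuous v) (hw : ContDiff ℝ 1 w)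
    (hM : ∀ j, ∀ x ∈ cell n L, |v x j| ≤ M) :
    ∫ x in cell n L, advect v w x ^ 2
      ≤ n * M ^ 2 * ∑ j, ∫ x in cell n L, partialDeriv j w x ^ 2 :=
  integral_sum_mul_sq_le (fun j => (EuclideanSpace.proj (𝕜 := ℝ) j).continuous.comp hv)
    (continuous_partialDeriv hw) hM

lemma integral_advect_sq_le_of_abs_partialDeriv_le (hv : Continuous v) (hw : ContDiff ℝ 1 w)
    (hM : ∀ j, ∀ x ∈ cell n L, |partialDeriv j w x| ≤ M) :
    ∫ x in cell n L, advect v w x ^ 2 ≤ n * M ^ 2 * ∑ j, ∫ x in cell n L, v x j ^ 2 := by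
  simp only [advect, smul_eq_mul, mul_comm (v _ _)]
  exact integral_sum_mul_sq_le (continuous_partialDeriv hw)
    (fun j => (EuclideanSpace.proj (𝕜 := ℝ) j).continuous.comp hv) hM

end Advect

lemma integral_sq_le_of_abs_le (hL : 0 < L) {q : E n → ℝ} (hq : Continuous q) {A : ℝ}
    (hA : ∀ x ∈ cell n L, |q x| ≤ A) : ∫ x in cell n L, q x ^ 2 ≤ A ^ 2 * L ^ n := by
  simpa [measureReal_cell hL] using integral_mul_sq_le hq continuous_const (q := 1) hA

section Stretching

variable {z : E 3 → E 3} {ν : E 3 → E 3}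

lemma neg_sum_le_two_mul_integral_mul_advect (hz : Continuous z) {w : E 3 → ℝ}
    (hw : ContDiff ℝ 1 w) (i : Fin 3) :
    -∑ j, ((∫ x in cell 3 L, z x i ^ 2 * |partialDeriv j w x|)
        + ∫ x in cell 3 L, z x j ^ 2 * |partialDeriv j w x|)
      ≤ 2 * ∫ x in cell 3 L, z x i * advect z w x := by
  have continuous_z (j : Fin 3) : Continuous fun x => z x j :=
    (EuclideanSpace.proj (𝕜 := ℝ) j).continuous.comp hz
  have integrable_sq_mul (k j : Fin 3) :
      IntegrableOn (fun x => z x k ^ 2 * |partialDeriv j w x|) (cell 3 L) :=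
    integrableOn_cell (((continuous_z k).pow 2).mul (continuous_partialDeriv hw j).abs)
  have pointwise (a b e : ℝ) : -(a ^ 2 * |e| + b ^ 2 * |e|) ≤ 2 * (a * (b * e)) := by
    rcases abs_cases e with ⟨he, _⟩ | ⟨he, _⟩ <;> rw [he] <;>
      nlinarith [mul_nonneg (sq_nonneg (a + b)) (abs_nonneg e),
        mul_nonneg (sq_nonneg (a - b)) (abs_nonneg e)]
  simp_rw [← integral_add (integrable_sq_mul _ _) (integrable_sq_mul _ _)]
  rw [← integral_finsetSum _ fun j _ => (integrable_sq_mul i j).fun_add (integrable_sq_mul j j),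
    ← integral_neg, ← integral_const_mul]
  refine setIntegral_mono ?_ ?_ fun x => ?_
  · exact (integrable_finsetSum _ fun j _ =>
      (integrable_sq_mul i j).fun_add (integrable_sq_mul j j)).neg
  · exact integrableOn_cell
      (continuous_const.mul ((continuous_z i).mul (continuous_advect hz hw)))
  · simp only [advect, smul_eq_mul, Finset.mul_sum, ← Finset.sum_neg_distrib]
    exact Finset.sum_le_sum fun j _ => pointwise _ _ _

-- The stretching of the vorticity error by the velocity error is cubic in the error; only part
-- of it can be absorbed into the dissipation, whence the rate `1 + A²` on the left.
lemma exists_le_sum_integral_mul_stretching (hL : 0 < L) {ε : ℝ} (hε : 0 < ε) :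
    ∃ C : ℝ, 0 ≤ C ∧ ∀ z : E 3 → E 3, IsPeriodic L z → ContDiff ℝ 1 z →
      ∀ ν : E 3 → E 3, ContDiff ℝ 1 ν →
      ∀ A : ℝ, (∀ i j, ∫ x in cell 3 L, partialDeriv j ν x i ^ 2 ≤ A) →
        -(ε * ∑ i, dissipation L (fun x => z x i)
            + C * (1 + A ^ 2) * ∑ i, ∫ x in cell 3 L, z x i ^ 2)
          ≤ ∑ i, 2 * ∫ x in cell 3 L, z x i * advect z (fun x => ν x i) x := by
  obtain ⟨C, hC₀, hC⟩ := exists_integral_sq_mul_abs_le hL (ε := ε / 6) (by positivity)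
  refine ⟨6 * C, by positivity, fun z hz hzc ν hν A hA => ?_⟩
  have contDiff_ν (i : Fin 3) : ContDiff ℝ 1 fun x => ν x i := contDiff_euclidean.1 hν i
  set b : Fin 3 → ℝ := fun k => ε / 6 * dissipation L (fun x => z x k)
    + C * (1 + A ^ 2) * ∫ x in cell 3 L, z x k ^ 2 with hb
  have integral_le (i j k : Fin 3) :
      ∫ x in cell 3 L, z x k ^ 2 * |partialDeriv j (fun x => ν x i) x| ≤ b k := by
    refine hC _ (hz.comp fun y => y k) (contDiff_euclidean.1 hzc k) _
      (continuous_partialDeriv (contDiff_ν i) j) A ?_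
    simp_rw [← partialDeriv_apply (hν.differentiable one_ne_zero _)]
    exact hA i j
  calc -(ε * ∑ i, dissipation L (fun x => z x i)
        + 6 * C * (1 + A ^ 2) * ∑ i, ∫ x in cell 3 L, z x i ^ 2)
      = ∑ i, -∑ j, (b i + b j) := by
        simp only [Fin.sum_univ_three, hb]
        ring
    _ ≤ ∑ i, 2 * ∫ x in cell 3 L, z x i * advect z (fun x => ν x i) x := by
        refine Finset.sum_le_sum fun i _ => le_trans (neg_le_neg ?_)
          (neg_sum_le_two_mul_integral_mul_advect hzc.continuous (contDiff_ν i) i)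
        exact Finset.sum_le_sum fun j _ => add_le_add (integral_le i j i) (integral_le i j j)

end Stretching

namespace IsClassicalOn

variable {a b : ℝ}

lemma isEvolution {w : ℝ → E n → ℝ} (hw : IsClassicalOn a b w)
    (hp : ∀ t ∈ Icc a b, IsPeriodic L (w t)) :
    IsEvolution L a b w fun t x => derivWithin (fun s => w s x) (Icc a b) t where
  continuousOn := hw.continuous
  hasDerivAt t ht x := (hw.time_diff t (Ioo_subset_Ico_self ht) x).hasDerivWithinAt.hasDerivAt
    (Icc_mem_nhds ht.1 ht.2)
  continuousOn_deriv := hw.time_cont.mono (prod_mono_left Ioo_subset_Ico_self)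
  contDiff t ht := hw.space_diff t (Ioo_subset_Ico_self ht)
  periodic := hp

lemma isEvolution_apply {m : ℕ} {w : ℝ → E n → E m} (hw : IsClassicalOn a b w)
    (hp : ∀ t ∈ Icc a b, IsPeriodic L (w t)) (i : Fin m) :
    IsEvolution L a b (fun t x => w t x i)
      fun t x => derivWithin (fun s => w s x) (Icc a b) t i where
  continuousOn := (EuclideanSpace.proj (𝕜 := ℝ) i).continuous.comp_continuousOn hw.continuous
  hasDerivAt t ht x := (EuclideanSpace.proj (𝕜 := ℝ) i).hasFDerivAt.comp_hasDerivAt t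
    ((hw.time_diff t (Ioo_subset_Ico_self ht) x).hasDerivWithinAt.hasDerivAt
      (Icc_mem_nhds ht.1 ht.2))
  continuousOn_deriv := (EuclideanSpace.proj (𝕜 := ℝ) i).continuous.comp_continuousOn
    (hw.time_cont.mono (prod_mono_left Ioo_subset_Ico_self))
  contDiff t ht := contDiff_euclidean.1 (hw.space_diff t (Ioo_subset_Ico_self ht)) i
  periodic t ht := (hp t ht).comp fun y => y i

end IsClassicalOn

/-! ### Consistency of the frozen velocity -/

lemma integral_add_sq_le {f g : E n → ℝ} (hf : Continuous f) (hg : Continuous g) :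
    ∫ x in cell n L, (f x + g x) ^ 2
      ≤ 2 * ((∫ x in cell n L, f x ^ 2) + ∫ x in cell n L, g x ^ 2) := by
  rw [← integral_add (integrableOn_cell (by fun_prop)) (integrableOn_cell (by fun_prop)),
    ← integral_const_mul]
  exact setIntegral_mono (integrableOn_cell (by fun_prop)) (integrableOn_cell (by fun_prop))
    fun x => add_sq_le

namespace IsVelocityError

variable {Y Z : ℝ} {V W : E n → E n}

lemma mono (hV : IsVelocityError L Y V) (hY : Y ≤ Z) : IsVelocityError L Z V where
  contDiff := hV.contDiff
  periodic := hV.periodic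
  div_free := hV.div_free
  sq_le i := (hV.sq_le i).trans (by gcongr)
  deriv_sq_le i j := (hV.deriv_sq_le i j).trans (by gcongr)

lemma add (hV : IsVelocityError L Y V) (hW : IsVelocityError L Z W) :
    IsVelocityError L (2 * (Y + Z)) fun x => V x + W x := by
  have differentiable_V := hV.contDiff.differentiable one_ne_zero
  have differentiable_W := hW.contDiff.differentiable one_ne_zero
  have partialDeriv_eq (j : Fin n) (x : E n) : partialDeriv j (fun x => V x + W x) x
      = partialDeriv j V x + partialDeriv j W x :=
    partialDeriv_add (differentiable_V x) (differentiable_W x) j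
  refine ⟨hV.contDiff.add hW.contDiff, hV.periodic.comp₂ hW.periodic (· + ·), fun x => ?_,
    fun i => ?_, fun i j => ?_⟩
  · simpa only [div, partialDeriv_eq, PiLp.add_apply, Finset.sum_add_distrib, add_zero]
      using congrArg₂ (· + ·) (hV.div_free x) (hW.div_free x)
  · simp only [PiLp.add_apply]
    refine (integral_add_sq_le (contDiff_euclidean.1 hV.contDiff i).continuous
      (contDiff_euclidean.1 hW.contDiff i).continuous).trans ?_
    linarith [hV.sq_le i, hW.sq_le i]
  · simp only [partialDeriv_eq, PiLp.add_apply]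
    refine (integral_add_sq_le
      (contDiff_partialDeriv_apply (k := 0) hV.contDiff (by norm_num) j i).continuous
      (contDiff_partialDeriv_apply (k := 0) hW.contDiff (by norm_num) j i).continuous).trans ?_
    linarith [hV.deriv_sq_le i j, hW.deriv_sq_le i j]

end IsVelocityError

lemma norm_partialDeriv_le {F : Type*} [NormedAddCommGroup F] [NormedSpace ℝ F] (w : E n → F)
    (x : E n) (i : Fin n) : ‖partialDeriv i w x‖ ≤ ‖fderiv ℝ w x‖ := by
  simpa [partialDeriv] using (fderiv ℝ w x).le_opNorm (EuclideanSpace.single i (1 : ℝ))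

lemma abs_partialDeriv_apply_le {k : ℕ} (v : E n → E k) (x : E n) (i : Fin k) (j : Fin n) :
    |partialDeriv j v x i| ≤ ‖fderiv ℝ v x‖ :=
  (PiLp.norm_apply_le (partialDeriv j v x) i).trans (norm_partialDeriv_le v x j)

namespace IsNSESolution

variable {f : ℝ → E n → E n} {φ : E n → E n} {u : ℝ → E n → E n} {p : ℝ → E n → ℝ}

lemma exists_isVelocityError_sub (h : IsNSESolution L T σ f φ u p) (hL : 0 < L) (hT : 0 < T) :
    ∃ c : ℝ, 0 ≤ c ∧ ∀ s ∈ Icc 0 T, ∀ t ∈ Icc 0 T,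
      IsVelocityError L (c * (t - s) ^ 2) fun x => u t x - u s x := by
  have smooth := h.isJointlyContDiff
  obtain ⟨Λ₀, hΛ₀⟩ := (smooth.mono (by norm_num)).exists_lipschitz hT L
  obtain ⟨Λ₁, hΛ₁⟩ := (smooth.fderiv hT (k := 1) (by norm_num)).exists_lipschitz hT L
  refine ⟨(Λ₀ ^ 2 + Λ₁ ^ 2) * L ^ n, by positivity, fun s hs t ht => ?_⟩
  have contDiff_slice {r : ℝ} (hr : r ∈ Icc 0 T) : ContDiff ℝ 1 (u r) :=
    (smooth.slice hr).of_le (by norm_num)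
  have contDiff_sub : ContDiff ℝ 1 fun x => u t x - u s x :=
    (contDiff_slice ht).sub (contDiff_slice hs)
  have differentiable {r : ℝ} (hr : r ∈ Icc 0 T) : Differentiable ℝ (u r) :=
    (contDiff_slice hr).differentiable one_ne_zero
  have sq_lipschitz_le (i : Fin n) {Λ : ℝ} (hΛ : Λ ^ 2 ≤ Λ₀ ^ 2 + Λ₁ ^ 2) :
      (Λ * |t - s|) ^ 2 * L ^ n
        ≤ n * (L ^ 2 + 1) * ((Λ₀ ^ 2 + Λ₁ ^ 2) * L ^ n * (t - s) ^ 2) := by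
    have one_le : 1 ≤ n * (L ^ 2 + 1) :=
      one_le_mul_of_one_le_of_one_le (mod_cast i.pos) (le_add_of_nonneg_left (sq_nonneg L))
    calc (Λ * |t - s|) ^ 2 * L ^ n = Λ ^ 2 * L ^ n * (t - s) ^ 2 := by
          rw [mul_pow, sq_abs]; ring
      _ ≤ (Λ₀ ^ 2 + Λ₁ ^ 2) * L ^ n * (t - s) ^ 2 := by gcongr
      _ ≤ n * (L ^ 2 + 1) * ((Λ₀ ^ 2 + Λ₁ ^ 2) * L ^ n * (t - s) ^ 2) :=
          le_mul_of_one_le_left (by positivity) one_le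
  refine ⟨contDiff_sub, (h.periodic_velocity t ht).comp₂ (h.periodic_velocity s hs) (· - ·),
    fun x => ?_, fun i => ?_, fun i j => ?_⟩
  · simpa only [div, partialDeriv_sub (differentiable ht x) (differentiable hs x), PiLp.sub_apply,
      Finset.sum_sub_distrib, sub_zero]
      using congrArg₂ (· - ·) (h.div_free t ht x) (h.div_free s hs x)
  · exact (integral_sq_le_of_abs_le hL (contDiff_euclidean.1 contDiff_sub i).continuous
      fun x hx => (PiLp.norm_apply_le _ i).trans (hΛ₀ s hs t ht x hx)).trans
      (sq_lipschitz_le i (le_add_of_nonneg_right (sq_nonneg _)))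
  · refine (integral_sq_le_of_abs_le hL
      (contDiff_partialDeriv_apply (k := 0) contDiff_sub (by norm_num) j i).continuous
      fun x hx => (abs_partialDeriv_apply_le _ x i j).trans ?_).trans
      (sq_lipschitz_le i (le_add_of_nonneg_left (sq_nonneg _)))
    rw [fderiv_fun_sub (differentiable ht x) (differentiable hs x)]
    exact hΛ₁ s hs t ht x hx

lemma exists_isVelocityError_sub_sub (h : IsNSESolution L T σ f φ u p) (hL : 0 < L)
    (hT : 0 < T) :
    ∃ c : ℝ, 0 ≤ c ∧ ∀ a b : ℝ, 0 ≤ a → b ≤ T → ∀ t ∈ Icc a b, ∀ (Y : ℝ) (V : E n → E n),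
      0 ≤ Y → IsVelocityError L Y V →
        IsVelocityError L (c * ((b - a) ^ 2 + Y)) fun x => u t x - (u b x - V x) := by
  obtain ⟨c, hc₀, hc⟩ := h.exists_isVelocityError_sub hL hT
  refine ⟨2 * (c + 1), by positivity, fun a b ha hb t ht Y V hY hV => ?_⟩
  have sq_le : (t - b) ^ 2 ≤ (b - a) ^ 2 := by nlinarith [ht.1, ht.2]
  have le : 2 * (c * (t - b) ^ 2 + Y) ≤ 2 * (c + 1) * ((b - a) ^ 2 + Y) := by
    nlinarith [mul_le_mul_of_nonneg_left sq_le hc₀, mul_nonneg hc₀ hY, sq_nonneg (b - a)]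
  have b_mem : b ∈ Icc 0 T := ⟨ha.trans (ht.1.trans ht.2), hb⟩
  simpa only [sub_sub_eq_add_sub, sub_add_eq_add_sub] using
    ((hc b b_mem t (Icc_subset_Icc ha hb ht)).add hV).mono le

end IsNSESolution

section GridTime

lemma gridTime_self (T : ℝ) {N : ℕ} (hN : N ≠ 0) : gridTime T N N = T := by
  rw [gridTime]; field_simp

lemma gridTime_nonneg (hT : 0 ≤ T) (N k : ℕ) : 0 ≤ gridTime T N k := by
  rw [gridTime]; positivity

lemma gridTime_lt_succ (hT : 0 < T) {N : ℕ} (hN : N ≠ 0) (k : ℕ) :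
    gridTime T N k < gridTime T N (k + 1) := by
  rw [← sub_pos, gridTime_succ_sub]; positivity

lemma gridTime_le (hT : 0 ≤ T) {N k : ℕ} (hN : N ≠ 0) (hk : k ≤ N) : gridTime T N k ≤ T := by
  calc gridTime T N k ≤ gridTime T N N := by simp only [gridTime]; gcongr
    _ = T := gridTime_self T hN

lemma contDiff_gridTime_succ {F : Type*} [NormedAddCommGroup F] [NormedSpace ℝ F] (hT : 0 < T)
    {N : ℕ} {w : ℕ → ℝ → E n → F} {w₀ : E n → F} (hw₀ : ContDiff ℝ 2 w₀)
    (hw : ∀ k < N, IsClassicalOn (gridTime T N k) (gridTime T N (k + 1)) (w k))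
    (terminal : ∀ k < N, w k (gridTime T N (k + 1)) =
      if k + 1 = N then w₀ else w (k + 1) (gridTime T N (k + 1))) {k : ℕ} (hk : k < N) :
    ContDiff ℝ 2 (w k (gridTime T N (k + 1))) := by
  rw [terminal k hk]
  split_ifs with last
  · exact hw₀
  · exact (hw (k + 1) (by omega)).space_diff _ ⟨le_rfl, gridTime_lt_succ hT (by omega) _⟩

end GridTime

section FrozenVelocity

/-- The frozen velocity `û_k` on the time step `[t_k, t_{k+1}]` in dimension two. -/
noncomputable def frozenVelocity2 (L T : ℝ) (N : ℕ) (w : ℕ → ℝ → E 2 → ℝ) (k : ℕ) : E 2 → E 2 :=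
  biotSavart2 L (w k (gridTime T N (k + 1)))

/-- The frozen velocity `û_k` on the time step `[t_k, t_{k+1}]` in dimension three. -/
noncomputable def frozenVelocity3 (L T : ℝ) (N : ℕ) (w : ℕ → ℝ → E 3 → E 3) (k : ℕ) : E 3 → E 3 :=
  biotSavart3 L (w k (gridTime T N (k + 1)))

/-- The squared `L²(Q)` norm of the vorticity error in dimension two. -/
noncomputable def sqError2 (L : ℝ) (u : ℝ → E 2 → E 2) (w : ℝ → E 2 → ℝ) (t : ℝ) : ℝ :=
  ∫ x in cell 2 L, (curl2 (u t) x - w t x) ^ 2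

/-- The squared `L²(Q)` norm of the vorticity error in dimension three. -/
noncomputable def sqError3 (L : ℝ) (u : ℝ → E 3 → E 3) (w : ℝ → E 3 → E 3) (t : ℝ) : ℝ :=
  ∑ i, ∫ x in cell 3 L, (curl3 (u t) x i - w t x i) ^ 2

lemma sqError2_nonneg (L : ℝ) (u : ℝ → E 2 → E 2) (w : ℝ → E 2 → ℝ) (t : ℝ) :
    0 ≤ sqError2 L u w t :=
  integral_nonneg fun _ => sq_nonneg _

lemma sqError3_nonneg (L : ℝ) (u : ℝ → E 3 → E 3) (w : ℝ → E 3 → E 3) (t : ℝ) :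
    0 ≤ sqError3 L u w t :=
  Finset.sum_nonneg fun _ _ => integral_nonneg fun _ => sq_nonneg _

lemma IsNSESolution.exists_isVelocityError_frozenVelocity2 {f : ℝ → E 2 → E 2} {φ : E 2 → E 2}
    {u : ℝ → E 2 → E 2} {p : ℝ → E 2 → ℝ} (h : IsNSESolution L T σ f φ u p) (hL : 0 < L)
    (hT : 0 < T) :
    ∃ c : ℝ, 0 ≤ c ∧ ∀ N w, IsFrozenApprox2 L T σ f φ N w → ∀ k < N,
      ∀ t ∈ Icc (gridTime T N k) (gridTime T N (k + 1)),
        IsVelocityError L (c * ((gridTime T N (k + 1) - gridTime T N k) ^ 2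
            + sqError2 L u (w k) (gridTime T N (k + 1))))
          fun x => u t x - frozenVelocity2 L T N w k x := by
  obtain ⟨c, hc₀, hc⟩ := h.exists_isVelocityError_sub_sub hL hT
  refine ⟨c, hc₀, fun N w hw k hk t ht => ?_⟩
  have N_ne_zero : N ≠ 0 := by omega
  have a_nonneg := gridTime_nonneg hT.le N k
  have b_mem : gridTime T N (k + 1) ∈ Icc 0 T :=
    ⟨gridTime_nonneg hT.le N _, gridTime_le hT.le N_ne_zero hk⟩
  have contDiff_terminal : ContDiff ℝ 2 (curl2 φ) :=
    h.terminal ▸ (h.isJointlyContDiff_curl2 hT).slice ⟨hT.le, le_rfl⟩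
  obtain ⟨V, hV, frozen_eq⟩ := exists_isVelocityError2 hL (h.periodic_velocity _ b_mem)
    (h.isJointlyContDiff.slice b_mem) (h.div_free _ b_mem) (h.mean_zero _ b_mem)
    (hw.periodic k hk _ ⟨ht.1.trans ht.2, le_rfl⟩)
    (contDiff_gridTime_succ hT contDiff_terminal hw.classical hw.terminal hk)
  simpa only [frozenVelocity2, frozen_eq] using
    hc _ _ a_nonneg b_mem.2 t ht _ V (sqError2_nonneg L u (w k) _) hV

lemma IsNSESolution.exists_isVelocityError_frozenVelocity3 {f : ℝ → E 3 → E 3} {φ : E 3 → E 3}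
    {u : ℝ → E 3 → E 3} {p : ℝ → E 3 → ℝ} (h : IsNSESolution L T σ f φ u p) (hL : 0 < L)
    (hT : 0 < T) :
    ∃ c : ℝ, 0 ≤ c ∧ ∀ N w, IsFrozenApprox3 L T σ f φ N w → ∀ k < N,
      ∀ t ∈ Icc (gridTime T N k) (gridTime T N (k + 1)),
        IsVelocityError L (c * ((gridTime T N (k + 1) - gridTime T N k) ^ 2
            + sqError3 L u (w k) (gridTime T N (k + 1))))
          fun x => u t x - frozenVelocity3 L T N w k x := by
  obtain ⟨c, hc₀, hc⟩ := h.exists_isVelocityError_sub_sub hL hT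
  refine ⟨c, hc₀, fun N w hw k hk t ht => ?_⟩
  have N_ne_zero : N ≠ 0 := by omega
  have a_nonneg := gridTime_nonneg hT.le N k
  have b_mem : gridTime T N (k + 1) ∈ Icc 0 T :=
    ⟨gridTime_nonneg hT.le N _, gridTime_le hT.le N_ne_zero hk⟩
  have contDiff_terminal : ContDiff ℝ 2 (curl3 φ) :=
    h.terminal ▸ (h.isJointlyContDiff_curl3 hT).slice ⟨hT.le, le_rfl⟩
  obtain ⟨V, hV, frozen_eq⟩ := exists_isVelocityError3 hL (h.periodic_velocity _ b_mem)
    (h.isJointlyContDiff.slice b_mem) (h.div_free _ b_mem) (h.mean_zero _ b_mem)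
    (hw.periodic k hk _ ⟨ht.1.trans ht.2, le_rfl⟩)
    (contDiff_gridTime_succ hT contDiff_terminal hw.classical hw.terminal hk)
  simpa only [frozenVelocity3, frozen_eq] using
    hc _ _ a_nonneg b_mem.2 t ht _ V (sqError3_nonneg L u (w k) _) hV

end FrozenVelocity

/-! ### Energy estimate over one time step -/

lemma advect_sub_left {F : Type*} [NormedAddCommGroup F] [NormedSpace ℝ F] (u v : E n → E n)
    (w : E n → F) (x : E n) :
    advect (fun x => u x - v x) w x = advect u w x - advect v w x := by
  simp only [advect, PiLp.sub_apply, sub_smul, Finset.sum_sub_distrib]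

lemma laplacian_sub {v w : E n → ℝ} (hv : ContDiff ℝ 2 v) (hw : ContDiff ℝ 2 w) (x : E n) :
    (Δ fun x => v x - w x) x = (Δ v) x - (Δ w) x :=
  hv.contDiffAt.laplacian_sub hw.contDiffAt

namespace IsVelocityError

variable {Y M : ℝ} {V : E n → E n}

lemma integral_advect_sq_le (hV : IsVelocityError L Y V) {w : E n → ℝ} (hw : ContDiff ℝ 1 w)
    (hM : ∀ j, ∀ x ∈ cell n L, |partialDeriv j w x| ≤ M) :
    ∫ x in cell n L, advect V w x ^ 2 ≤ n ^ 3 * M ^ 2 * (L ^ 2 + 1) * Y := by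
  calc ∫ x in cell n L, advect V w x ^ 2
      ≤ n * M ^ 2 * ∑ j, ∫ x in cell n L, V x j ^ 2 :=
        integral_advect_sq_le_of_abs_partialDeriv_le hV.contDiff.continuous hw hM
    _ ≤ n * M ^ 2 * ∑ _j : Fin n, n * (L ^ 2 + 1) * Y := by
        gcongr with j
        exact hV.sq_le j
    _ = n ^ 3 * M ^ 2 * (L ^ 2 + 1) * Y := by
        rw [Finset.sum_const, Finset.card_univ, Fintype.card_fin, nsmul_eq_mul]; ring

lemma integral_advect_apply_sq_le (hV : IsVelocityError L Y V) {v : E n → E n}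
    (hv : Continuous v) (hM : ∀ j, ∀ x ∈ cell n L, |v x j| ≤ M) (i : Fin n) :
    ∫ x in cell n L, advect v (fun x => V x i) x ^ 2 ≤ n ^ 3 * M ^ 2 * (L ^ 2 + 1) * Y := by
  have differentiable_V := hV.contDiff.differentiable one_ne_zero
  calc ∫ x in cell n L, advect v (fun x => V x i) x ^ 2
      ≤ n * M ^ 2 * ∑ j, ∫ x in cell n L, partialDeriv j (fun x => V x i) x ^ 2 :=
        integral_advect_sq_le_of_abs_le hv (contDiff_euclidean.1 hV.contDiff i) hM
    _ ≤ n * M ^ 2 * ∑ _j : Fin n, n * (L ^ 2 + 1) * Y := by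
        gcongr with j
        simpa only [partialDeriv_apply (differentiable_V _)] using hV.deriv_sq_le i j
    _ = n ^ 3 * M ^ 2 * (L ^ 2 + 1) * Y := by
        rw [Finset.sum_const, Finset.card_univ, Fintype.card_fin, nsmul_eq_mul]; ring

end IsVelocityError

namespace IsNSESolution

lemma regular_of_isVelocityError_sub {f : ℝ → E n → E n} {φ : E n → E n} {u : ℝ → E n → E n}
    {p : ℝ → E n → ℝ} (h : IsNSESolution L T σ f φ u p) {t : ℝ} (ht : t ∈ Icc 0 T) {Y : ℝ}
    {v : E n → E n} (hv : IsVelocityError L Y fun x => u t x - v x) :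
    ContDiff ℝ 1 v ∧ IsPeriodic L v ∧ ∀ x, div v x = 0 := by
  have contDiff_u : ContDiff ℝ 1 (u t) := (h.isJointlyContDiff.slice ht).of_le (by norm_num)
  obtain ⟨contDiff_sub, periodic_sub, div_sub, -, -⟩ := hv
  have contDiff_v : ContDiff ℝ 1 v := by simpa using contDiff_u.sub contDiff_sub
  refine ⟨contDiff_v, by simpa using (h.periodic_velocity t ht).comp₂ periodic_sub (· - ·),
    fun x => ?_⟩
  have div_eq : div (fun x => u t x - v x) x = div (u t) x - div v x := by
    simp only [div, partialDeriv_sub (contDiff_u.differentiable one_ne_zero x)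
      (contDiff_v.differentiable one_ne_zero x), PiLp.sub_apply, Finset.sum_sub_distrib]
  linarith [div_sub x, h.div_free t ht x]

section DimensionTwo

variable {f : ℝ → E 2 → E 2} {φ : E 2 → E 2} {u : ℝ → E 2 → E 2} {p : ℝ → E 2 → ℝ}
  {N k : ℕ} {w : ℕ → ℝ → E 2 → ℝ} {t : ℝ}

lemma isEvolution_curl2_sub (h : IsNSESolution L T σ f φ u p) (hT : 0 < T)
    (hw : IsFrozenApprox2 L T σ f φ N w) (hk : k < N) :
    IsEvolution L (gridTime T N k) (gridTime T N (k + 1)) (fun t x => curl2 (u t) x - w k t x)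
      fun t x => timeDeriv T (fun t => curl2 (u t)) t x
        - derivWithin (fun s => w k s x) (Icc (gridTime T N k) (gridTime T N (k + 1))) t :=
  ((h.isJointlyContDiff_curl2 hT).isEvolution hT (fun t ht => (h.periodic_velocity t ht).curl2)
    (gridTime_nonneg hT.le N k) (gridTime_le hT.le (by omega) hk)).sub
    ((hw.classical k hk).isEvolution (hw.periodic k hk))

lemma curl2_sub_equation (h : IsNSESolution L T σ f φ u p) (hT : 0 < T)
    (hw : IsFrozenApprox2 L T σ f φ N w) (hk : k < N)
    (ht : t ∈ Ioo (gridTime T N k) (gridTime T N (k + 1))) (x : E 2) :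
    timeDeriv T (fun t => curl2 (u t)) t x
        - derivWithin (fun s => w k s x) (Icc (gridTime T N k) (gridTime T N (k + 1))) t
      = -(σ ^ 2 / 2 * (Δ fun x => curl2 (u t) x - w k t x) x)
        + advect (frozenVelocity2 L T N w k) (fun x => curl2 (u t) x - w k t x) x
        + advect (fun x => u t x - frozenVelocity2 L T N w k x) (curl2 (u t)) x := by
  have t_mem : t ∈ Ioo 0 T :=
    Ioo_subset_Ioo (gridTime_nonneg hT.le N k) (gridTime_le hT.le (by omega) hk) ht
  have contDiff_curl : ContDiff ℝ 2 (curl2 (u t)) :=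
    (h.isJointlyContDiff_curl2 hT).slice (Ioo_subset_Icc_self t_mem)
  have contDiff_w : ContDiff ℝ 2 (w k t) :=
    (hw.classical k hk).space_diff t (Ioo_subset_Ico_self ht)
  rw [advect_sub_left, advect_sub (contDiff_curl.differentiable two_ne_zero x)
    (contDiff_w.differentiable two_ne_zero x), laplacian_sub contDiff_curl contDiff_w]
  have frozen_equation := hw.equation k hk t (Ioo_subset_Ico_self ht) x
  rw [← frozenVelocity2] at frozen_equation
  linear_combination h.curl2_equation t_mem x - frozen_equation

lemma hasDerivAt_sqError2 (h : IsNSESolution L T σ f φ u p) (hL : 0 < L) (hT : 0 < T)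
    (hw : IsFrozenApprox2 L T σ f φ N w) (hk : k < N)
    (ht : t ∈ Ioo (gridTime T N k) (gridTime T N (k + 1))) {Y : ℝ}
    (hV : IsVelocityError L Y fun x => u t x - frozenVelocity2 L T N w k x) :
    HasDerivAt (sqError2 L u (w k)) (σ ^ 2 * dissipation L (fun x => curl2 (u t) x - w k t x)
      + 2 * ∫ x in cell 2 L, (curl2 (u t) x - w k t x)
        * advect (fun x => u t x - frozenVelocity2 L T N w k x) (curl2 (u t)) x) t := by
  have t_mem : t ∈ Icc 0 T := Icc_subset_Icc (gridTime_nonneg hT.le N k)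
    (gridTime_le hT.le (by omega) hk) (Ioo_subset_Icc_self ht)
  obtain ⟨contDiff_frozen, periodic_frozen, div_frozen⟩ := h.regular_of_isVelocityError_sub t_mem hV
  have contDiff_curl : ContDiff ℝ 1 (curl2 (u t)) :=
    ((h.isJointlyContDiff_curl2 hT).slice t_mem).of_le one_le_two
  exact (h.isEvolution_curl2_sub hT hw hk).hasDerivAt_energy_of_equation hL ht periodic_frozen
    contDiff_frozen div_frozen (continuous_advect hV.contDiff.continuous contDiff_curl)
    (h.curl2_sub_equation hT hw hk ht)

lemma neg_le_deriv_sqError2 (h : IsNSESolution L T σ f φ u p) (hL : 0 < L) (hT : 0 < T)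
    (hw : IsFrozenApprox2 L T σ f φ N w) (hk : k < N)
    (ht : t ∈ Ioo (gridTime T N k) (gridTime T N (k + 1))) {Y M : ℝ}
    (hV : IsVelocityError L Y fun x => u t x - frozenVelocity2 L T N w k x)
    (hM : ∀ x ∈ cell 2 L, ‖fderiv ℝ (curl2 (u t)) x‖ ≤ M) :
    -(sqError2 L u (w k) t + 8 * M ^ 2 * (L ^ 2 + 1) * Y) ≤ deriv (sqError2 L u (w k)) t := by
  have t_mem : t ∈ Icc 0 T := Icc_subset_Icc (gridTime_nonneg hT.le N k)
    (gridTime_le hT.le (by omega) hk) (Ioo_subset_Icc_self ht)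
  have contDiff_curl : ContDiff ℝ 1 (curl2 (u t)) :=
    ((h.isJointlyContDiff_curl2 hT).slice t_mem).of_le one_le_two
  have forcing_sq_le := hV.integral_advect_sq_le contDiff_curl fun j x hx =>
    (norm_partialDeriv_le (curl2 (u t)) x j).trans (hM x hx)
  have forcing_ge := neg_add_le_two_mul_integral_mul (L := L)
    ((h.isEvolution_curl2_sub hT hw hk).contDiff t ht).continuous
    (continuous_advect hV.contDiff.continuous contDiff_curl)
  have dissipation_term_nonneg :=
    mul_nonneg (sq_nonneg σ) (dissipation_nonneg (L := L) fun x => curl2 (u t) x - w k t x)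
  rw [(h.hasDerivAt_sqError2 hL hT hw hk ht hV).deriv, sqError2]
  push_cast at forcing_sq_le
  linarith

lemma exists_isStepEnergy_sqError2 (h : IsNSESolution L T σ f φ u p) (hL : 0 < L) (hT : 0 < T) :
    ∃ C : ℝ, 0 ≤ C ∧ ∀ N w, IsFrozenApprox2 L T σ f φ N w → ∀ k < N,
      IsStepEnergy C (gridTime T N k) (gridTime T N (k + 1)) (sqError2 L u (w k)) := by
  obtain ⟨M, hM⟩ := (((h.isJointlyContDiff_curl2 hT).fderiv hT (k := 1)
    (by norm_num)).mono zero_le_one).exists_bound L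
  obtain ⟨c, hc₀, hc⟩ := h.exists_isVelocityError_frozenVelocity2 hL hT
  refine ⟨1 + 8 * M ^ 2 * (L ^ 2 + 1) * c, by positivity, fun N w hw k hk =>
    ⟨(h.isEvolution_curl2_sub hT hw hk).continuousOn_energy, fun t _ => sqError2_nonneg L u _ t,
      fun t ht => (h.hasDerivAt_sqError2 hL hT hw hk ht
        (hc N w hw k hk t (Ioo_subset_Icc_self ht))).differentiableAt, fun t ht => ?_⟩⟩
  set a := gridTime T N k
  set b := gridTime T N (k + 1)
  have error_nonneg (s : ℝ) : 0 ≤ sqError2 L u (w k) s := sqError2_nonneg L u (w k) s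
  have t_mem : t ∈ Icc 0 T := Icc_subset_Icc (gridTime_nonneg hT.le N k)
    (gridTime_le hT.le (by omega) hk) (Ioo_subset_Icc_self ht)
  have rate_le : sqError2 L u (w k) t
      ≤ (1 + 8 * M ^ 2 * (L ^ 2 + 1) * c) * (1 + sqError2 L u (w k) b ^ 2)
        * sqError2 L u (w k) t :=
    le_mul_of_one_le_left (error_nonneg t) (one_le_mul_of_one_le_of_one_le
      (le_add_of_nonneg_right (by positivity)) (le_add_of_nonneg_right (sq_nonneg _)))
  have source_nonneg : 0 ≤ (b - a) ^ 2 + sqError2 L u (w k) b :=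
    add_nonneg (sq_nonneg _) (error_nonneg b)
  linarith [h.neg_le_deriv_sqError2 hL hT hw hk ht (hc N w hw k hk t (Ioo_subset_Icc_self ht))
    (hM t t_mem)]

end DimensionTwo

end IsNSESolution

/-- The forcing of the `i`-th component of the vorticity error `z` by the velocity error `ν` and by
`z` itself, without the quadratic term `(z · ∇) ν`. -/
noncomputable def linearForcing (u ω ν z : E n → E n) (i : Fin n) (x : E n) : ℝ :=
  advect ν (fun x => ω x i) x - advect ω (fun x => ν x i) x - advect z (fun x => u x i) x

lemma continuous_linearForcing {u ω ν z : E n → E n} (hu : ContDiff ℝ 1 u) (hω : ContDiff ℝ 1 ω)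
    (hν : ContDiff ℝ 1 ν) (hz : Continuous z) (i : Fin n) :
    Continuous (linearForcing u ω ν z i) :=
  ((continuous_advect hν.continuous (contDiff_euclidean.1 hω i)).sub
    (continuous_advect hω.continuous (contDiff_euclidean.1 hν i))).sub
    (continuous_advect hz (contDiff_euclidean.1 hu i))

lemma integral_sub_sub_sq_le {f g h : E n → ℝ} (hf : Continuous f) (hg : Continuous g)
    (hh : Continuous h) :
    ∫ x in cell n L, (f x - g x - h x) ^ 2
      ≤ 3 * ((∫ x in cell n L, f x ^ 2) + (∫ x in cell n L, g x ^ 2)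
          + ∫ x in cell n L, h x ^ 2) := by
  rw [← integral_add (integrableOn_cell (by fun_prop)) (integrableOn_cell (by fun_prop)),
    ← integral_add (integrableOn_cell (by fun_prop)) (integrableOn_cell (by fun_prop)),
    ← integral_const_mul]
  refine setIntegral_mono (integrableOn_cell (by fun_prop)) (integrableOn_cell (by fun_prop))
    fun x => ?_
  dsimp only
  linarith [sq_nonneg (f x + g x), sq_nonneg (f x + h x), sq_nonneg (g x - h x)]

namespace IsVelocityError

variable {Y M : ℝ} {u ω V z : E n → E n}

lemma integral_linearForcing_sq_le (hV : IsVelocityError L Y V) (hu : ContDiff ℝ 1 u)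
    (hω : ContDiff ℝ 1 ω) (hz : Continuous z) (hωM : ∀ x ∈ cell n L, ‖ω x‖ ≤ M)
    (hdωM : ∀ x ∈ cell n L, ‖fderiv ℝ ω x‖ ≤ M) (hduM : ∀ x ∈ cell n L, ‖fderiv ℝ u x‖ ≤ M)
    (i : Fin n) :
    ∫ x in cell n L, linearForcing u ω V z i x ^ 2
      ≤ 6 * n ^ 3 * M ^ 2 * (L ^ 2 + 1) * Y
        + 3 * n * M ^ 2 * ∑ j, ∫ x in cell n L, z x j ^ 2 := by
  have abs_deriv_le {v : E n → E n} (hv : ContDiff ℝ 1 v)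
      (hM : ∀ x ∈ cell n L, ‖fderiv ℝ v x‖ ≤ M) (j : Fin n) (x : E n) (hx : x ∈ cell n L) :
      |partialDeriv j (fun x => v x i) x| ≤ M := by
    rw [← partialDeriv_apply (hv.differentiable one_ne_zero x)]
    exact (abs_partialDeriv_apply_le v x i j).trans (hM x hx)
  have transport_le :=
    hV.integral_advect_sq_le (contDiff_euclidean.1 hω i) (abs_deriv_le hω hdωM)
  have stretching_le := hV.integral_advect_apply_sq_le hω.continuous
    (fun j x hx => (PiLp.norm_apply_le (ω x) j).trans (hωM x hx)) i
  have error_stretching_le := integral_advect_sq_le_of_abs_partialDeriv_le hz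
    (contDiff_euclidean.1 hu i) (abs_deriv_le hu hduM)
  have continuous_transport := continuous_advect hV.contDiff.continuous (contDiff_euclidean.1 hω i)
  have continuous_stretching :=
    continuous_advect hω.continuous (contDiff_euclidean.1 hV.contDiff i)
  have continuous_error_stretching := continuous_advect hz (contDiff_euclidean.1 hu i)
  have forcing_le := integral_sub_sub_sq_le (L := L) continuous_transport continuous_stretching
    continuous_error_stretching
  simp only [linearForcing]
  linarith

lemma neg_le_sum_integral_mul_linearForcing (hV : IsVelocityError L Y V) (hu : ContDiff ℝ 1 u)
    (hω : ContDiff ℝ 1 ω) (hz : Continuous z) (hωM : ∀ x ∈ cell n L, ‖ω x‖ ≤ M)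
    (hdωM : ∀ x ∈ cell n L, ‖fderiv ℝ ω x‖ ≤ M) (hduM : ∀ x ∈ cell n L, ‖fderiv ℝ u x‖ ≤ M) :
    -((1 + 3 * n ^ 2 * M ^ 2) * ∑ i, (∫ x in cell n L, z x i ^ 2)
        + 6 * n ^ 4 * M ^ 2 * (L ^ 2 + 1) * Y)
      ≤ ∑ i, 2 * ∫ x in cell n L, z x i * linearForcing u ω V z i x := by
  calc -((1 + 3 * n ^ 2 * M ^ 2) * ∑ i, (∫ x in cell n L, z x i ^ 2)
        + 6 * n ^ 4 * M ^ 2 * (L ^ 2 + 1) * Y)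
      = ∑ i, -((∫ x in cell n L, z x i ^ 2) + (6 * n ^ 3 * M ^ 2 * (L ^ 2 + 1) * Y
          + 3 * n * M ^ 2 * ∑ j, ∫ x in cell n L, z x j ^ 2)) := by
        rw [Finset.sum_neg_distrib, Finset.sum_add_distrib, Finset.sum_const, Finset.card_univ,
          Fintype.card_fin, nsmul_eq_mul]
        ring
    _ ≤ ∑ i, -((∫ x in cell n L, z x i ^ 2)
          + ∫ x in cell n L, linearForcing u ω V z i x ^ 2) := by
        gcongr with i
        exact hV.integral_linearForcing_sq_le hu hω hz hωM hdωM hduM i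
    _ ≤ ∑ i, 2 * ∫ x in cell n L, z x i * linearForcing u ω V z i x := by
        gcongr with i
        exact neg_add_le_two_mul_integral_mul
          ((EuclideanSpace.proj (𝕜 := ℝ) i).continuous.comp hz)
          (continuous_linearForcing hu hω hV.contDiff hz i)

end IsVelocityError

namespace IsNSESolution

section DimensionThree

variable {f : ℝ → E 3 → E 3} {φ : E 3 → E 3} {u : ℝ → E 3 → E 3} {p : ℝ → E 3 → ℝ}
  {N k : ℕ} {w : ℕ → ℝ → E 3 → E 3} {t : ℝ}

lemma isEvolution_curl3_sub (h : IsNSESolution L T σ f φ u p) (hT : 0 < T)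
    (hw : IsFrozenApprox3 L T σ f φ N w) (hk : k < N) (i : Fin 3) :
    IsEvolution L (gridTime T N k) (gridTime T N (k + 1))
      (fun t x => curl3 (u t) x i - w k t x i)
      fun t x => timeDeriv T (fun t x => curl3 (u t) x i) t x
        - derivWithin (fun s => w k s x) (Icc (gridTime T N k) (gridTime T N (k + 1))) t i :=
  (((h.isJointlyContDiff_curl3 hT).apply i).isEvolution hT
    (fun t ht => (h.periodic_velocity t ht).curl3.comp (· i))
    (gridTime_nonneg hT.le N k) (gridTime_le hT.le (by omega) hk)).sub
    ((hw.classical k hk).isEvolution_apply (hw.periodic k hk) i)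

lemma curl3_sub_equation (h : IsNSESolution L T σ f φ u p) (hT : 0 < T)
    (hw : IsFrozenApprox3 L T σ f φ N w) (hk : k < N)
    (ht : t ∈ Ioo (gridTime T N k) (gridTime T N (k + 1)))
    (hv : Differentiable ℝ (frozenVelocity3 L T N w k)) (i : Fin 3) (x : E 3) :
    timeDeriv T (fun t x => curl3 (u t) x i) t x
        - derivWithin (fun s => w k s x) (Icc (gridTime T N k) (gridTime T N (k + 1))) t i
      = -(σ ^ 2 / 2 * (Δ fun x => curl3 (u t) x i - w k t x i) x)
        + advect (frozenVelocity3 L T N w k) (fun x => curl3 (u t) x i - w k t x i) x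
        + (linearForcing (u t) (curl3 (u t)) (fun x => u t x - frozenVelocity3 L T N w k x)
            (fun x => curl3 (u t) x - w k t x) i x
          + advect (fun x => curl3 (u t) x - w k t x)
            (fun x => (u t x - frozenVelocity3 L T N w k x) i) x) := by
  have t_mem : t ∈ Ioo 0 T :=
    Ioo_subset_Ioo (gridTime_nonneg hT.le N k) (gridTime_le hT.le (by omega) hk) ht
  have contDiff_curl : ContDiff ℝ 2 (curl3 (u t)) :=
    (h.isJointlyContDiff_curl3 hT).slice (Ioo_subset_Icc_self t_mem)
  have contDiff_w : ContDiff ℝ 2 (w k t) :=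
    (hw.classical k hk).space_diff t (Ioo_subset_Ico_self ht)
  have differentiable_u : Differentiable ℝ (u t) :=
    (h.isJointlyContDiff.slice (Ioo_subset_Icc_self t_mem)).differentiable (by norm_num)
  have contDiff_curl_apply := contDiff_euclidean.1 contDiff_curl i
  have contDiff_w_apply := contDiff_euclidean.1 contDiff_w i
  have frozen_equation := congrArg (· i) (hw.equation k hk t (Ioo_subset_Ico_self ht) x)
  rw [← frozenVelocity3] at frozen_equation
  simp only [PiLp.add_apply, PiLp.sub_apply, PiLp.smul_apply, PiLp.zero_apply, smul_eq_mul,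
    laplacian_apply contDiff_w, advect_apply (contDiff_w.differentiable two_ne_zero x),
    advect_apply (hv x)] at frozen_equation
  have curl_equation := h.curl3_equation t_mem x i
  rw [advect_apply (differentiable_u x)] at curl_equation
  simp only [linearForcing, PiLp.sub_apply, advect_sub_left,
    advect_sub (contDiff_curl_apply.differentiable two_ne_zero x)
      (contDiff_w_apply.differentiable two_ne_zero x),
    advect_sub (differentiableAt_euclidean.1 (differentiable_u x) i)
      (differentiableAt_euclidean.1 (hv x) i),
    laplacian_sub contDiff_curl_apply contDiff_w_apply]
  linear_combination curl_equation - frozen_equation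

lemma hasDerivAt_sqError3 (h : IsNSESolution L T σ f φ u p) (hL : 0 < L) (hT : 0 < T)
    (hw : IsFrozenApprox3 L T σ f φ N w) (hk : k < N)
    (ht : t ∈ Ioo (gridTime T N k) (gridTime T N (k + 1))) {Y : ℝ}
    (hV : IsVelocityError L Y fun x => u t x - frozenVelocity3 L T N w k x) :
    HasDerivAt (sqError3 L u (w k))
      (σ ^ 2 * (∑ i, dissipation L fun x => (curl3 (u t) x - w k t x) i)
        + (∑ i, 2 * ∫ x in cell 3 L, (curl3 (u t) x - w k t x) i
          * linearForcing (u t) (curl3 (u t)) (fun x => u t x - frozenVelocity3 L T N w k x)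
            (fun x => curl3 (u t) x - w k t x) i x)
        + ∑ i, 2 * ∫ x in cell 3 L, (curl3 (u t) x - w k t x) i
          * advect (fun x => curl3 (u t) x - w k t x)
            (fun x => (u t x - frozenVelocity3 L T N w k x) i) x) t := by
  have t_mem : t ∈ Icc 0 T := Icc_subset_Icc (gridTime_nonneg hT.le N k)
    (gridTime_le hT.le (by omega) hk) (Ioo_subset_Icc_self ht)
  obtain ⟨contDiff_frozen, periodic_frozen, div_frozen⟩ := h.regular_of_isVelocityError_sub t_mem hV
  have contDiff_u : ContDiff ℝ 1 (u t) := (h.isJointlyContDiff.slice t_mem).of_le (by norm_num)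
  have contDiff_curl : ContDiff ℝ 1 (curl3 (u t)) :=
    ((h.isJointlyContDiff_curl3 hT).slice t_mem).of_le one_le_two
  have continuous_error : Continuous fun x => curl3 (u t) x - w k t x :=
    contDiff_curl.continuous.sub
      ((hw.classical k hk).space_diff t (Ioo_subset_Ico_self ht)).continuous
  have continuous_component (i : Fin 3) : Continuous fun x => (curl3 (u t) x - w k t x) i :=
    (EuclideanSpace.proj (𝕜 := ℝ) i).continuous.comp continuous_error
  have continuous_linear (i : Fin 3) :=
    continuous_linearForcing contDiff_u contDiff_curl hV.contDiff continuous_error i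
  have continuous_stretching (i : Fin 3) :=
    continuous_advect continuous_error (contDiff_euclidean.1 hV.contDiff i)
  have hasDerivAt_sum := HasDerivAt.fun_sum fun i (_ : i ∈ Finset.univ) =>
    (h.isEvolution_curl3_sub hT hw hk i).hasDerivAt_energy_of_equation hL ht periodic_frozen
      contDiff_frozen div_frozen ((continuous_linear i).fun_add (continuous_stretching i))
      (h.curl3_sub_equation hT hw hk ht (contDiff_frozen.differentiable one_ne_zero) i)
  convert! hasDerivAt_sum using 1
  rw [Finset.mul_sum, ← Finset.sum_add_distrib, ← Finset.sum_add_distrib]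
  refine Finset.sum_congr rfl fun i _ => ?_
  simp only [← PiLp.sub_apply, mul_add]
  rw [integral_add (integrableOn_cell ((continuous_component i).fun_mul (continuous_linear i)))
    (integrableOn_cell ((continuous_component i).fun_mul (continuous_stretching i))), mul_add,
    add_assoc]

lemma exists_bound_curl3 (h : IsNSESolution L T σ f φ u p) (hT : 0 < T) (L : ℝ) :
    ∃ M, ∀ t ∈ Icc 0 T, ∀ x ∈ cell 3 L,
      ‖curl3 (u t) x‖ ≤ M ∧ ‖fderiv ℝ (curl3 (u t)) x‖ ≤ M ∧ ‖fderiv ℝ (u t) x‖ ≤ M := by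
  have smooth_curl := h.isJointlyContDiff_curl3 hT
  obtain ⟨M₀, hM₀⟩ := (smooth_curl.mono zero_le_two).exists_bound L
  obtain ⟨M₁, hM₁⟩ := (smooth_curl.fderiv hT (k := 0) (by norm_num)).exists_bound L
  obtain ⟨M₂, hM₂⟩ := (h.isJointlyContDiff.fderiv hT (k := 0) (by norm_num)).exists_bound L
  exact ⟨max M₀ (max M₁ M₂), fun t ht x hx => ⟨(hM₀ t ht x hx).trans (le_max_left _ _),
    (hM₁ t ht x hx).trans (le_max_of_le_right (le_max_left _ _)),
    (hM₂ t ht x hx).trans (le_max_of_le_right (le_max_right _ _))⟩⟩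

lemma exists_neg_le_deriv_sqError3 (h : IsNSESolution L T σ f φ u p) (hL : 0 < L) (hT : 0 < T)
    (hσ : σ ≠ 0) :
    ∃ C : ℝ, 0 ≤ C ∧ ∀ N w, IsFrozenApprox3 L T σ f φ N w → ∀ k < N,
      ∀ t ∈ Ioo (gridTime T N k) (gridTime T N (k + 1)), ∀ Y, 0 ≤ Y →
        IsVelocityError L Y (fun x => u t x - frozenVelocity3 L T N w k x) →
          -(C * (1 + Y ^ 2) * sqError3 L u (w k) t + C * Y) ≤ deriv (sqError3 L u (w k)) t := by
  obtain ⟨M, hM⟩ := h.exists_bound_curl3 hT L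
  obtain ⟨K, hK₀, hK⟩ := exists_le_sum_integral_mul_stretching hL (pow_pos (abs_pos.2 hσ) 2)
  rw [sq_abs] at hK
  refine ⟨1 + 27 * M ^ 2 + K * (1 + 9 * (L ^ 2 + 1) ^ 2) + 486 * M ^ 2 * (L ^ 2 + 1), by positivity,
    fun N w hw k hk t ht Y hY hV => ?_⟩
  have t_mem : t ∈ Icc 0 T := Icc_subset_Icc (gridTime_nonneg hT.le N k)
    (gridTime_le hT.le (by omega) hk) (Ioo_subset_Icc_self ht)
  have contDiff_u : ContDiff ℝ 1 (u t) := (h.isJointlyContDiff.slice t_mem).of_le (by norm_num)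
  have contDiff_curl : ContDiff ℝ 1 (curl3 (u t)) :=
    ((h.isJointlyContDiff_curl3 hT).slice t_mem).of_le one_le_two
  have contDiff_error : ContDiff ℝ 1 fun x => curl3 (u t) x - w k t x :=
    contDiff_curl.sub
      (((hw.classical k hk).space_diff t (Ioo_subset_Ico_self ht)).of_le one_le_two)
  have periodic_error : IsPeriodic L fun x => curl3 (u t) x - w k t x :=
    (h.periodic_velocity t t_mem).curl3.comp₂ (hw.periodic k hk t (Ioo_subset_Icc_self ht)) (· - ·)
  have linear_ge := hV.neg_le_sum_integral_mul_linearForcing contDiff_u contDiff_curl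
    contDiff_error.continuous (fun x hx => (hM t t_mem x hx).1) (fun x hx => (hM t t_mem x hx).2.1)
    fun x hx => (hM t t_mem x hx).2.2
  have stretching_ge := hK _ periodic_error contDiff_error _ hV.contDiff _ hV.deriv_sq_le
  rw [(h.hasDerivAt_sqError3 hL hT hw hk ht hV).deriv]
  have error_eq : ∑ i, ∫ x in cell 3 L, (curl3 (u t) x - w k t x) i ^ 2
      = sqError3 L u (w k) t := rfl
  rw [error_eq] at linear_ge stretching_ge
  push_cast at linear_ge stretching_ge
  have error_nonneg := sqError3_nonneg L u (w k) t
  have slack_nonneg : 0 ≤ (Y ^ 2 * (1 + 27 * M ^ 2) + K * (Y ^ 2 + 9 * (L ^ 2 + 1) ^ 2)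
      + 486 * M ^ 2 * (L ^ 2 + 1) * (1 + Y ^ 2)) * sqError3 L u (w k) t
      + (1 + 27 * M ^ 2 + K * (1 + 9 * (L ^ 2 + 1) ^ 2)) * Y := by positivity
  linarith

lemma exists_isStepEnergy_sqError3 (h : IsNSESolution L T σ f φ u p) (hL : 0 < L) (hT : 0 < T)
    (hσ : σ ≠ 0) :
    ∃ C : ℝ, 0 ≤ C ∧ ∀ N w, IsFrozenApprox3 L T σ f φ N w → ∀ k < N,
      IsStepEnergy C (gridTime T N k) (gridTime T N (k + 1)) (sqError3 L u (w k)) := by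
  obtain ⟨C, hC₀, hC⟩ := h.exists_neg_le_deriv_sqError3 hL hT hσ
  obtain ⟨c, hc₀, hc⟩ := h.exists_isVelocityError_frozenVelocity3 hL hT
  refine ⟨C * (1 + 2 * c ^ 2 * (T ^ 4 + 1)) + C * c, by positivity, fun N w hw k hk =>
    ⟨continuousOn_finsetSum _ fun i _ => (h.isEvolution_curl3_sub hT hw hk i).continuousOn_energy,
      fun t _ => sqError3_nonneg L u _ t, fun t ht => (h.hasDerivAt_sqError3 hL hT hw hk ht
        (hc N w hw k hk t (Ioo_subset_Icc_self ht))).differentiableAt, fun t ht => ?_⟩⟩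
  set a := gridTime T N k
  set b := gridTime T N (k + 1)
  set y := sqError3 L u (w k)
  have error_nonneg (s : ℝ) : 0 ≤ y s := sqError3_nonneg L u (w k) s
  have step_nonneg : 0 ≤ b - a := sub_nonneg.2 (gridTime_le_succ hT.le N k)
  have step_le : b - a ≤ T := (sub_le_self b (gridTime_nonneg hT.le N k)).trans
    (gridTime_le hT.le (by omega) hk)
  set Y := c * ((b - a) ^ 2 + y b)
  have velocity_nonneg : 0 ≤ Y := mul_nonneg hc₀ (add_nonneg (sq_nonneg _) (error_nonneg b))
  have velocity_sq_le : Y ^ 2 ≤ 2 * c ^ 2 * (T ^ 4 + y b ^ 2) := by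
    calc Y ^ 2 = c ^ 2 * ((b - a) ^ 2 + y b) ^ 2 := mul_pow _ _ _
      _ ≤ c ^ 2 * (2 * (((b - a) ^ 2) ^ 2 + y b ^ 2)) := by gcongr; exact add_sq_le
      _ = 2 * c ^ 2 * ((b - a) ^ 4 + y b ^ 2) := by ring
      _ ≤ 2 * c ^ 2 * (T ^ 4 + y b ^ 2) := by gcongr
  have rate_le : 1 + Y ^ 2 ≤ (1 + 2 * c ^ 2 * (T ^ 4 + 1)) * (1 + y b ^ 2) := by
    have slack_nonneg : 0 ≤ y b ^ 2 + 2 * c ^ 2 * (1 + T ^ 4 * y b ^ 2) := by positivity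
    linarith
  calc -((C * (1 + 2 * c ^ 2 * (T ^ 4 + 1)) + C * c) * (1 + y b ^ 2) * y t
        + (C * (1 + 2 * c ^ 2 * (T ^ 4 + 1)) + C * c) * ((b - a) ^ 2 + y b))
      ≤ -(C * ((1 + 2 * c ^ 2 * (T ^ 4 + 1)) * (1 + y b ^ 2)) * y t + C * Y) := by
        have rate_slack_nonneg : 0 ≤ C * c * (1 + y b ^ 2) * y t :=
          mul_nonneg (by positivity) (error_nonneg t)
        have source_slack_nonneg :
            0 ≤ C * (1 + 2 * c ^ 2 * (T ^ 4 + 1)) * ((b - a) ^ 2 + y b) :=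
          mul_nonneg (by positivity) (add_nonneg (sq_nonneg _) (error_nonneg b))
        simp only [Y]
        linarith
    _ ≤ -(C * (1 + Y ^ 2) * y t + C * Y) := by
        gcongr
        exact error_nonneg t
    _ ≤ deriv y t := hC N w hw k hk t ht Y velocity_nonneg
        (hc N w hw k hk t (Ioo_subset_Icc_self ht))

end DimensionThree

end IsNSESolution

namespace IsNSESolution

lemma exists_l2Norm_curl2_sub_le {f : ℝ → E 2 → E 2} {φ : E 2 → E 2} {u : ℝ → E 2 → E 2}
    {p : ℝ → E 2 → ℝ} (h : IsNSESolution L T σ f φ u p) (hL : 0 < L) (hT : 0 < T) :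
    ∃ K : ℝ, ∀ N w, IsFrozenApprox2 L T σ f φ N w →
      ∀ k < N, ∀ t ∈ Icc (gridTime T N k) (gridTime T N (k + 1)),
        l2Norm L (fun x => curl2 (u t) x - w k t x) ≤ K * (T / N) := by
  obtain ⟨C, hC₀, hC⟩ := h.exists_isStepEnergy_sqError2 hL hT
  obtain ⟨K, hK⟩ := exists_sqrt_gridEnergy_le hC₀ hT.le
  refine ⟨K, fun N w hw k hk t ht => ?_⟩
  have gridEnergy : IsGridEnergy C T N fun k => sqError2 L u (w k) := by
    refine ⟨hC N w hw, fun k hk => ?_⟩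
    simp only [sqError2, hw.terminal k hk]
    split_ifs with last_step
    · simp [last_step, gridTime_self T (Nat.ne_zero_of_lt hk), h.terminal]
    · rfl
  simpa only [l2Norm, sqError2, Real.norm_eq_abs, sq_abs] using hK N _ gridEnergy k hk t ht

lemma exists_l2Norm_curl3_sub_le {f : ℝ → E 3 → E 3} {φ : E 3 → E 3} {u : ℝ → E 3 → E 3}
    {p : ℝ → E 3 → ℝ} (h : IsNSESolution L T σ f φ u p) (hL : 0 < L) (hT : 0 < T) (hσ : σ ≠ 0) :
    ∃ K : ℝ, ∀ N w, IsFrozenApprox3 L T σ f φ N w →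
      ∀ k < N, ∀ t ∈ Icc (gridTime T N k) (gridTime T N (k + 1)),
        l2Norm L (fun x => curl3 (u t) x - w k t x) ≤ K * (T / N) := by
  obtain ⟨C, hC₀, hC⟩ := h.exists_isStepEnergy_sqError3 hL hT hσ
  obtain ⟨K, hK⟩ := exists_sqrt_gridEnergy_le hC₀ hT.le
  refine ⟨K, fun N w hw k hk t ht => ?_⟩
  have gridEnergy : IsGridEnergy C T N fun k => sqError3 L u (w k) := by
    refine ⟨hC N w hw, fun k hk => ?_⟩
    simp only [sqError3, hw.terminal k hk]
    split_ifs with last_step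
    · simp [last_step, gridTime_self T (Nat.ne_zero_of_lt hk), h.terminal]
    · rfl
  have continuous_error (i : Fin 3) : Continuous fun x => curl3 (u t) x i - w k t x i :=
    continuous_slice (z := fun t x => curl3 (u t) x i - w k t x i)
      (h.isEvolution_curl3_sub hT hw hk i).continuousOn ht
  have sqError_eq : ∫ x in cell 3 L, ‖curl3 (u t) x - w k t x‖ ^ 2 = sqError3 L u (w k) t := by
    simp only [EuclideanSpace.real_norm_sq_eq, PiLp.sub_apply]
    exact integral_finsetSum _ fun i _ => integrableOn_cell ((continuous_error i).pow 2)
  simpa only [l2Norm, sqError_eq] using hK N _ gridEnergy k hk t ht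

end IsNSESolution

end PeriodicNSE

theorem mainTheorem2 (L T σ : ℝ) (hL : 0 < L) (hT : 0 < T) (hσ : σ ≠ 0) :
    (∀ (f : ℝ → PeriodicNSE.E 2 → PeriodicNSE.E 2) (φ : PeriodicNSE.E 2 → PeriodicNSE.E 2)
        (u : ℝ → PeriodicNSE.E 2 → PeriodicNSE.E 2) (p : ℝ → PeriodicNSE.E 2 → ℝ),
        PeriodicNSE.IsNSESolution L T σ f φ u p →
        ∃ K : ℝ, ∀ N : ℕ, 1 ≤ N → ∀ w : ℕ → ℝ → PeriodicNSE.E 2 → ℝ,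
          PeriodicNSE.IsFrozenApprox2 L T σ f φ N w →
          ∀ k < N, ∀ t ∈ Set.Icc (PeriodicNSE.gridTime T N k) (PeriodicNSE.gridTime T N (k + 1)),
            PeriodicNSE.l2Norm L (fun x => PeriodicNSE.curl2 (u t) x - w k t x) ≤ K * (T / N)) ∧
    (∀ (f : ℝ → PeriodicNSE.E 3 → PeriodicNSE.E 3) (φ : PeriodicNSE.E 3 → PeriodicNSE.E 3)
        (u : ℝ → PeriodicNSE.E 3 → PeriodicNSE.E 3) (p : ℝ → PeriodicNSE.E 3 → ℝ),
        PeriodicNSE.IsNSESolution L T σ f φ u p →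
        ∃ K : ℝ, ∀ N : ℕ, 1 ≤ N → ∀ w : ℕ → ℝ → PeriodicNSE.E 3 → PeriodicNSE.E 3,
          PeriodicNSE.IsFrozenApprox3 L T σ f φ N w →
          ∀ k < N, ∀ t ∈ Set.Icc (PeriodicNSE.gridTime T N k) (PeriodicNSE.gridTime T N (k + 1)),
            PeriodicNSE.l2Norm L (fun x => PeriodicNSE.curl3 (u t) x - w k t x) ≤ K * (T / N)) :=
  ⟨fun _ _ _ _ h =>
      let ⟨K, hK⟩ := h.exists_l2Norm_curl2_sub_le hL hT
      ⟨K, fun N _ => hK N⟩,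
    fun _ _ _ _ h =>
      let ⟨K, hK⟩ := h.exists_l2Norm_curl3_sub_le hL hT hσ
      ⟨K, fun N _ => hK N⟩⟩
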